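/- Let $H=\sum_{j=1}^N\left[1-\sigma^z_j\sigma^z_{j+1}-\epsilon\,\sigma^x_j\sigma^x_{j+1}-\epsilon\,\sigma^y_j\sigma^y_{j+1}\right]$ be the ferromagnetic XXZ Hamiltonian on $(\mathbb C^2)^{\otimes N}$ with real $\epsilon$ and periodic boundary conditions (sites are taken modulo $N$). For a set $Y$ of sites let $|Y\rangle$ be the basis state with down spins exactly on $Y$, let $Y+l$ be the translate of $Y$ by $l$, and let $\partial Y$ be the set of $j$ such that exactly one of $j,j+1$ lies in $Y$. Let $T|Y\rangle=|Y+1\rangle$; a vector $\psi$ has momentum $k$ if $T\psi=e^{-ik}\psi$. Fix $m$ with $0<m<N$ and put $M=\{1,\dots,m\}$. Write $X:m$ if $|X\Delta M|=m$, and let $n(X)$ be the number of elements of $\partial(X\Delta M)$. The unknowns $e$ are real numbers $e(X)$ for $X:m$ with $n(X)>2$, and $e_s$ for $s\in\mathbb Z/N$. Put $e(\emptyset)=1$ and $e(X)=0$ for the other $X:m$ with $n(X)=2$. The fixed-point equation $F(e)=e$ consists of $$e_s=-2\epsilon\sum_{j\in\partial(M-s)}e\big(M\Delta(M-s)\Delta\{j,j+1\}\big)\qquad(s\in\mathbb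 Z/N),$$ $$e(X)=\frac{\epsilon}{n(X)-2}\sum_{j\in\partial(X\Delta M)}e\big(X\Delta\{j,j+1\}\big)+\frac{1}{2(n(X)-2)}\sum_{s}e_s\,e\big((X+s)\Delta(M+s)\Delta M\big)$$ for all $X:m$ with $n(X)>2$. Let $w(X)$ be the least $r$ for which there are sets $X_0=\emptyset,X_1,\dots,X_r=X$ with $X_{i+1}=X_i\Delta\{j,j+1\}$ for some $j\in\partial(X_i\Delta M)$, let $w_s=w(M\Delta(M+s))$, and for $K>0$ put $$\|e\|=\sum_{s}|e_s|(K|\epsilon|)^{-w_s}+2\sum_{X:m,\;n(X)>2}|e(X)|\,(n(X)-2)\,(K|\epsilon|)^{-w(X)}$$ (for $\epsilon=0$, where the only solution is $e=0$, negative powers of $0$ are read as $0$). For real $k$ define $$\Psi_k=\sum_{l=1}^Ne^{ikl}\sum_{X:m}e(X)\,|(X\Delta M)+l\rangle,\qquad E_N(k)=4+\sum_{-N/2<s\le N/2}e_s\,e^{iks}.$$ **Theorem.** There are constants $K>0$ and $\delta>0$ (independent of $N$, $m$ and $\epsilon$) such that, whenever $K|\epsilon|<1$ and $0<m<N$: 1.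 The fixed-point equation has exactly one solution $e$ with $\|e\|\le\delta$. From now on $\Psi_k$ and $E_N(k)$ are formed with this solution. 2. For each of the $N$ momenta $k=2\pi p/N$, $p=0,\dots,N-1$, the vector $\Psi_k$ is nonzero, lies in the sector with $m$ down spins, has momentum $k$, and satisfies $H\Psi_k=E_N(k)\Psi_k$. The number $E_N(k)$ is real, and it is the lowest eigenvalue of $H$ on the vectors of momentum $k$ in this sector. 3. These $N$ eigenvalues are the lowest in the sector: every eigenvector of $H$ in the sector that is orthogonal to all $N$ of the $\Psi_k$ has an eigenvalue larger than each of the $E_N(k)$. 4. The two fully polarized states (all spins up, all spins down), which do not belong to the sector, have momentum $0$ and eigenvalue $0$, and $E_N(0)>0$. If these two states are added to the sector, then $E_N(0)$ is the second lowest eigenvalue with momentum $0$, i.e. every eigenvalue of $H$ with momentum $0$ on the span of the sector and these two states is either $0$ or at least $E_N(0)$. 5. For fixed $m$ and $\epsilon$ there are real constants $d_s$, $s\in\mathbb Z$, with $\sum_s|d_s|<\infty$ such that $$\lim_{N\to\infty}E_N(k)=4+\sum_{s=-\infty}^{\infty}d_s\,e^{iks}\qquad\text{for every real }k,$$ and $|d_s|\le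 C|\epsilon|^m$ for all $s\ne0$, where $C$ depends only on $m$. -/

import Mathlib

open scoped symmDiff

noncomputable section

namespace XXZ

/-! ### The periodic XXZ chain

Sites are the elements of `ZMod N`, so that site `N + 1` is site `1`.  A spin configuration assigns
to every site the basis vector `0` (spin up) or `1` (spin down) of `ℂ²`; a state is a vector of the
`N`-fold tensor power of `ℂ²`, given by its coordinates in the basis of spin configurations. -/

abbrev Config (N : ℕ) : Type := ZMod N → Fin 2

abbrev State (N : ℕ) : Type := Config N → ℂ

def pauliX : Matrix (Fin 2) (Fin 2) ℂ := !![0, 1; 1, 0]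

def pauliY : Matrix (Fin 2) (Fin 2) ℂ := !![0, -Complex.I; Complex.I, 0]

def pauliZ : Matrix (Fin 2) (Fin 2) ℂ := !![1, 0; 0, -1]

/-- The operator that acts by the matrix `A` on the tensor factor at site `j` and trivially on the
other factors. -/
def siteOp {N : ℕ} (A : Matrix (Fin 2) (Fin 2) ℂ) (j : ZMod N) : Module.End ℂ (State N) where
  toFun ψ := fun σ => ∑ b : Fin 2, A (σ j) b * ψ (Function.update σ j b)
  map_add' ψ φ := by
    funext σ
    simp only [Pi.add_apply, mul_add, Finset.sum_add_distrib]
  map_smul' c ψ := by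
    funext σ
    simp only [Pi.smul_apply, smul_eq_mul, RingHom.id_apply, Finset.mul_sum]
    exact Finset.sum_congr rfl fun b _ => by ring

/-- `H = ∑ⱼ (1 - σᶻⱼ σᶻⱼ₊₁ - ε σˣⱼ σˣⱼ₊₁ - ε σʸⱼ σʸⱼ₊₁)` with periodic boundary conditions. -/
def hamiltonian (N : ℕ) [NeZero N] (ε : ℝ) : Module.End ℂ (State N) :=
  ∑ j : ZMod N,
    (1 - siteOp pauliZ j * siteOp pauliZ (j + 1)
      - (ε : ℂ) • (siteOp pauliX j * siteOp pauliX (j + 1))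
      - (ε : ℂ) • (siteOp pauliY j * siteOp pauliY (j + 1)))

/-- Translation by one lattice site to the right; it maps `|Y⟩` to `|Y + 1⟩`. -/
def translation (N : ℕ) : Module.End ℂ (State N) :=
  LinearMap.funLeft ℂ ℂ fun (σ : Config N) (j : ZMod N) => σ (j + 1)

/-- The configuration with down spins at the sites of `Y` and up spins elsewhere. -/
def config {N : ℕ} (Y : Finset (ZMod N)) : Config N := fun j => if j ∈ Y then 1 else 0

/-- The basis state `|Y⟩`. -/
def ket {N : ℕ} [NeZero N] (Y : Finset (ZMod N)) : State N := Pi.single (config Y) 1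

/-- The number of down spins. -/
def numDown {N : ℕ} [NeZero N] (σ : Config N) : ℕ :=
  (Finset.univ.filter fun j : ZMod N => σ j = 1).card

/-- `ψ` lies in the sector with `m` down spins. -/
def InSector {N : ℕ} [NeZero N] (m : ℕ) (ψ : State N) : Prop :=
  ∀ σ : Config N, ψ σ ≠ 0 → numDown σ = m

/-- `ψ` has momentum `k`. -/
def HasMomentum {N : ℕ} (k : ℝ) (ψ : State N) : Prop :=
  translation N ψ = Complex.exp (-(Complex.I * k)) • ψ

/-- The momenta of the chain: `2 π p / N` for `p = 0, …, N - 1`. -/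
def momentum (N p : ℕ) : ℝ := 2 * Real.pi * p / N

/-! ### The fixed point equation -/

section

variable {N : ℕ} [NeZero N] {m : ℕ}

/-- `M = {1, …, m}`. -/
def M (N m : ℕ) : Finset (ZMod N) := (Finset.Icc 1 m).image fun i : ℕ => (i : ZMod N)

/-- `Y + l = {i + l : i ∈ Y}`. -/
def shift (Y : Finset (ZMod N)) (l : ZMod N) : Finset (ZMod N) := Y.image fun i => i + l

/-- The boundary of `Y`: the bonds `⟨j, j + 1⟩` with exactly one endpoint in `Y`, where the bond
is labelled by `j`. -/
def bdry (Y : Finset (ZMod N)) : Finset (ZMod N) :=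
  Finset.univ.filter fun j => ¬ (j ∈ Y ↔ j + 1 ∈ Y)

/-- The constraint `X : m`, i.e. `|X ∆ M⟩` has `m` down spins. -/
abbrev InSec (m : ℕ) (X : Finset (ZMod N)) : Prop := (X ∆ M N m).card = m

/-- The number `n(X)` of bonds in the boundary of `X ∆ M`. -/
def nb (m : ℕ) (X : Finset (ZMod N)) : ℕ := (bdry (X ∆ M N m)).card

/-- The sets `X` that label an unknown `e(X)`: `X : m` and `n(X) > 2`. -/
abbrev Excited (m : ℕ) (X : Finset (ZMod N)) : Prop := InSec m X ∧ 2 < nb m X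

variable (N m) in
/-- The unknowns: the `e(X)` for `X : m` with `n(X) > 2`, and the Fourier coefficients `e_s`, for
`s` modulo `N`. -/
@[ext]
structure Unknowns where
  coeff : {X : Finset (ZMod N) // Excited m X} → ℝ
  four : ZMod N → ℝ

/-- `e(X)` for all `X`: the unknowns where `n(X) > 2`, together with the normalization
`e(∅) = 1` and `e(X) = 0` for the other `X` with `n(X) = 2`. -/
def Unknowns.val (e : Unknowns N m) (X : Finset (ZMod N)) : ℝ :=
  if h : Excited m X then e.coeff ⟨X, h⟩ else if X = ∅ then 1 else 0

/-- The map `F` of the fixed point equation `F(e) = e`. -/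
def Fmap (ε : ℝ) (e : Unknowns N m) : Unknowns N m where
  coeff X :=
    ε / ((nb m X.1 : ℝ) - 2) * ∑ j ∈ bdry (X.1 ∆ M N m), e.val (X.1 ∆ {j, j + 1})
      + 1 / (2 * ((nb m X.1 : ℝ) - 2)) *
        ∑ s : ZMod N, e.four s * e.val (shift X.1 s ∆ shift (M N m) s ∆ M N m)
  four s :=
    -(2 * ε * ∑ j ∈ bdry (shift (M N m) (-s)),
        e.val (M N m ∆ shift (M N m) (-s) ∆ {j, j + 1}))

/-- `w(X)`: the least `n` such that there are `X₀ = ∅, X₁, …, Xₙ = X` with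
`Xᵢ₊₁ = Xᵢ ∆ {j, j + 1}` for some bond `j` in the boundary of `Xᵢ ∆ M`. -/
def w (m : ℕ) (X : Finset (ZMod N)) : ℕ :=
  sInf {n : ℕ | ∃ S : ℕ → Finset (ZMod N), S 0 = ∅ ∧ S n = X ∧
    ∀ i < n, ∃ j ∈ bdry (S i ∆ M N m), S (i + 1) = S i ∆ {j, j + 1}}

/-- The weighted norm
`∑ₛ |e_s| (K|ε|)^(-w_s) + 2 ∑_X |e(X)| (n(X) - 2) (K|ε|)^(-w(X))`, with `w_s = w(M ∆ (M + s))`. -/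
def wnorm (K ε : ℝ) (e : Unknowns N m) : ℝ :=
  ∑ s : ZMod N, |e.four s| * (K * |ε|) ^ (-(w m (M N m ∆ shift (M N m) s) : ℤ))
    + 2 * ∑ X : {X : Finset (ZMod N) // Excited m X},
        |e.coeff X| * ((nb m X.1 : ℝ) - 2) * (K * |ε|) ^ (-(w m X.1 : ℤ))

/-- `Ψ_k = ∑_{l=1}^N e^{ikl} ∑_{X : m} e(X) |(X ∆ M) + l⟩`. -/
def droplet (e : Unknowns N m) (k : ℝ) : State N :=
  ∑ l ∈ Finset.Icc 1 N, Complex.exp (Complex.I * k * l) •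
    ∑ X : Finset (ZMod N) with InSec m X,
      (e.val X : ℂ) • ket (shift (X ∆ M N m) (l : ZMod N))

/-- `E_N(k) = 4 + ∑ₛ e_s e^{iks}` for every real `k`.  The sum is over `s` modulo `N`, with
representatives `-N/2 < s ≤ N/2`; at the momenta of the chain their choice does not matter. -/
def energy (e : Unknowns N m) (k : ℝ) : ℂ :=
  4 + ∑ s : ZMod N, (e.four s : ℂ) * Complex.exp (Complex.I * k * (s.valMinAbs : ℂ))

end

end XXZ

end

open XXZ

/-!
The proof works with configurations `Y = X ∆ M` in place of `X`, so that the unknown `e(X)` becomes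
an amplitude `u(Y)`, and `w(X)` becomes the distance from `M` to `Y` in the graph whose edges are
hops of a single down spin (`w_eq_dist`).

*The fixed point.* Write `W(Y) = ρ ^ dist(M, Y)` with `ρ = (K|ε|)⁻¹`.  The linear terms of the fixed
point map replace a configuration by one a single hop away, which costs a factor `ρ` in the weight,
and `|ε| ρ = 1 / K`; a configuration is reached by as many hops as it has domain walls, and
`n ≤ 3 (n - 2)` for `n > 2`, so the division by `n - 2` compensates this number
(`tsum_linear_le`).  The quadratic term is controlled by the triangle inequality
`dist(M, Y) ≤ dist(M, M - s) + dist(M, Y + s)` (`tsum_quadratic_le`).  Hence for `K = 100` the map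
contracts the ball of radius `δ = 1 / 4` into itself.  The estimate is carried out in `ℝ≥0∞`, on any
commutative ring in place of `ZMod N` and for any weight with these properties (`WeightData`), so
that it applies to the rings `ZMod N`, and with the trivial weight to the infinite chain `ℤ` as
well.  Of connectivity by hops only the fact that `M` reaches its translates is needed
(`reachable_M_translate`): for a configuration out of reach `w` would be zero by definition, and the
inequalities hold for it all the same.

*The eigenvectors.* On a ring the configurations with at most two domain walls are the translates
of `M` (`exists_translate_of_card_walls_le`), so the fixed point equation is equivalent to one
linear equation for all `Y` (`amp_equation`).  Multiplied by the character `s ↦ e^{iks}` and summed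
over translations, it is the eigenvalue equation for `Ψ_k` (`hamiltonian_droplet`).

*The gap.* As quadratic forms `H ≥ 2 (1 - |ε|) n`, where `n` is the number of domain walls
(`le_re_dotProduct_hamiltonian`).  The energies `E_N(k)` lie within `1 / 4` of `4`.  If an
eigenvector `φ` of momentum `k` in the sector is orthogonal to `Ψ_k` and its eigenvalue is at most
`9 / 2`, then so is the energy of `φ - φ(M) Ψ_k`; but this vector vanishes on all translates of `M`,
and therefore has energy at least `6 (1 - |ε|)` (`lt_eigenvalue_of_orthogonal`).  A general
eigenvector is decomposed into its momentum components.

*The limit.* A hop changes a sum of `1`-Lipschitz functions over a configuration by at most `1`,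
which bounds `dist(M, M + s)` from below by `|s| - 2m`, and by `m` if `s ≠ 0` and the ring is long.
Therefore `e_s` is dominated by a summable sequence, uniformly in `N`.  Along an ultrafilter the
solutions converge pointwise, and the limit is a small solution of the fixed point equation on `ℤ`,
because large rings look like `ℤ` near a finite set.  That solution is unique by the contraction
estimate, so `e_s` converges (`IsSolutionFamily.exists_limit`), and `E_N(k)` converges by dominated
convergence.
-/

namespace XXZ

/-! ### Domain walls, hops and translations -/

section Hopping

variable {G : Type*} [CommRing G] [DecidableEq G]

/-- The domain walls of `Y`: the bonds `⟨j, j + 1⟩` with exactly one endpoint in `Y`.  It agrees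
with `bdry` on a ring, and makes sense on the infinite chain too. -/
def walls (Y : Finset G) : Finset G :=
  (Y ∪ Y.image fun i => i - 1).filter fun j => ¬ (j ∈ Y ↔ j + 1 ∈ Y)

/-- The configuration that results from exchanging the spins at the ends of the bond `j`, if `j`
is a domain wall of `Y`. -/
def hop (Y : Finset G) (j : G) : Finset G := Y ∆ {j, j + 1}

/-- `Y + s`. -/
def translate (Y : Finset G) (s : G) : Finset G := Y.image fun i => i + s

theorem mem_walls {Y : Finset G} {j : G} : j ∈ walls Y ↔ ¬ (j ∈ Y ↔ j + 1 ∈ Y) := by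
  simp only [walls, Finset.mem_filter, Finset.mem_union, Finset.mem_image, and_iff_right_iff_imp]
  intro h
  by_cases hj : j ∈ Y
  · exact Or.inl hj
  · exact Or.inr ⟨j + 1, by tauto, by ring⟩

theorem mem_hop {Y : Finset G} {j x : G} :
    x ∈ hop Y j ↔ ¬ (x ∈ Y ↔ x = j ∨ x = j + 1) := by
  simp only [hop, Finset.mem_symmDiff, Finset.mem_insert, Finset.mem_singleton]
  tauto

@[simp]
theorem hop_hop (Y : Finset G) (j : G) : hop (hop Y j) j = Y := by
  simp [hop]

theorem hop_ne (Y : Finset G) (j : G) : hop Y j ≠ Y := by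
  intro h
  have := congrArg (j ∈ ·) h
  simp [mem_hop] at this

theorem mem_translate {Y : Finset G} {s x : G} : x ∈ translate Y s ↔ x - s ∈ Y := by
  simp only [translate, Finset.mem_image]
  constructor
  · rintro ⟨i, hi, rfl⟩
    simpa using hi
  · intro h
    exact ⟨x - s, h, by ring⟩

@[simp]
theorem translate_zero (Y : Finset G) : translate Y 0 = Y := by
  ext x
  simp [mem_translate]

theorem translate_translate (Y : Finset G) (s t : G) :
    translate (translate Y s) t = translate Y (s + t) := by
  ext x
  simp only [mem_translate]
  rw [show x - t - s = x - (s + t) by ring]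

@[simp]
theorem card_translate (Y : Finset G) (s : G) : (translate Y s).card = Y.card :=
  Finset.card_image_of_injective _ (add_left_injective s)

theorem translate_injective (s : G) : Function.Injective fun Y : Finset G => translate Y s :=
  Function.LeftInverse.injective (g := fun Y => translate Y (-s)) fun Y => by
    simp [translate_translate]

theorem walls_translate (Y : Finset G) (s : G) : walls (translate Y s) = translate (walls Y) s := by
  ext x
  simp only [mem_walls, mem_translate]
  rw [show x + 1 - s = x - s + 1 by ring]

theorem hop_translate (Y : Finset G) (s j : G) :
    hop (translate Y s) (j + s) = translate (hop Y j) s := by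
  ext x
  simp only [mem_hop, mem_translate, sub_eq_iff_eq_add]
  rw [show j + s + 1 = j + 1 + s by ring]

theorem card_walls_translate (Y : Finset G) (s : G) :
    (walls (translate Y s)).card = (walls Y).card := by
  rw [walls_translate, card_translate]

variable [Nontrivial G]

@[simp]
theorem mem_walls_hop {Y : Finset G} {j : G} : j ∈ walls (hop Y j) ↔ j ∈ walls Y := by
  simp only [mem_walls, mem_hop]
  simp
  tauto

theorem hop_of_mem {Y : Finset G} {j : G} (hj : j ∈ Y) (hj' : j + 1 ∉ Y) :
    hop Y j = insert (j + 1) (Y.erase j) := by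
  have hne : j + 1 ≠ j := by simp
  ext x
  simp only [mem_hop, Finset.mem_insert, Finset.mem_erase]
  by_cases h1 : x = j
  · subst h1; simp [hj]
  · by_cases h2 : x = j + 1
    · subst h2; simp [hj']
    · simp [h1, h2]

theorem hop_of_notMem {Y : Finset G} {j : G} (hj : j ∉ Y) (hj' : j + 1 ∈ Y) :
    hop Y j = insert j (Y.erase (j + 1)) := by
  have hne : j + 1 ≠ j := by simp
  ext x
  simp only [mem_hop, Finset.mem_insert, Finset.mem_erase]
  by_cases h1 : x = j
  · subst h1; simp [hj]
  · by_cases h2 : x = j + 1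
    · subst h2; simp [hj']
    · simp [h1, h2]

theorem card_hop {Y : Finset G} {j : G} (h : j ∈ walls Y) : (hop Y j).card = Y.card := by
  rw [mem_walls] at h
  by_cases hj : j ∈ Y
  · have hj' : j + 1 ∉ Y := by tauto
    rw [hop_of_mem hj hj', Finset.card_insert_of_notMem (by simp [hj']),
      Finset.card_erase_add_one hj]
  · have hj' : j + 1 ∈ Y := by tauto
    rw [hop_of_notMem hj hj', Finset.card_insert_of_notMem (by simp [hj]),
      Finset.card_erase_add_one hj']

/-- Configurations joined by a single hop of a down spin to a neighbouring site. -/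
def hopGraph (G : Type*) [CommRing G] [DecidableEq G] [Nontrivial G] :
    SimpleGraph (Finset G) where
  Adj Y Z := ∃ j ∈ walls Y, Z = hop Y j
  symm := ⟨by
    rintro Y Z ⟨j, hj, rfl⟩
    exact ⟨j, by simpa using hj, by simp⟩⟩
  loopless := ⟨by
    rintro Y ⟨j, -, h⟩
    exact hop_ne Y j h.symm⟩

end Hopping

/-! ### Maps between chains -/

section Image

variable {G H : Type*} [CommRing G] [DecidableEq G] [DecidableEq H]

/-- `Y` together with all its neighbours. -/
def neighborhood (Y : Finset G) : Finset G :=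
  Y ∪ (Y.image fun i => i - 1) ∪ Y.image fun i => i + 1

theorem mem_neighborhood {Y : Finset G} {j : G} :
    j ∈ neighborhood Y ↔ j ∈ Y ∨ j + 1 ∈ Y ∨ j - 1 ∈ Y := by
  simp only [neighborhood, Finset.mem_union, Finset.mem_image, sub_eq_iff_eq_add, exists_eq_right,
    ← eq_sub_iff_add_eq, or_assoc]

theorem mem_image_iff_of_mem_neighborhood {f : G → H} {Y : Finset G}
    (hY : Set.InjOn f (neighborhood Y)) {x : G} (hx : x ∈ neighborhood Y) :
    f x ∈ Y.image f ↔ x ∈ Y := by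
  rw [Finset.mem_image]
  constructor
  · rintro ⟨y, hy, h⟩
    have := hY (mem_neighborhood.2 (Or.inl hy)) hx h
    rwa [← this]
  · intro h
    exact ⟨x, h, rfl⟩

theorem card_image_of_injOn_neighborhood {f : G → H} {Y : Finset G}
    (hY : Set.InjOn f (neighborhood Y)) : (Y.image f).card = Y.card :=
  Finset.card_image_of_injOn (hY.mono fun _ hx => mem_neighborhood.2 (Or.inl hx))

theorem walls_subset_neighborhood (Y : Finset G) : walls Y ⊆ neighborhood Y := by
  intro j hj
  rw [mem_walls] at hj
  rw [mem_neighborhood]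
  tauto

theorem add_one_mem_neighborhood {Y : Finset G} {j : G} (hj : j ∈ walls Y) :
    j + 1 ∈ neighborhood Y := by
  rw [mem_walls] at hj
  rw [mem_neighborhood, add_sub_cancel_right]
  tauto

variable [CommRing H]

/-- A map between chains that commutes with the step to the right neighbour and is injective near
`Y` carries the domain walls of `Y` to those of its image. -/
theorem walls_image {f : G → H} (hf : ∀ x, f (x + 1) = f x + 1) {Y : Finset G}
    (hY : Set.InjOn f (neighborhood Y)) : walls (Y.image f) = (walls Y).image f := by
  have key : ∀ x, (x ∈ Y ∨ x + 1 ∈ Y) → (f x ∈ walls (Y.image f) ↔ x ∈ walls Y) := by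
    intro x hx
    rw [mem_walls, mem_walls, ← hf,
      mem_image_iff_of_mem_neighborhood hY (mem_neighborhood.2 (by tauto)),
      mem_image_iff_of_mem_neighborhood hY (mem_neighborhood.2 (by
        rw [add_sub_cancel_right]; tauto))]
  ext z
  rw [Finset.mem_image]
  constructor
  · intro hz
    have hz' := hz
    rw [mem_walls] at hz'
    by_cases h : z ∈ Y.image f
    · obtain ⟨y, hy, rfl⟩ := Finset.mem_image.1 h
      exact ⟨y, (key y (Or.inl hy)).1 hz, rfl⟩
    · have h1 : z + 1 ∈ Y.image f := by tauto
      obtain ⟨y, hy, h2⟩ := Finset.mem_image.1 h1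
      have h3 : f (y - 1) = z := by
        have := hf (y - 1)
        rw [sub_add_cancel, h2] at this
        exact (add_right_cancel this).symm
      refine ⟨y - 1, (key (y - 1) (Or.inr (by simpa using hy))).1 (h3 ▸ hz), h3⟩
  · rintro ⟨x, hx, rfl⟩
    refine (key x ?_).2 hx
    rw [mem_walls] at hx
    tauto

theorem card_walls_image {f : G → H} (hf : ∀ x, f (x + 1) = f x + 1) {Y : Finset G}
    (hY : Set.InjOn f (neighborhood Y)) : (walls (Y.image f)).card = (walls Y).card := by
  rw [walls_image hf hY]
  exact Finset.card_image_of_injOn (hY.mono (walls_subset_neighborhood Y))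

theorem sum_walls_image {f : G → H} (hf : ∀ x, f (x + 1) = f x + 1) {Y : Finset G}
    (hY : Set.InjOn f (neighborhood Y)) (g : H → ℝ) :
    ∑ j ∈ walls (Y.image f), g j = ∑ j ∈ walls Y, g (f j) := by
  rw [walls_image hf hY]
  exact Finset.sum_image (hY.mono (walls_subset_neighborhood Y))

theorem hop_image {f : G → H} (hf : ∀ x, f (x + 1) = f x + 1) {Y : Finset G}
    (hY : Set.InjOn f (neighborhood Y)) {j : G} (hj : j ∈ walls Y) :
    hop (Y.image f) (f j) = (hop Y j).image f := by
  have hj1 := walls_subset_neighborhood Y hj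
  have hj2 := add_one_mem_neighborhood hj
  ext z
  rw [mem_hop, ← hf, Finset.mem_image (s := hop Y j)]
  constructor
  · intro h
    have : ∃ x ∈ neighborhood Y, f x = z := by
      by_cases h1 : z = f j
      · exact ⟨j, hj1, h1.symm⟩
      · by_cases h2 : z = f (j + 1)
        · exact ⟨j + 1, hj2, h2.symm⟩
        · have : z ∈ Y.image f := by tauto
          obtain ⟨y, hy, rfl⟩ := Finset.mem_image.1 this
          exact ⟨y, mem_neighborhood.2 (Or.inl hy), rfl⟩
    obtain ⟨x, hx, rfl⟩ := this
    rw [mem_image_iff_of_mem_neighborhood hY hx, hY.eq_iff hx hj1, hY.eq_iff hx hj2] at h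
    exact ⟨x, mem_hop.2 h, rfl⟩
  · rintro ⟨x, hx, rfl⟩
    rw [mem_hop] at hx
    have hx' : x ∈ neighborhood Y := by
      by_cases h1 : x = j
      · exact h1 ▸ hj1
      · by_cases h2 : x = j + 1
        · exact h2 ▸ hj2
        · exact mem_neighborhood.2 (by tauto)
    rwa [mem_image_iff_of_mem_neighborhood hY hx', hY.eq_iff hx' hj1, hY.eq_iff hx' hj2]

end Image

open scoped ENNReal

/-! ### The fixed point map and its contraction estimate -/

section Estimates

variable {G : Type*} [CommRing G] [DecidableEq G]

/-- The configurations that carry an unknown of the fixed point equation: as many down spins as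
the reference droplet `D`, and more than two domain walls. -/
def IsExcited (D Y : Finset G) : Prop := Y.card = D.card ∧ 2 < (walls Y).card

instance (D Y : Finset G) : Decidable (IsExcited D Y) := instDecidableAnd

/-- The fixed point map for the amplitudes of configurations. -/
noncomputable def fixAmp (ε : ℝ) (D : Finset G) (u : Finset G → ℝ) (a : G → ℝ) (Y : Finset G) : ℝ :=
  if IsExcited D Y then
    ε / (((walls Y).card : ℝ) - 2) * ∑ j ∈ walls Y, u (hop Y j)
      + 1 / (2 * (((walls Y).card : ℝ) - 2)) * ∑' s, a s * u (translate Y s)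
  else if Y = D then 1 else 0

/-- The fixed point map for the Fourier coefficients of the energy. -/
noncomputable def fixFour (ε : ℝ) (D : Finset G) (u : Finset G → ℝ) (s : G) : ℝ :=
  -(2 * ε * ∑ j ∈ walls (translate D (-s)), u (hop (translate D (-s)) j))

/-- `∑ₛ |a s| W(D + s)`. -/
noncomputable def fourNorm (D : Finset G) (W : Finset G → ℝ≥0∞) (a : G → ℝ) : ℝ≥0∞ :=
  ∑' s, ‖a s‖ₑ * W (translate D s)

/-- `∑_Y |u Y| (n(Y) - 2) W(Y)` over the excited configurations. -/
noncomputable def ampNorm (D : Finset G) (W : Finset G → ℝ≥0∞) (u : Finset G → ℝ) : ℝ≥0∞ :=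
  ∑' Y, if IsExcited D Y then ‖u Y‖ₑ * ((((walls Y).card - 2 : ℕ) : ℝ≥0∞) * W Y) else 0

/-- The properties of the reference droplet `D` and of the weight `W` (which plays the role of
`Y ↦ r ^ (-w(Y))`) on which the contraction estimate rests. -/
structure WeightData (D : Finset G) (W : Finset G → ℝ≥0∞) (ρ : ℝ≥0∞) : Prop where
  card_walls_le : (walls D).card ≤ 2
  eq_zero_of_translate : ∀ s, translate D s = D → s = 0
  weight_self : W D = 1
  one_le : ∀ Y, 1 ≤ W Y
  ne_top : ∀ Y, W Y ≠ ∞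
  hop_le : ∀ Y, ∀ j ∈ walls Y, W (hop Y j) ≤ ρ * W Y
  le_neg : ∀ s, W (translate D s) ≤ W (translate D (-s))
  le_mul : ∀ Y s, W Y ≤ W (translate D (-s)) * W (translate Y s)

theorem isExcited_translate {D Y : Finset G} {s : G} :
    IsExcited D (translate Y s) ↔ IsExcited D Y := by
  simp [IsExcited, card_walls_translate]

variable {D : Finset G} {W : Finset G → ℝ≥0∞} {ρ : ℝ≥0∞}

theorem WeightData.translate_injective (h : WeightData D W ρ) :
    Function.Injective fun s => translate D s := by
  intro s t hst
  have := congrArg (fun Y => translate Y (-t)) hst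
  simp only [translate_translate, add_neg_cancel, translate_zero] at this
  have := h.eq_zero_of_translate _ this
  rwa [add_neg_eq_zero] at this

theorem WeightData.not_isExcited_translate (h : WeightData D W ρ) (s : G) :
    ¬ IsExcited D (translate D s) := by
  rw [isExcited_translate]
  exact fun h' => absurd h.card_walls_le (not_le.2 h'.2)

/-- Each pair of a configuration `Y` and a hop to `Z` is charged to `Z`, which has `n(Z)` hops. -/
theorem tsum_hop_le [Nontrivial G] (h : WeightData D W ρ) (b : Finset G → ℝ≥0∞) :
    (∑' Y, if Y.card = D.card then (∑ j ∈ walls Y, b (hop Y j)) * W Y else 0) ≤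
      ρ * ∑' Z, if Z.card = D.card then b Z * (((walls Z).card : ℝ≥0∞) * W Z) else 0 := by
  -- Write both sides as sums over pairs of a configuration and a bond; for a fixed bond, hopping is
  -- an involution of the configurations.
  have h1 : ∀ Y : Finset G,
      (if Y.card = D.card then (∑ j ∈ walls Y, b (hop Y j)) * W Y else 0) =
        ∑' j, if Y.card = D.card ∧ j ∈ walls Y then b (hop Y j) * W Y else 0 := by
    intro Y
    by_cases hY : Y.card = D.card
    · simp only [hY, if_true, true_and]
      rw [tsum_eq_sum (s := walls Y) (fun j hj => by simp [hj]), Finset.sum_mul]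
      exact Finset.sum_congr rfl fun j hj => by simp [hj]
    · simp [hY]
  have h2 : ∀ Z : Finset G,
      (∑' j, if Z.card = D.card ∧ j ∈ walls Z then b Z * (ρ * W Z) else 0) =
        ρ * if Z.card = D.card then b Z * (((walls Z).card : ℝ≥0∞) * W Z) else 0 := by
    intro Z
    by_cases hZ : Z.card = D.card
    · simp only [hZ, if_true, true_and]
      rw [tsum_eq_sum (s := walls Z) (fun j hj => by simp [hj])]
      rw [Finset.sum_congr rfl (fun j hj => if_pos hj), Finset.sum_const, nsmul_eq_mul]
      ring
    · simp [hZ]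
  rw [tsum_congr h1, ENNReal.tsum_comm, ← ENNReal.tsum_mul_left, ← tsum_congr h2,
    ENNReal.tsum_comm (α := Finset G)]
  refine ENNReal.tsum_le_tsum fun j => ?_
  have hinv : Function.Involutive fun Y : Finset G => hop Y j := fun Y => hop_hop Y j
  rw [← Equiv.tsum_eq hinv.toPerm]
  refine ENNReal.tsum_le_tsum fun Z => ?_
  simp only [Function.Involutive.coe_toPerm, hop_hop, mem_walls_hop]
  by_cases hj : j ∈ walls Z
  · simp only [hj, and_true, card_hop hj]
    split_ifs
    · gcongr
      exact h.hop_le Z j hj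
    · exact le_rfl
  · simp [hj]

/-- The linear terms of both fixed point equations together: the excited configurations and the
translates of the droplet are different targets of hops. -/
theorem tsum_linear_le [Nontrivial G] (h : WeightData D W ρ) (b : Finset G → ℝ≥0∞) :
    (∑' s, (∑ j ∈ walls (translate D (-s)), b (hop (translate D (-s)) j)) * W (translate D s)) +
      (∑' Y, if IsExcited D Y then (∑ j ∈ walls Y, b (hop Y j)) * W Y else 0) ≤
      ρ * ∑' Z, if Z.card = D.card then b Z * (((walls Z).card : ℝ≥0∞) * W Z) else 0 := by
  refine le_trans ?_ (tsum_hop_le h b)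
  set g : Finset G → ℝ≥0∞ := fun Y => (∑ j ∈ walls Y, b (hop Y j)) * W Y with hg
  have hinj : Function.Injective fun s => translate D (-s) :=
    h.translate_injective.comp neg_injective
  calc _ ≤ (∑' s : G, if IsExcited D (translate D (-s)) then 0 else
            if (translate D (-s)).card = D.card then g (translate D (-s)) else 0) +
          ∑' Y, if IsExcited D Y then g Y else 0 := by
        refine add_le_add (ENNReal.tsum_le_tsum fun s => ?_) le_rfl
        rw [if_neg (h.not_isExcited_translate _), if_pos (card_translate _ _)]
        exact mul_le_mul_right (h.le_neg s) _
    _ ≤ (∑' Y, if IsExcited D Y then 0 else if Y.card = D.card then g Y else 0) +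
          ∑' Y, if IsExcited D Y then g Y else 0 := by
        gcongr
        exact ENNReal.tsum_comp_le_tsum_of_injective hinj
          (fun Y => if IsExcited D Y then 0 else if Y.card = D.card then g Y else 0)
    _ ≤ _ := by
        rw [← ENNReal.tsum_add]
        refine ENNReal.tsum_le_tsum fun Y => ?_
        by_cases hY : IsExcited D Y
        · simp [hY, hY.1, hg]
        · simp [hY, hg]

/-- The quadratic term. -/
theorem tsum_quadratic_le (h : WeightData D W ρ) (α : G → ℝ≥0∞) (β : Finset G → ℝ≥0∞) :
    (∑' Y, if IsExcited D Y then (∑' s, α s * β (translate Y s)) * W Y else 0) ≤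
      (∑' s, α s * W (translate D s)) * ∑' Y, if IsExcited D Y then β Y * W Y else 0 := by
  have h1 : ∀ Y : Finset G,
      (if IsExcited D Y then (∑' s, α s * β (translate Y s)) * W Y else 0) ≤
        ∑' s, (α s * W (translate D s)) *
          if IsExcited D (translate Y s) then β (translate Y s) * W (translate Y s) else 0 := by
    intro Y
    by_cases hY : IsExcited D Y
    · simp only [hY, if_true, isExcited_translate, ← ENNReal.tsum_mul_right]
      refine ENNReal.tsum_le_tsum fun s => ?_
      have h2 : W Y ≤ W (translate D s) * W (translate Y s) := by
        refine (h.le_mul Y s).trans ?_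
        gcongr
        simpa using h.le_neg (-s)
      calc α s * β (translate Y s) * W Y
          ≤ α s * β (translate Y s) * (W (translate D s) * W (translate Y s)) := by gcongr
        _ = _ := by ring
    · simp [hY]
  refine (ENNReal.tsum_le_tsum h1).trans ?_
  rw [ENNReal.tsum_comm, ← ENNReal.tsum_mul_right]
  refine ENNReal.tsum_le_tsum fun s => ?_
  rw [ENNReal.tsum_mul_left]
  exact mul_le_mul_right (ENNReal.tsum_comp_le_tsum_of_injective (translate_injective s)
    (fun Y => if IsExcited D Y then β Y * W Y else 0)) _

theorem WeightData.enorm_le_ampNorm (h : WeightData D W ρ) (u : Finset G → ℝ) {Y : Finset G}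
    (hY : IsExcited D Y) : ‖u Y‖ₑ ≤ ampNorm D W u := by
  refine le_trans ?_ (ENNReal.le_tsum Y)
  rw [if_pos hY]
  have h1 : (1 : ℝ≥0∞) ≤ ((walls Y).card - 2 : ℕ) := by
    have := hY.2
    exact_mod_cast (by omega : 1 ≤ (walls Y).card - 2)
  calc ‖u Y‖ₑ = ‖u Y‖ₑ * (1 * 1) := by simp
    _ ≤ _ := by gcongr; exact h.one_le Y

theorem WeightData.tsum_enorm_le_fourNorm (h : WeightData D W ρ) (a : G → ℝ) :
    ∑' s, ‖a s‖ₑ ≤ fourNorm D W a :=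
  ENNReal.tsum_le_tsum fun s => by
    calc ‖a s‖ₑ = ‖a s‖ₑ * 1 := by simp
      _ ≤ _ := by gcongr; exact h.one_le _

/-- The convolution in the fixed point map converges, also on an infinite chain. -/
theorem WeightData.summable_mul (h : WeightData D W ρ) {u : Finset G → ℝ} {a : G → ℝ}
    (hu : ampNorm D W u ≠ ∞) (ha : fourNorm D W a ≠ ∞) {Y : Finset G} (hY : IsExcited D Y) :
    Summable fun s => a s * u (translate Y s) := by
  refine Summable.of_enorm (ne_top_of_le_ne_top (ENNReal.mul_ne_top ha hu) ?_)
  calc ∑' s, ‖a s * u (translate Y s)‖ₑ ≤ ∑' s, ‖a s‖ₑ * ampNorm D W u :=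
        ENNReal.tsum_le_tsum fun s => by
          rw [enorm_mul]
          gcongr
          exact h.enorm_le_ampNorm u (isExcited_translate.2 hY)
    _ ≤ _ := by
        rw [ENNReal.tsum_mul_right]
        gcongr
        exact h.tsum_enorm_le_fourNorm a

/-- `n ≤ 3 (n - 2)` as soon as `n > 2`, so that the relative bound on the hopping survives the
division by `n - 2`. -/
theorem tsum_card_walls_le {b : Finset G → ℝ} (hb : ∀ Y, ¬ IsExcited D Y → b Y = 0) :
    (∑' Z, if Z.card = D.card then ‖b Z‖ₑ * (((walls Z).card : ℝ≥0∞) * W Z) else 0) ≤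
      3 * ampNorm D W b := by
  rw [ampNorm, ← ENNReal.tsum_mul_left]
  refine ENNReal.tsum_le_tsum fun Z => ?_
  by_cases hZ : IsExcited D Z
  · rw [if_pos hZ.1, if_pos hZ]
    have h1 : ((walls Z).card : ℝ≥0∞) ≤ 3 * ((walls Z).card - 2 : ℕ) := by
      have := hZ.2
      exact_mod_cast (by omega : (walls Z).card ≤ 3 * ((walls Z).card - 2))
    calc ‖b Z‖ₑ * (((walls Z).card : ℝ≥0∞) * W Z)
        ≤ ‖b Z‖ₑ * (3 * ((walls Z).card - 2 : ℕ) * W Z) := by gcongr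
      _ = _ := by ring
  · simp [hb Z hZ]

theorem enorm_two_real : ‖(2 : ℝ)‖ₑ = 2 := by
  exact_mod_cast Real.enorm_natCast 2

theorem enorm_two_mul_fixAmp_sub_le (h : WeightData D W ρ) (ε : ℝ) {u u' : Finset G → ℝ}
    {a a' : G → ℝ} (hu : ampNorm D W u ≠ ∞) (ha : fourNorm D W a ≠ ∞)
    (hu' : ampNorm D W u' ≠ ∞) (ha' : fourNorm D W a' ≠ ∞) {Y : Finset G}
    (hY : IsExcited D Y) :
    2 * (‖fixAmp ε D u a Y - fixAmp ε D u' a' Y‖ₑ * ((walls Y).card - 2 : ℕ)) ≤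
      2 * ‖ε‖ₑ * ∑ j ∈ walls Y, ‖u (hop Y j) - u' (hop Y j)‖ₑ +
        ∑' s, (‖a s - a' s‖ₑ * ‖u (translate Y s)‖ₑ +
          ‖a' s‖ₑ * ‖u (translate Y s) - u' (translate Y s)‖ₑ) := by
  have hn : (2 : ℝ) < (walls Y).card := by exact_mod_cast hY.2
  have hn0 : ((walls Y).card : ℝ) - 2 ≠ 0 := by linarith
  have key : 2 * ((fixAmp ε D u a Y - fixAmp ε D u' a' Y) * ((walls Y).card - 2 : ℕ)) =
      2 * ε * ∑ j ∈ walls Y, (u (hop Y j) - u' (hop Y j)) +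
        ∑' s, (a s * u (translate Y s) - a' s * u' (translate Y s)) := by
    rw [Summable.tsum_sub (h.summable_mul hu ha hY) (h.summable_mul hu' ha' hY),
      Finset.sum_sub_distrib, fixAmp, fixAmp, if_pos hY, if_pos hY, Nat.cast_sub hY.2.le]
    push_cast
    field_simp
    ring
  have hl : 2 * (‖fixAmp ε D u a Y - fixAmp ε D u' a' Y‖ₑ * ((walls Y).card - 2 : ℕ)) =
      ‖2 * ((fixAmp ε D u a Y - fixAmp ε D u' a' Y) * ((walls Y).card - 2 : ℕ))‖ₑ := by
    rw [enorm_mul, enorm_mul]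
    congr 2
    · rw [enorm_two_real]
    · rw [Real.enorm_natCast]
  rw [hl, key]
  refine (enorm_add_le _ _).trans (add_le_add ?_ ?_)
  · rw [enorm_mul, enorm_mul]
    refine mul_le_mul' (le_of_eq (by rw [enorm_two_real])) (enorm_sum_le _ _)
  · refine enorm_tsum_le_tsum_enorm.trans (ENNReal.tsum_le_tsum fun s => ?_)
    rw [show a s * u (translate Y s) - a' s * u' (translate Y s) =
      (a s - a' s) * u (translate Y s) + a' s * (u (translate Y s) - u' (translate Y s)) by ring]
    refine (enorm_add_le _ _).trans ?_
    rw [enorm_mul, enorm_mul]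

/-- The weighted norm of a pair of amplitudes and Fourier coefficients. -/
noncomputable def solNorm (D : Finset G) (W : Finset G → ℝ≥0∞) (u : Finset G → ℝ) (a : G → ℝ) :
    ℝ≥0∞ :=
  fourNorm D W a + 2 * ampNorm D W u

theorem solNorm_ne_top_iff {u : Finset G → ℝ} {a : G → ℝ} :
    solNorm D W u a ≠ ∞ ↔ fourNorm D W a ≠ ∞ ∧ ampNorm D W u ≠ ∞ := by
  simp [solNorm, ENNReal.mul_eq_top]

/-- The factor `n - 2 ≥ 1` may be dropped. -/
theorem tsum_excited_le_ampNorm (u : Finset G → ℝ) :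
    (∑' Y, if IsExcited D Y then ‖u Y‖ₑ * W Y else 0) ≤ ampNorm D W u := by
  refine ENNReal.tsum_le_tsum fun Y => ?_
  split_ifs with hY
  · have h1 : (1 : ℝ≥0∞) ≤ ((walls Y).card - 2 : ℕ) := by
      have := hY.2
      exact_mod_cast (by omega : 1 ≤ (walls Y).card - 2)
    calc ‖u Y‖ₑ * W Y = ‖u Y‖ₑ * (1 * W Y) := by simp
      _ ≤ _ := by gcongr
  · exact le_rfl

theorem solNorm_add_le (u v : Finset G → ℝ) (a b : G → ℝ) :
    solNorm D W (fun Y => u Y + v Y) (fun s => a s + b s) ≤ solNorm D W u a + solNorm D W v b := by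
  have h1 : fourNorm D W (fun s => a s + b s) ≤ fourNorm D W a + fourNorm D W b := by
    rw [fourNorm, fourNorm, fourNorm, ← ENNReal.tsum_add]
    refine ENNReal.tsum_le_tsum fun s => ?_
    rw [← add_mul]
    gcongr
    exact enorm_add_le _ _
  have h2 : ampNorm D W (fun s => u s + v s) ≤ ampNorm D W u + ampNorm D W v := by
    rw [ampNorm, ampNorm, ampNorm, ← ENNReal.tsum_add]
    refine ENNReal.tsum_le_tsum fun s => ?_
    split_ifs
    · rw [← add_mul]
      gcongr
      exact enorm_add_le _ _
    · simp
  calc _ ≤ _ := add_le_add h1 (mul_le_mul_right h2 2)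
    _ = _ := by simp only [solNorm]; ring

theorem solNorm_sub_le (u v : Finset G → ℝ) (a b : G → ℝ) :
    solNorm D W (fun Y => u Y - v Y) (fun s => a s - b s) ≤ solNorm D W u a + solNorm D W v b := by
  have h := solNorm_add_le (D := D) (W := W) u (fun Y => -v Y) a (fun s => -b s)
  have h' : solNorm D W (fun Y => -v Y) (fun s => -b s) = solNorm D W v b := by
    simp [solNorm, fourNorm, ampNorm]
  rwa [h'] at h

/-- The estimate behind the contraction property, before numerical values are inserted. -/
theorem solNorm_fix_sub_le [Nontrivial G] (h : WeightData D W ρ) (ε : ℝ) {u u' : Finset G → ℝ}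
    {a a' : G → ℝ} (hp : solNorm D W u a ≠ ∞) (hp' : solNorm D W u' a' ≠ ∞)
    (huu' : ∀ Y, ¬ IsExcited D Y → u Y = u' Y) :
    solNorm D W (fun Y => fixAmp ε D u a Y - fixAmp ε D u' a' Y)
        (fun s => fixFour ε D u s - fixFour ε D u' s) ≤
      6 * (‖ε‖ₑ * ρ) * ampNorm D W (fun Y => u Y - u' Y) +
        fourNorm D W (fun s => a s - a' s) * ampNorm D W u +
        fourNorm D W a' * ampNorm D W (fun Y => u Y - u' Y) := by
  obtain ⟨ha, hu⟩ := solNorm_ne_top_iff.1 hp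
  obtain ⟨ha', hu'⟩ := solNorm_ne_top_iff.1 hp'
  set b : Finset G → ℝ≥0∞ := fun Y => ‖u Y - u' Y‖ₑ with hb
  set T₁ := ∑' s, (∑ j ∈ walls (translate D (-s)), b (hop (translate D (-s)) j)) *
    W (translate D s) with hT₁
  set T₂ := ∑' Y, if IsExcited D Y then (∑ j ∈ walls Y, b (hop Y j)) * W Y else 0 with hT₂
  have hlin : T₁ + T₂ ≤ ρ * (3 * ampNorm D W (fun Y => u Y - u' Y)) :=
    (tsum_linear_le h b).trans (mul_le_mul_right (tsum_card_walls_le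
      (b := fun Y => u Y - u' Y) fun Y hY => by simp [huu' Y hY]) _)
  have hfour : fourNorm D W (fun s => fixFour ε D u s - fixFour ε D u' s) ≤
      2 * ‖ε‖ₑ * T₁ := by
    rw [fourNorm, hT₁, ← ENNReal.tsum_mul_left]
    refine ENNReal.tsum_le_tsum fun s => ?_
    rw [← mul_assoc]
    gcongr
    rw [fixFour, fixFour, neg_sub_neg, ← mul_sub, ← Finset.sum_sub_distrib, enorm_mul, enorm_mul]
    refine mul_le_mul' (le_of_eq (by rw [enorm_two_real])) ((enorm_sum_le _ _).trans ?_)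
    exact Finset.sum_le_sum fun j _ => by rw [hb]; exact (enorm_sub_rev _ _).le
  have hamp : 2 * ampNorm D W (fun Y => fixAmp ε D u a Y - fixAmp ε D u' a' Y) ≤
      2 * ‖ε‖ₑ * T₂ + (fourNorm D W (fun s => a s - a' s) * ampNorm D W u +
        fourNorm D W a' * ampNorm D W (fun Y => u Y - u' Y)) := by
    have h1 := (tsum_quadratic_le h (fun s => ‖a s - a' s‖ₑ) (fun Y => ‖u Y‖ₑ)).trans
      (mul_le_mul_right (tsum_excited_le_ampNorm u) _)
    have h2 := (tsum_quadratic_le h (fun s => ‖a' s‖ₑ) (fun Y => ‖u Y - u' Y‖ₑ)).trans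
      (mul_le_mul_right (tsum_excited_le_ampNorm (fun Y => u Y - u' Y)) _)
    refine le_trans ?_ (add_le_add_right (add_le_add h1 h2) _)
    rw [ampNorm, hT₂, ← ENNReal.tsum_mul_left, ← ENNReal.tsum_mul_left, ← ENNReal.tsum_add,
      ← ENNReal.tsum_add]
    refine ENNReal.tsum_le_tsum fun Y => ?_
    by_cases hY : IsExcited D Y
    · simp only [hY, if_true]
      have := enorm_two_mul_fixAmp_sub_le h ε hu ha hu' ha' hY
      rw [ENNReal.tsum_add] at this
      calc _ = 2 * (‖fixAmp ε D u a Y - fixAmp ε D u' a' Y‖ₑ * ((walls Y).card - 2 : ℕ)) * W Y := by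
            ring
        _ ≤ _ := mul_le_mul_left this _
        _ = _ := by simp only [hb]; ring
    · simp [hY]
  calc _ ≤ 2 * ‖ε‖ₑ * T₁ + _ := add_le_add hfour hamp
    _ = 2 * ‖ε‖ₑ * (T₁ + T₂) + (fourNorm D W (fun s => a s - a' s) * ampNorm D W u +
        fourNorm D W a' * ampNorm D W (fun Y => u Y - u' Y)) := by ring
    _ ≤ 2 * ‖ε‖ₑ * (ρ * (3 * ampNorm D W (fun Y => u Y - u' Y))) +
        (fourNorm D W (fun s => a s - a' s) * ampNorm D W u +
        fourNorm D W a' * ampNorm D W (fun Y => u Y - u' Y)) := by gcongr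
    _ = _ := by ring

/-- On the ball of radius `1 / 4` the fixed point map contracts by the factor `1 / 2`. -/
theorem two_mul_solNorm_fix_sub_le [Nontrivial G] (h : WeightData D W ρ) {ε : ℝ}
    (hε : 100 * (‖ε‖ₑ * ρ) ≤ 1) {u u' : Finset G → ℝ} {a a' : G → ℝ}
    (hp : 4 * solNorm D W u a ≤ 1) (hp' : 4 * solNorm D W u' a' ≤ 1)
    (huu' : ∀ Y, ¬ IsExcited D Y → u Y = u' Y) :
    2 * solNorm D W (fun Y => fixAmp ε D u a Y - fixAmp ε D u' a' Y)
        (fun s => fixFour ε D u s - fixFour ε D u' s) ≤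
      solNorm D W (fun Y => u Y - u' Y) (fun s => a s - a' s) := by
  have hfin : ∀ x : ℝ≥0∞, 4 * x ≤ 1 → x ≠ ∞ := by
    rintro x hx rfl
    simp at hx
  have h1 := solNorm_fix_sub_le h ε (hfin _ hp) (hfin _ hp') huu'
  have h2 : 12 * (‖ε‖ₑ * ρ) ≤ 1 := le_trans (by gcongr; norm_num) hε
  have h3 : 2 * ampNorm D W u ≤ 1 := by
    refine le_trans ?_ hp
    calc 2 * ampNorm D W u ≤ 1 * (fourNorm D W a + 2 * ampNorm D W u) := by
          rw [one_mul]; exact le_add_self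
      _ ≤ _ := by rw [solNorm]; gcongr; norm_num
  have h4 : 2 * fourNorm D W a' ≤ 1 := by
    refine le_trans ?_ hp'
    calc 2 * fourNorm D W a' ≤ 2 * (fourNorm D W a' + 2 * ampNorm D W u') := by
          gcongr; exact le_self_add
      _ ≤ _ := by rw [solNorm]; gcongr; norm_num
  set x := ampNorm D W (fun Y => u Y - u' Y)
  set y := fourNorm D W (fun s => a s - a' s)
  calc _ ≤ 2 * (6 * (‖ε‖ₑ * ρ) * x + y * ampNorm D W u + fourNorm D W a' * x) := by gcongr
    _ = (12 * (‖ε‖ₑ * ρ)) * x + y * (2 * ampNorm D W u) + (2 * fourNorm D W a') * x := by ring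
    _ ≤ 1 * x + y * 1 + 1 * x := by gcongr
    _ = y + 2 * x := by ring

/-- The fixed point map preserves the ball of radius `1 / 4`. -/
theorem four_mul_solNorm_fix_le [Nontrivial G] (h : WeightData D W ρ) {ε : ℝ}
    (hε : 100 * (‖ε‖ₑ * ρ) ≤ 1) {u : Finset G → ℝ} {a : G → ℝ}
    (hp : 4 * solNorm D W u a ≤ 1)
    (hu : ∀ Y, ¬ IsExcited D Y → u Y = if Y = D then 1 else 0) :
    4 * solNorm D W (fixAmp ε D u a) (fixFour ε D u) ≤ 1 := by
  have hD : ¬ IsExcited D D := by simpa using h.not_isExcited_translate 0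
  -- Compare with the droplet `v`, whose norm vanishes because `D` is not excited.
  set v : Finset G → ℝ := fun Y => if Y = D then 1 else 0 with hv
  have hv0 : ∀ Y, IsExcited D Y → v Y = 0 := fun Y hY => by
    have : Y ≠ D := fun h' => hD (h' ▸ hY)
    simp [hv, this]
  have hamp0 : ∀ v' : Finset G → ℝ, (∀ Y, IsExcited D Y → v' Y = 0) → ampNorm D W v' = 0 := by
    intro v' hv'
    rw [ampNorm, ENNReal.tsum_eq_zero]
    intro Y
    split_ifs with hY
    · simp [hv' Y hY]
    · rfl
  have hnv : solNorm D W v (fun _ => 0) = 0 := by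
    simp [solNorm, fourNorm, hamp0 v hv0]
  have hdiff := two_mul_solNorm_fix_sub_le h hε hp (u' := v) (a' := fun _ => 0)
    (by rw [hnv]; simp) hu
  have hdiff' : solNorm D W (fun Y => u Y - v Y) (fun s => a s - 0) = solNorm D W u a := by
    simp only [solNorm, ampNorm, sub_zero]
    congr 2
    refine tsum_congr fun Y => ?_
    split_ifs with hY
    · rw [hv0 Y hY, sub_zero]
    · rfl
  rw [hdiff'] at hdiff
  -- The image of the unperturbed droplet itself consists of single hops.
  have hbase : solNorm D W (fixAmp ε D v fun _ => 0) (fixFour ε D v) ≤ 4 * (‖ε‖ₑ * ρ) := by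
    have hlin := tsum_linear_le h (fun Y => ‖v Y‖ₑ)
    have hr : (∑' Z, if Z.card = D.card then ‖v Z‖ₑ * (((walls Z).card : ℝ≥0∞) * W Z) else 0) ≤
        2 := by
      rw [tsum_eq_single D (fun Z hZ => by simp [hv, hZ])]
      simp only [hv, if_true, h.weight_self, mul_one]
      simpa using h.card_walls_le
    have h1 : fourNorm D W (fixFour ε D v) ≤ 2 * ‖ε‖ₑ * ∑' s,
        (∑ j ∈ walls (translate D (-s)), ‖v (hop (translate D (-s)) j)‖ₑ) *
          W (translate D s) := by
      rw [fourNorm, ← ENNReal.tsum_mul_left]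
      refine ENNReal.tsum_le_tsum fun s => ?_
      rw [← mul_assoc, fixFour, enorm_neg, enorm_mul, enorm_mul]
      gcongr
      · rw [enorm_two_real]
      · exact enorm_sum_le _ _
    have h2 : ampNorm D W (fixAmp ε D v fun _ => 0) ≤ ‖ε‖ₑ *
        ∑' Y, if IsExcited D Y then (∑ j ∈ walls Y, ‖v (hop Y j)‖ₑ) * W Y else 0 := by
      rw [ampNorm, ← ENNReal.tsum_mul_left]
      refine ENNReal.tsum_le_tsum fun Y => ?_
      by_cases hY : IsExcited D Y
      · simp only [hY, if_true]
        rw [← mul_assoc, ← mul_assoc]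
        refine mul_le_mul_left ?_ _
        have hn : (2 : ℝ) < (walls Y).card := by exact_mod_cast hY.2
        have hn0 : ((walls Y).card : ℝ) - 2 ≠ 0 := by linarith
        have : fixAmp ε D v (fun _ => 0) Y * ((walls Y).card - 2 : ℕ) =
            ε * ∑ j ∈ walls Y, v (hop Y j) := by
          rw [fixAmp, if_pos hY, Nat.cast_sub hY.2.le]
          push_cast
          simp only [zero_mul, tsum_zero, mul_zero, add_zero]
          field_simp
        calc _ = ‖fixAmp ε D v (fun _ => 0) Y * ((walls Y).card - 2 : ℕ)‖ₑ := by
              rw [enorm_mul, Real.enorm_natCast]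
          _ ≤ _ := by
              rw [this, enorm_mul]
              gcongr
              exact enorm_sum_le _ _
      · simp [hY]
    calc _ ≤ _ := add_le_add h1 (mul_le_mul_right h2 2)
      _ = 2 * ‖ε‖ₑ * ((∑' s, (∑ j ∈ walls (translate D (-s)),
            ‖v (hop (translate D (-s)) j)‖ₑ) * W (translate D s)) +
            ∑' Y, if IsExcited D Y then (∑ j ∈ walls Y, ‖v (hop Y j)‖ₑ) * W Y else 0) := by ring
      _ ≤ 2 * ‖ε‖ₑ * (ρ * 2) := by gcongr; exact hlin.trans (mul_le_mul_right hr _)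
      _ = _ := by ring
  have htri : solNorm D W (fixAmp ε D u a) (fixFour ε D u) ≤
      solNorm D W (fun Y => fixAmp ε D u a Y - fixAmp ε D v (fun _ => 0) Y)
        (fun s => fixFour ε D u s - fixFour ε D v s) +
      solNorm D W (fixAmp ε D v fun _ => 0) (fixFour ε D v) := by
    simpa using solNorm_add_le (D := D) (W := W)
      (fun Y => fixAmp ε D u a Y - fixAmp ε D v (fun _ => 0) Y) (fixAmp ε D v fun _ => 0)
      (fun s => fixFour ε D u s - fixFour ε D v s) (fixFour ε D v)
  have h8 : 2 * (4 * solNorm D W (fixAmp ε D u a) (fixFour ε D u)) ≤ 2 * 1 := by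
    calc _ ≤ 2 * (4 * _) := mul_le_mul_right (mul_le_mul_right htri 4) 2
      _ = 4 * (2 * solNorm D W (fun Y => fixAmp ε D u a Y - fixAmp ε D v (fun _ => 0) Y)
        (fun s => fixFour ε D u s - fixFour ε D v s)) +
          8 * solNorm D W (fixAmp ε D v fun _ => 0) (fixFour ε D v) := by ring
      _ ≤ 4 * solNorm D W u a + 8 * (4 * (‖ε‖ₑ * ρ)) := by gcongr
      _ ≤ 1 + 100 * (‖ε‖ₑ * ρ) := by
          rw [← mul_assoc]
          gcongr
          norm_num
      _ ≤ 1 + 1 := by gcongr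
      _ = 2 * 1 := by norm_num
  exact (ENNReal.mul_le_mul_iff_right (by simp) (by simp)).1 h8

theorem eq_zero_of_two_mul_le {x : ℝ≥0∞} (hx : x ≠ ∞) (h : 2 * x ≤ x) : x = 0 := by
  by_contra h0
  rw [two_mul] at h
  exact absurd h (not_le.2 (ENNReal.lt_add_right hx h0))

theorem WeightData.solNorm_eq_zero_iff (h : WeightData D W ρ) {u : Finset G → ℝ} {a : G → ℝ} :
    solNorm D W u a = 0 ↔ (∀ s, a s = 0) ∧ ∀ Y, IsExcited D Y → u Y = 0 := by
  have hW : ∀ Y, W Y ≠ 0 := fun Y h0 => by simpa [h0] using h.one_le Y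
  simp only [solNorm, fourNorm, ampNorm, add_eq_zero, ENNReal.tsum_eq_zero, mul_eq_zero, hW,
    or_false, enorm_eq_zero, OfNat.ofNat_ne_zero, false_or]
  refine and_congr_right fun _ => forall_congr' fun Y => ?_
  by_cases hY : IsExcited D Y
  · have h1 : ((walls Y).card - 2 : ℕ) ≠ 0 := by have := hY.2; omega
    simp only [hY, if_true, mul_eq_zero, enorm_eq_zero, hW, or_false, Nat.cast_eq_zero, h1,
      true_imp_iff]
  · simp [hY]

/-- In the ball of radius `1 / 4` there is at most one fixed point. -/
theorem fix_unique [Nontrivial G] (h : WeightData D W ρ) {ε : ℝ}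
    (hε : 100 * (‖ε‖ₑ * ρ) ≤ 1) {u u' : Finset G → ℝ} {a a' : G → ℝ}
    (hp : 4 * solNorm D W u a ≤ 1) (hp' : 4 * solNorm D W u' a' ≤ 1)
    (hu : fixAmp ε D u a = u) (ha : fixFour ε D u = a)
    (hu' : fixAmp ε D u' a' = u') (ha' : fixFour ε D u' = a') : u = u' ∧ a = a' := by
  have huu' : ∀ Y, ¬ IsExcited D Y → u Y = u' Y := by
    intro Y hY
    rw [← hu, ← hu', fixAmp, fixAmp, if_neg hY, if_neg hY]
  have h1 := two_mul_solNorm_fix_sub_le h hε hp hp' huu'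
  rw [hu, hu', ha, ha'] at h1
  have hfin : solNorm D W (fun Y => u Y - u' Y) (fun s => a s - a' s) ≠ ∞ := by
    refine ne_top_of_le_ne_top ?_ (solNorm_sub_le u u' a a')
    refine ENNReal.add_ne_top.2 ⟨?_, ?_⟩
    · intro ht
      simp [ht] at hp
    · intro ht
      simp [ht] at hp'
  have h0 := eq_zero_of_two_mul_le hfin h1
  rw [h.solNorm_eq_zero_iff] at h0
  refine ⟨funext fun Y => ?_, funext fun s => sub_eq_zero.1 (h0.1 s)⟩
  by_cases hY : IsExcited D Y
  · exact sub_eq_zero.1 (h0.2 Y hY)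
  · exact huu' Y hY

end Estimates

/-! ### Existence of the fixed point on a finite chain -/

section Existence

variable {G : Type*} [CommRing G] [DecidableEq G] [Fintype G] {D : Finset G}
  {W : Finset G → ℝ≥0∞} {ρ : ℝ≥0∞}

theorem WeightData.continuous_solNorm (h : WeightData D W ρ) :
    Continuous fun p : (Finset G → ℝ) × (G → ℝ) => solNorm D W p.1 p.2 := by
  have hc : ∀ {f : (Finset G → ℝ) × (G → ℝ) → ℝ} {c : ℝ≥0∞}, Continuous f → c ≠ ∞ →
      Continuous fun p => ‖f p‖ₑ * c := fun hf hc =>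
    (ENNReal.continuous_mul_const hc).comp (continuous_enorm.comp hf)
  simp only [solNorm, fourNorm, ampNorm, tsum_fintype]
  refine Continuous.add (continuous_finsetSum _ fun s _ => hc (by fun_prop) (h.ne_top _))
    ((ENNReal.continuous_const_mul (by simp)).comp (continuous_finsetSum _ fun Y _ => ?_))
  split_ifs
  · exact hc (by fun_prop) (ENNReal.mul_ne_top (by simp) (h.ne_top _))
  · exact continuous_const

/-- Existence of the fixed point on a finite chain.  The ball is compact, so the distance between
`p` and `F p` attains its minimum; as `F` contracts, the minimum is zero. -/
theorem exists_fix [Nontrivial G] (h : WeightData D W ρ) {ε : ℝ}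
    (hε : 100 * (‖ε‖ₑ * ρ) ≤ 1) :
    ∃ u a, fixAmp ε D u a = u ∧ fixFour ε D u = a ∧ 4 * solNorm D W u a ≤ 1 := by
  set S : Set ((Finset G → ℝ) × (G → ℝ)) :=
    {p | (∀ Y, ¬ IsExcited D Y → p.1 Y = if Y = D then 1 else 0) ∧ 4 * solNorm D W p.1 p.2 ≤ 1}
    with hS
  have hD : ¬ IsExcited D D := by simpa using h.not_isExcited_translate 0
  have hle : ∀ x : ℝ≥0∞, 4 * x ≤ 1 → x ≤ 1 := fun x hx => by
    refine le_trans ?_ hx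
    calc x = 1 * x := (one_mul x).symm
      _ ≤ 4 * x := by gcongr; norm_num
  have habs : ∀ x : ℝ, ‖x‖ₑ ≤ 1 → x ∈ Set.Icc (-1 : ℝ) 1 := fun x hx => by
    rw [Set.mem_Icc, ← abs_le]
    have := (enorm_le_coe (r := 1)).1 (by simpa using hx)
    exact_mod_cast this
  have hcompact : IsCompact S := by
    refine IsCompact.of_isClosed_subset
      ((isCompact_univ_pi fun _ : Finset G => isCompact_Icc (a := (-1 : ℝ)) (b := 1)).prod
        (isCompact_univ_pi fun _ : G => isCompact_Icc (a := (-1 : ℝ)) (b := 1))) ?_ ?_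
    · have h1 : {p : (Finset G → ℝ) × (G → ℝ) | ∀ Y, ¬ IsExcited D Y →
          p.1 Y = if Y = D then 1 else 0} = ⋂ Y, ⋂ (_ : ¬ IsExcited D Y),
            {p | p.1 Y = if Y = D then 1 else 0} := by
        ext
        simp
      have h2 : IsClosed {p : (Finset G → ℝ) × (G → ℝ) | ∀ Y, ¬ IsExcited D Y →
          p.1 Y = if Y = D then 1 else 0} := by
        rw [h1]
        exact isClosed_iInter fun Y => isClosed_iInter fun _ =>
          isClosed_eq (by fun_prop) continuous_const
      exact h2.inter (isClosed_le ((ENNReal.continuous_const_mul (by simp)).comp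
        h.continuous_solNorm) continuous_const)
    · rintro ⟨u, a⟩ ⟨hu, hp⟩
      have hp := hle _ hp
      refine ⟨fun Y _ => ?_, fun s _ => ?_⟩
      · by_cases hY : IsExcited D Y
        · refine habs _ ((h.enorm_le_ampNorm u hY).trans (le_trans ?_ hp))
          rw [solNorm, two_mul]
          exact le_add_left le_self_add
        · have := hu Y hY
          dsimp only at this ⊢
          rw [this]
          split_ifs <;> simp
      · refine habs _ (le_trans ?_ hp)
        exact (ENNReal.le_tsum s).trans ((h.tsum_enorm_le_fourNorm a).trans le_self_add)
  have hne : S.Nonempty := by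
    refine ⟨(fun Y => if Y = D then 1 else 0, fun _ => 0), fun Y _ => rfl, ?_⟩
    have : solNorm D W (fun Y => if Y = D then 1 else 0) (fun _ => 0) = 0 := by
      rw [h.solNorm_eq_zero_iff]
      refine ⟨fun _ => rfl, fun Y hY => if_neg ?_⟩
      rintro rfl
      exact hD hY
    simp [this]
  have hcont : Continuous fun p : (Finset G → ℝ) × (G → ℝ) =>
      solNorm D W (fun Y => fixAmp ε D p.1 p.2 Y - p.1 Y) (fun s => fixFour ε D p.1 s - p.2 s) := by
    refine h.continuous_solNorm.comp (f := fun p : (Finset G → ℝ) × (G → ℝ) =>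
      ((fun Y => fixAmp ε D p.1 p.2 Y - p.1 Y), fun s => fixFour ε D p.1 s - p.2 s)) ?_
    refine Continuous.prodMk (continuous_pi fun Y => ?_) (continuous_pi fun s => ?_)
    · simp only [fixAmp, tsum_fintype]
      split_ifs <;> fun_prop
    · simp only [fixFour]
      fun_prop
  obtain ⟨⟨u, a⟩, ⟨hu, hp⟩, hmin⟩ := hcompact.exists_isMinOn hne hcont.continuousOn
  have hu' : ∀ Y, ¬ IsExcited D Y → fixAmp ε D u a Y = if Y = D then 1 else 0 := fun Y hY =>
    if_neg hY
  have hp' := four_mul_solNorm_fix_le h hε hp hu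
  have h1 := hmin (show (fixAmp ε D u a, fixFour ε D u) ∈ S from ⟨hu', hp'⟩)
  simp only [Set.mem_ofPred_eq] at h1
  have h2 := two_mul_solNorm_fix_sub_le h hε hp' hp fun Y hY => (hu' Y hY).trans (hu Y hY).symm
  have hfin : solNorm D W (fun Y => fixAmp ε D u a Y - u Y) (fun s => fixFour ε D u s - a s) ≠ ∞ :=
    ne_top_of_le_ne_top (by simp) ((solNorm_sub_le _ _ _ _).trans
      (add_le_add (hle _ hp') (hle _ hp)))
  have h0 := eq_zero_of_two_mul_le hfin ((mul_le_mul_right h1 2).trans h2)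
  rw [h.solNorm_eq_zero_iff] at h0
  refine ⟨u, a, funext fun Y => ?_, funext fun s => sub_eq_zero.1 (h0.1 s), hp⟩
  by_cases hY : IsExcited D Y
  · exact sub_eq_zero.1 (h0.2 Y hY)
  · exact (hu' Y hY).trans (hu Y hY).symm

end Existence

/-! ### Distances in the hopping graph -/

section Distance

variable {G : Type*} [CommRing G] [DecidableEq G] [Nontrivial G]

/-- Translation as an automorphism of the hopping graph. -/
def translateIso (s : G) : hopGraph G ≃g hopGraph G where
  toFun Y := translate Y s
  invFun Y := translate Y (-s)
  left_inv Y := by simp [translate_translate]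
  right_inv Y := by simp [translate_translate]
  map_rel_iff' {Y Z} := by
    change (∃ j ∈ walls (translate Y s), translate Z s = hop (translate Y s) j) ↔
      ∃ j ∈ walls Y, Z = hop Y j
    constructor
    · rintro ⟨j, hj, h⟩
      rw [walls_translate, mem_translate] at hj
      refine ⟨j - s, hj, translate_injective s ?_⟩
      change translate Z s = translate (hop Y (j - s)) s
      rw [← hop_translate, sub_add_cancel]
      exact h
    · rintro ⟨j, hj, rfl⟩
      refine ⟨j + s, ?_, ?_⟩
      · rwa [walls_translate, mem_translate, add_sub_cancel_right]
      · rw [hop_translate]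

theorem reachable_translate {Y Z : Finset G} (h : (hopGraph G).Reachable Y Z) (s : G) :
    (hopGraph G).Reachable (translate Y s) (translate Z s) :=
  h.map (translateIso s).toHom

theorem dist_translate_le {Y Z : Finset G} (h : (hopGraph G).Reachable Y Z) (s : G) :
    (hopGraph G).dist (translate Y s) (translate Z s) ≤ (hopGraph G).dist Y Z := by
  obtain ⟨p, hp⟩ := h.exists_walk_length_eq_dist
  rw [← hp, ← SimpleGraph.Walk.length_map (translateIso s).toHom]
  exact SimpleGraph.dist_le _

theorem dist_translate (Y Z : Finset G) (s : G) :
    (hopGraph G).dist (translate Y s) (translate Z s) = (hopGraph G).dist Y Z := by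
  have hback : ∀ Y : Finset G, translate (translate Y s) (-s) = Y := fun Y => by
    simp [translate_translate]
  by_cases h : (hopGraph G).Reachable Y Z
  · refine le_antisymm (dist_translate_le h s) ?_
    simpa only [hback] using dist_translate_le (reachable_translate h s) (-s)
  · rw [SimpleGraph.dist_eq_zero_of_not_reachable h, SimpleGraph.dist_eq_zero_of_not_reachable]
    intro h'
    exact h (by simpa only [hback] using reachable_translate h' (-s))

/-- The weight `Y ↦ ρ ^ dist(D, Y)` has the properties needed for the contraction estimate, if `D`
can be moved to its translates by hops. -/
theorem weightData_pow_dist {D : Finset G} (hcard : (walls D).card ≤ 2)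
    (hinj : ∀ s, translate D s = D → s = 0)
    (hreach : ∀ s, (hopGraph G).Reachable D (translate D s)) {ρ : ℝ≥0∞} (hρ : 1 ≤ ρ)
    (hρ' : ρ ≠ ∞) : WeightData D (fun Y => ρ ^ (hopGraph G).dist D Y) ρ where
  card_walls_le := hcard
  eq_zero_of_translate := hinj
  weight_self := by simp
  one_le _ := one_le_pow₀ hρ
  ne_top _ := ENNReal.pow_ne_top hρ'
  hop_le Y j hj := by
    have hadj : (hopGraph G).Adj Y (hop Y j) := ⟨j, hj, rfl⟩
    rw [← pow_succ']
    refine pow_le_pow_right₀ hρ ?_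
    have := hadj.reachable.dist_triangle_right D
    rwa [SimpleGraph.dist_eq_one_iff_adj.2 hadj] at this
  le_neg s := by
    refine pow_le_pow_right₀ hρ (le_of_eq ?_)
    rw [← dist_translate D (translate D s) (-s), SimpleGraph.dist_comm]
    simp [translate_translate]
  le_mul Y s := by
    rw [← pow_add]
    refine pow_le_pow_right₀ hρ ?_
    have := (hreach (-s)).dist_triangle_left Y
    rwa [← dist_translate (translate D (-s)) Y s, translate_translate, neg_add_cancel,
      translate_zero] at this

/-- A hop changes the sum of a function with increments at most `1` by at most `1`. -/
theorem abs_sum_hop_sub_le {f : G → ℤ} (hf : ∀ j, |f (j + 1) - f j| ≤ 1) {Y : Finset G} {j : G}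
    (hj : j ∈ walls Y) : |∑ y ∈ hop Y j, f y - ∑ y ∈ Y, f y| ≤ 1 := by
  rw [mem_walls] at hj
  have hfj := hf j
  by_cases h : j ∈ Y
  · have h' : j + 1 ∉ Y := by tauto
    rw [hop_of_mem h h', Finset.sum_insert (by simp [h']), ← Finset.add_sum_erase Y f h]
    simpa using hfj
  · have h' : j + 1 ∈ Y := by tauto
    rw [hop_of_notMem h h', Finset.sum_insert (by simp [h]), ← Finset.add_sum_erase Y f h']
    rw [abs_sub_comm] at hfj
    simpa using hfj

/-- Potentials with increments at most `1` bound the number of hops from below. -/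
theorem abs_sum_sub_le_dist {f : G → ℤ} (hf : ∀ j, |f (j + 1) - f j| ≤ 1) {Y Z : Finset G}
    (h : (hopGraph G).Reachable Y Z) :
    |∑ y ∈ Z, f y - ∑ y ∈ Y, f y| ≤ (hopGraph G).dist Y Z := by
  obtain ⟨p, hp⟩ := h.exists_walk_length_eq_dist
  rw [← hp]
  clear hp h
  induction p with
  | nil => simp
  | cons hadj p ih =>
    rw [SimpleGraph.Walk.length_cons]
    obtain ⟨j, hj, rfl⟩ := hadj
    have := abs_sum_hop_sub_le hf hj
    push_cast
    rw [abs_le] at *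
    constructor <;> linarith [ih.1, ih.2, this.1, this.2]

end Distance

/-! ### Droplets -/

section Interval

variable {G : Type*} [CommRing G] [DecidableEq G]

/-- The droplet `{1, …, m}`, on a finite or an infinite chain. -/
def interval (G : Type*) [CommRing G] [DecidableEq G] (m : ℕ) : Finset G :=
  (Finset.Icc 1 m).image fun i : ℕ => (i : G)

theorem mem_interval {m : ℕ} {x : G} : x ∈ interval G m ↔ ∃ i : ℕ, 1 ≤ i ∧ i ≤ m ∧ (i : G) = x := by
  simp [interval, and_assoc]

/-- The only site outside a droplet whose right neighbour is inside is the site `0`. -/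
theorem eq_zero_of_add_one_mem_interval {m : ℕ} {j : G} (h : j ∉ interval G m)
    (h' : j + 1 ∈ interval G m) : j = 0 := by
  obtain ⟨i, h1, h2, h3⟩ := mem_interval.1 h'
  obtain ⟨k, rfl⟩ : ∃ k, i = k + 1 := ⟨i - 1, by omega⟩
  have hk : (k : G) = j := by
    push_cast at h3
    exact add_right_cancel h3
  rcases Nat.eq_zero_or_pos k with rfl | hk0
  · rw [← hk, Nat.cast_zero]
  · exact absurd (mem_interval.2 ⟨k, hk0, by omega, hk⟩) h

theorem walls_interval_subset (m : ℕ) : walls (interval G m) ⊆ {0, (m : G)} := by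
  intro j hj
  rw [Finset.mem_insert, Finset.mem_singleton]
  by_cases h : j ∈ interval G m
  · right
    have h' : j + 1 ∉ interval G m := by
      rw [mem_walls] at hj
      tauto
    obtain ⟨i, h1, h2, rfl⟩ := mem_interval.1 h
    by_contra hne
    have : i ≠ m := fun h0 => hne (by rw [h0])
    exact h' (mem_interval.2 ⟨i + 1, by omega, by omega, by push_cast; rfl⟩)
  · left
    rw [mem_walls] at hj
    exact eq_zero_of_add_one_mem_interval h (by tauto)

theorem card_walls_interval_le (m : ℕ) : (walls (interval G m)).card ≤ 2 :=
  (Finset.card_le_card (walls_interval_subset m)).trans Finset.card_le_two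

variable {m : ℕ} (hinj : Set.InjOn (Nat.cast : ℕ → G) (Set.Iic m))

include hinj

omit [DecidableEq G] in
theorem injOn_natCast_Icc : Set.InjOn (Nat.cast : ℕ → G) (Set.Icc 1 (m + 1)) := by
  intro i hi k hk h
  obtain ⟨i, rfl⟩ : ∃ l, i = l + 1 := ⟨i - 1, by have := hi.1; omega⟩
  obtain ⟨k, rfl⟩ : ∃ l, k = l + 1 := ⟨k - 1, by have := hk.1; omega⟩
  push_cast at h
  have hi' : i ≤ m := by have := hi.2; omega
  have hk' : k ≤ m := by have := hk.2; omega
  rw [hinj hi' hk' (add_right_cancel h)]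

theorem card_interval : (interval G m).card = m := by
  rw [interval, Finset.card_image_of_injOn, Nat.card_Icc, Nat.add_sub_cancel]
  intro i hi k hk h
  exact hinj (Finset.mem_Icc.1 hi).2 (Finset.mem_Icc.1 hk).2 h

theorem eq_zero_of_translate_interval (hm : 0 < m) {s : G}
    (h : translate (interval G m) s = interval G m) : s = 0 := by
  have h0 : (0 : G) ∉ interval G m := by
    intro h0
    obtain ⟨i, h1, h2, h3⟩ := mem_interval.1 h0
    have := hinj (show i ∈ Set.Iic m from h2) (show 0 ∈ Set.Iic m from Nat.zero_le m)
      (by simpa using h3)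
    omega
  refine eq_zero_of_add_one_mem_interval (m := m) ?_ ?_
  · rw [← h, mem_translate, sub_self]
    exact h0
  · rw [← h, mem_translate, add_sub_cancel_left]
    exact mem_interval.2 ⟨1, le_rfl, hm, by simp⟩

/-- Moving the spins one after the other, starting with the rightmost one, shifts a droplet. -/
theorem reachable_interval_translate_one [Nontrivial G] :
    (hopGraph G).Reachable (interval G m) (translate (interval G m) 1) := by
  have hinj' := injOn_natCast_Icc hinj
  have hin : ∀ k : ℕ, 1 ≤ k → k ≤ m + 1 → (k : G) ∈ interval G (m + 1) := fun k h1 h2 =>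
    mem_interval.2 ⟨k, h1, h2, rfl⟩
  have step : ∀ k : ℕ, 1 ≤ k → k ≤ m →
      (hopGraph G).Adj ((interval G (m + 1)).erase ((k + 1 : ℕ) : G))
        ((interval G (m + 1)).erase (k : G)) := by
    intro k h1 h2
    have hk : (k : G) + 1 ≠ k := by simp
    have ha := hin k h1 (by omega)
    have hb := hin (k + 1) (by omega) (by omega)
    push_cast at hb ⊢
    refine ⟨k, ?_, ?_⟩
    · rw [mem_walls]
      simp [ha]
    · ext x
      rw [mem_hop]
      simp only [Finset.mem_erase]
      by_cases hx1 : x = k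
      · subst hx1
        simp [ha]
      · by_cases hx2 : x = k + 1
        · subst hx2
          simp [hb]
        · simp [hx1, hx2]
  have hreach : ∀ k : ℕ, k ≤ m → (hopGraph G).Reachable
      ((interval G (m + 1)).erase ((m + 1 : ℕ) : G))
      ((interval G (m + 1)).erase ((m + 1 - k : ℕ) : G)) := by
    intro k
    induction k with
    | zero => intro _; exact SimpleGraph.Reachable.refl _
    | succ k ih =>
      intro hk
      refine (ih (by omega)).trans ?_
      have := step (m + 1 - (k + 1)) (by omega) (by omega)
      rw [show m + 1 - (k + 1) + 1 = m + 1 - k by omega] at this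
      exact this.reachable
  have hstart : (interval G (m + 1)).erase ((m + 1 : ℕ) : G) = interval G m := by
    ext x
    simp only [Finset.mem_erase, mem_interval]
    constructor
    · rintro ⟨hne, i, h1, h2, rfl⟩
      refine ⟨i, h1, ?_, rfl⟩
      have : i ≠ m + 1 := fun h => hne (by rw [h])
      omega
    · rintro ⟨i, h1, h2, rfl⟩
      refine ⟨fun h => ?_, i, h1, by omega, rfl⟩
      have := hinj' (show i ∈ Set.Icc 1 (m + 1) from ⟨h1, by omega⟩)
        (show m + 1 ∈ Set.Icc 1 (m + 1) from ⟨by omega, le_rfl⟩) h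
      omega
  have hend : (interval G (m + 1)).erase ((m + 1 - m : ℕ) : G) = translate (interval G m) 1 := by
    rw [Nat.add_sub_cancel_left, Nat.cast_one]
    ext x
    simp only [Finset.mem_erase, mem_translate, mem_interval]
    constructor
    · rintro ⟨hne, i, h1, h2, rfl⟩
      have : i ≠ 1 := fun h => hne (by rw [h, Nat.cast_one])
      refine ⟨i - 1, by omega, by omega, ?_⟩
      rw [Nat.cast_sub h1, Nat.cast_one]
    · rintro ⟨i, h1, h2, h3⟩
      have h4 : x = ((i + 1 : ℕ) : G) := by
        push_cast
        rw [h3, sub_add_cancel]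
      refine ⟨fun h => ?_, i + 1, by omega, by omega, h4.symm⟩
      have := hinj' (show i + 1 ∈ Set.Icc 1 (m + 1) from ⟨by omega, by omega⟩)
        (show 1 ∈ Set.Icc 1 (m + 1) from ⟨le_rfl, by omega⟩) (by rw [← h4, h, Nat.cast_one])
      omega
  rw [← hend]
  conv_lhs => rw [← hstart]
  exact hreach m le_rfl

theorem reachable_interval_translate_natCast [Nontrivial G] (n : ℕ) :
    (hopGraph G).Reachable (interval G m) (translate (interval G m) n) := by
  induction n with
  | zero => simp
  | succ n ih =>
    have := reachable_translate ih 1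
    rw [translate_translate] at this
    push_cast
    exact (reachable_interval_translate_one hinj).trans this

end Interval

/-! ### The fixed point equation on the ring -/

section FiniteChain

variable {N : ℕ} [NeZero N] {m : ℕ}

omit [NeZero N] in
theorem injOn_natCast_zmod (hmN : m < N) : Set.InjOn (Nat.cast : ℕ → ZMod N) (Set.Iic m) := by
  intro i hi k hk h
  have hi' : i ≤ m := hi
  have hk' : k ≤ m := hk
  rwa [ZMod.natCast_eq_natCast_iff', Nat.mod_eq_of_lt (by omega),
    Nat.mod_eq_of_lt (by omega)] at h

omit [NeZero N] in
theorem M_eq_interval : M N m = interval (ZMod N) m := rfl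

omit [NeZero N] in
theorem shift_eq_translate (Y : Finset (ZMod N)) (s : ZMod N) : shift Y s = translate Y s := rfl

theorem bdry_eq_walls (Y : Finset (ZMod N)) : bdry Y = walls Y := by
  ext j
  simp [bdry, mem_walls]

omit [NeZero N] in
theorem card_M (hmN : m < N) : (M N m).card = m :=
  card_interval (injOn_natCast_zmod hmN)

theorem reachable_M_translate (hmN : m < N) [Nontrivial (ZMod N)] (s : ZMod N) :
    (hopGraph (ZMod N)).Reachable (M N m) (translate (M N m) s) := by
  have := reachable_interval_translate_natCast (injOn_natCast_zmod hmN) s.val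
  rwa [ZMod.natCast_zmod_val] at this

theorem weightData_M (hm : 0 < m) (hmN : m < N) [Nontrivial (ZMod N)] {ρ : ℝ≥0∞} (hρ : 1 ≤ ρ)
    (hρ' : ρ ≠ ∞) :
    WeightData (M N m) (fun Y => ρ ^ (hopGraph (ZMod N)).dist (M N m) Y) ρ :=
  weightData_pow_dist (card_walls_interval_le m)
    (fun _ h => eq_zero_of_translate_interval (injOn_natCast_zmod hmN) hm h)
    (reachable_M_translate hmN) hρ hρ'

/-- The distance `w` of the fixed point equation is the distance in the hopping graph. -/
theorem w_eq_dist [Nontrivial (ZMod N)] (X : Finset (ZMod N)) :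
    w m X = (hopGraph (ZMod N)).dist (M N m) (X ∆ M N m) := by
  rw [w, SimpleGraph.dist_eq_sInf]
  congr 1
  ext n
  rw [Set.mem_range]
  constructor
  · rintro ⟨S, h0, hn, hS⟩
    have key : ∀ k ≤ n, ∃ p : (hopGraph (ZMod N)).Walk (M N m) (S k ∆ M N m), p.length = k := by
      intro k
      induction k with
      | zero =>
        intro _
        rw [h0, ← Finset.bot_eq_empty, bot_symmDiff]
        exact ⟨SimpleGraph.Walk.nil, rfl⟩
      | succ k ih =>
        intro hk
        obtain ⟨p, hp⟩ := ih (by omega)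
        obtain ⟨j, hj, hSj⟩ := hS k (by omega)
        have hadj : (hopGraph (ZMod N)).Adj (S k ∆ M N m) (S (k + 1) ∆ M N m) := by
          refine ⟨j, by rwa [← bdry_eq_walls], ?_⟩
          rw [hSj, hop, symmDiff_right_comm]
        exact ⟨p.concat hadj, by rw [SimpleGraph.Walk.length_concat, hp]⟩
    rw [← hn]
    exact key n le_rfl
  · rintro ⟨p, rfl⟩
    refine ⟨fun k => p.getVert k ∆ M N m, ?_, ?_, ?_⟩
    · simp
    · simp
    · intro k hk
      obtain ⟨j, hj, h⟩ := p.adj_getVert_succ hk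
      refine ⟨j, ?_, ?_⟩
      · rw [bdry_eq_walls, symmDiff_symmDiff_cancel_right]
        exact hj
      · simp only [h, hop]
        rw [symmDiff_right_comm]

/-- The amplitude `e(Y ∆ M)` of the configuration `Y`. -/
def Unknowns.amp (e : Unknowns N m) (Y : Finset (ZMod N)) : ℝ := e.val (Y ∆ M N m)

theorem excited_iff (hmN : m < N) (X : Finset (ZMod N)) :
    Excited m X ↔ IsExcited (M N m) (X ∆ M N m) := by
  rw [IsExcited, card_M hmN, Excited, InSec, nb, bdry_eq_walls]

theorem isExcited_iff (hmN : m < N) (Y : Finset (ZMod N)) :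
    IsExcited (M N m) Y ↔ Excited m (Y ∆ M N m) := by
  rw [excited_iff hmN, symmDiff_symmDiff_cancel_right]

theorem amp_of_not_isExcited (hmN : m < N) (e : Unknowns N m) {Y : Finset (ZMod N)}
    (hY : ¬ IsExcited (M N m) Y) : e.amp Y = if Y = M N m then 1 else 0 := by
  rw [isExcited_iff hmN] at hY
  rw [Unknowns.amp, Unknowns.val, dif_neg hY]
  simp only [← Finset.bot_eq_empty, symmDiff_eq_bot]

theorem amp_of_excited (e : Unknowns N m) (X : {X : Finset (ZMod N) // Excited m X}) :
    e.amp (X.1 ∆ M N m) = e.coeff X := by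
  rw [Unknowns.amp, symmDiff_symmDiff_cancel_right, Unknowns.val, dif_pos X.2]

theorem val_eq_amp (e : Unknowns N m) (X : Finset (ZMod N)) : e.val X = e.amp (X ∆ M N m) := by
  rw [Unknowns.amp, symmDiff_symmDiff_cancel_right]

omit [NeZero N] in
theorem translate_symmDiff (Y Z : Finset (ZMod N)) (s : ZMod N) :
    translate (Y ∆ Z) s = translate Y s ∆ translate Z s := by
  ext x
  simp [mem_translate, Finset.mem_symmDiff]

theorem Fmap_coeff (hmN : m < N) (ε : ℝ) (e : Unknowns N m)
    (X : {X : Finset (ZMod N) // Excited m X}) :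
    (Fmap ε e).coeff X = fixAmp ε (M N m) e.amp e.four (X.1 ∆ M N m) := by
  rw [fixAmp, if_pos ((excited_iff hmN _).1 X.2), tsum_fintype]
  simp only [Fmap, nb, bdry_eq_walls, val_eq_amp, symmDiff_symmDiff_cancel_right,
    shift_eq_translate, translate_symmDiff, hop]
  simp only [symmDiff_right_comm]

theorem Fmap_four (ε : ℝ) (e : Unknowns N m) (s : ZMod N) :
    (Fmap ε e).four s = fixFour ε (M N m) e.amp s := by
  simp only [Fmap, fixFour, bdry_eq_walls, val_eq_amp, shift_eq_translate, hop]
  congr 2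
  refine Finset.sum_congr rfl fun j _ => ?_
  congr 1
  ext x
  simp only [Finset.mem_symmDiff]
  tauto

/-- The fixed point equation in terms of the amplitudes of configurations. -/
theorem Fmap_eq_iff (hmN : m < N) (ε : ℝ) (e : Unknowns N m) :
    Fmap ε e = e ↔ fixAmp ε (M N m) e.amp e.four = e.amp ∧ fixFour ε (M N m) e.amp = e.four := by
  constructor
  · intro h
    refine ⟨funext fun Y => ?_, funext fun s => ?_⟩
    · by_cases hY : IsExcited (M N m) Y
      · have hX := (isExcited_iff hmN Y).1 hY
        have h1 := Fmap_coeff hmN ε e ⟨_, hX⟩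
        have h2 := amp_of_excited e ⟨_, hX⟩
        simp only [symmDiff_symmDiff_cancel_right] at h1 h2
        rw [← h1, h2, h]
      · rw [amp_of_not_isExcited hmN e hY, fixAmp, if_neg hY]
    · rw [← Fmap_four, h]
  · rintro ⟨h1, h2⟩
    ext i
    · rw [Fmap_coeff hmN, h1, amp_of_excited]
    · rw [Fmap_four, h2]

theorem Unknowns.ext_amp {e e' : Unknowns N m} (h : e.amp = e'.amp) (h' : e.four = e'.four) :
    e = e' := by
  ext i
  · rw [← amp_of_excited, ← amp_of_excited, h]
  · rw [h']

/-- Amplitudes that are normalized on the configurations with few domain walls come from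
unknowns. -/
theorem exists_amp_eq (hmN : m < N) {u : Finset (ZMod N) → ℝ} (a : ZMod N → ℝ)
    (hu : ∀ Y, ¬ IsExcited (M N m) Y → u Y = if Y = M N m then 1 else 0) :
    ∃ e : Unknowns N m, e.amp = u ∧ e.four = a := by
  refine ⟨⟨fun X => u (X.1 ∆ M N m), a⟩, funext fun Y => ?_, rfl⟩
  by_cases hY : IsExcited (M N m) Y
  · have := amp_of_excited (⟨fun X => u (X.1 ∆ M N m), a⟩ : Unknowns N m)
      ⟨_, (isExcited_iff hmN Y).1 hY⟩
    simpa only [symmDiff_symmDiff_cancel_right] using this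
  · rw [amp_of_not_isExcited hmN _ hY, hu Y hY]

/-- For `ε ≠ 0` the norm of the fixed point equation is the weighted norm of the contraction
estimate. -/
theorem ofReal_wnorm (hmN : m < N) [Nontrivial (ZMod N)] {K ε : ℝ} (hr : 0 < K * |ε|)
    (e : Unknowns N m) :
    ENNReal.ofReal (wnorm K ε e) = solNorm (M N m)
      (fun Y => ENNReal.ofReal (K * |ε|)⁻¹ ^ (hopGraph (ZMod N)).dist (M N m) Y)
      e.amp e.four := by
  have hpow : ∀ d : ℕ, ENNReal.ofReal ((K * |ε|) ^ (-(d : ℤ))) =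
      ENNReal.ofReal (K * |ε|)⁻¹ ^ d := fun d => by
    rw [zpow_neg, zpow_natCast, ← inv_pow, ENNReal.ofReal_pow (by positivity)]
  have hn : ∀ X : {X : Finset (ZMod N) // Excited m X}, (0 : ℝ) ≤ (nb m X.1 : ℝ) - 2 := by
    intro X
    have : (2 : ℝ) < nb m X.1 := by exact_mod_cast X.2.2
    linarith
  rw [wnorm, ENNReal.ofReal_add (Finset.sum_nonneg fun s _ => by positivity)
    (mul_nonneg zero_le_two (Finset.sum_nonneg fun X _ => by have := hn X; positivity)),
    ENNReal.ofReal_mul zero_le_two, ENNReal.ofReal_sum_of_nonneg (fun s _ => by positivity),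
    ENNReal.ofReal_sum_of_nonneg (fun X _ => by have := hn X; positivity), solNorm, fourNorm,
    ampNorm, tsum_fintype, tsum_fintype]
  congr 1
  · refine Finset.sum_congr rfl fun s _ => ?_
    rw [ENNReal.ofReal_mul (abs_nonneg _), hpow, Real.enorm_eq_ofReal_abs, w_eq_dist,
      shift_eq_translate, symmDiff_comm (M N m), symmDiff_symmDiff_cancel_right]
  · congr 1
    · simp
    have hinv : Function.Involutive fun Y : Finset (ZMod N) => Y ∆ M N m := fun Y =>
      symmDiff_symmDiff_cancel_right _ _
    rw [← Equiv.sum_comp hinv.toPerm, ← Finset.sum_filter]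
    simp only [Function.Involutive.coe_toPerm, ← excited_iff hmN]
    rw [← Finset.sum_subtype_eq_sum_filter]
    simp only [Finset.subtype_univ]
    refine Finset.sum_congr rfl fun X _ => ?_
    rw [ENNReal.ofReal_mul (by have := hn X; positivity), ENNReal.ofReal_mul (abs_nonneg _), hpow,
      w_eq_dist, amp_of_excited, Real.enorm_eq_ofReal_abs, mul_assoc, nb, bdry_eq_walls]
    congr 2
    rw [← Nat.cast_two, ← Nat.cast_sub, ENNReal.ofReal_natCast]
    rw [← bdry_eq_walls]
    exact X.2.2.le

end FiniteChain

/-- The trivial weight needs no information about distances. -/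
theorem weightData_one {G : Type*} [CommRing G] [DecidableEq G] {D : Finset G}
    (hcard : (walls D).card ≤ 2) (hinj : ∀ s, translate D s = D → s = 0) :
    WeightData D (fun _ => 1) 1 where
  card_walls_le := hcard
  eq_zero_of_translate := hinj
  weight_self := rfl
  one_le _ := le_rfl
  ne_top _ := ENNReal.one_ne_top
  hop_le _ _ _ := by simp
  le_neg _ := le_rfl
  le_mul _ _ := by simp

/-! ### The small solution on the ring -/

section Solution

variable {N : ℕ} [NeZero N] {m : ℕ}

omit [NeZero N] in
theorem nontrivial_zmod_of_lt (hm : 0 < m) (hmN : m < N) : Nontrivial (ZMod N) :=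
  have : Fact (1 < N) := ⟨by omega⟩
  inferInstance

/-- Without hopping, the droplet is the only fixed point. -/
theorem fix_zero {u : Finset (ZMod N) → ℝ} {a : ZMod N → ℝ} (hu : fixAmp 0 (M N m) u a = u)
    (ha : fixFour 0 (M N m) u = a) : u = (fun Y => if Y = M N m then 1 else 0) ∧ a = fun _ => 0 := by
  have ha0 : a = fun _ => 0 := by
    rw [← ha]
    funext s
    simp [fixFour]
  refine ⟨?_, ha0⟩
  rw [← hu, ha0]
  funext Y
  rw [fixAmp]
  split_ifs with h1 h2 h2
  · exfalso
    rw [h2] at h1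
    exact absurd (card_walls_interval_le m) (not_le.2 h1.2)
  · simp
  · rfl
  · rfl

theorem four_mul_solNorm_le_iff (hmN : m < N) [Nontrivial (ZMod N)] {ε : ℝ} (hε : ε ≠ 0)
    (e : Unknowns N m) :
    4 * solNorm (M N m)
      (fun Y => ENNReal.ofReal (100 * |ε|)⁻¹ ^ (hopGraph (ZMod N)).dist (M N m) Y)
      e.amp e.four ≤ 1 ↔ wnorm 100 ε e ≤ 1 / 4 := by
  have hpos : 0 < 100 * |ε| := by positivity
  rw [← ofReal_wnorm hmN hpos, show (4 : ℝ≥0∞) = ENNReal.ofReal 4 by simp,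
    ← ENNReal.ofReal_mul (by norm_num), ENNReal.ofReal_le_one]
  constructor <;> intro h <;> linarith

/-- The fixed point equation on a finite chain has exactly one small solution.  The case `ε = 0` is
treated directly, since there `wnorm` has vanishing weights and is not a norm. -/
theorem exists_solution (hm : 0 < m) (hmN : m < N) {ε : ℝ} (hε : 100 * |ε| < 1) :
    ∃ e : Unknowns N m, Fmap ε e = e ∧ wnorm 100 ε e ≤ 1 / 4 ∧
      ∀ e' : Unknowns N m, Fmap ε e' = e' → wnorm 100 ε e' ≤ 1 / 4 → e' = e := by
  have := nontrivial_zmod_of_lt hm hmN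
  rcases eq_or_ne ε 0 with rfl | hε0
  · obtain ⟨e, he1, he2⟩ := exists_amp_eq hmN (u := fun Y => if Y = M N m then 1 else 0)
      (fun _ => 0) (fun Y _ => rfl)
    refine ⟨e, ?_, ?_, ?_⟩
    · rw [Fmap_eq_iff hmN, he1, he2]
      constructor
      · funext Y
        rw [fixAmp]
        split_ifs with h1 h2 h2
        · exfalso
          rw [h2] at h1
          exact absurd (card_walls_interval_le m) (not_le.2 h1.2)
        · simp
        · rfl
        · rfl
      · funext s
        simp [fixFour]
    · have h0 : ∀ X : {X : Finset (ZMod N) // Excited m X}, e.coeff X = 0 := by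
        intro X
        rw [← amp_of_excited, he1]
        refine if_neg fun h => ?_
        have := (excited_iff hmN _).1 X.2
        rw [h] at this
        exact absurd (card_walls_interval_le m) (not_le.2 this.2)
      simp [wnorm, he2, h0]
    · intro e' he' _
      rw [Fmap_eq_iff hmN] at he'
      obtain ⟨h1, h2⟩ := fix_zero he'.1 he'.2
      exact Unknowns.ext_amp (h1.trans he1.symm) (h2.trans he2.symm)
  · have hpos : 0 < 100 * |ε| := by positivity
    have hρ : 1 ≤ ENNReal.ofReal (100 * |ε|)⁻¹ := by
      rw [ENNReal.one_le_ofReal]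
      exact (one_le_inv₀ hpos).2 hε.le
    have hW := weightData_M hm hmN hρ ENNReal.ofReal_ne_top
    have hκ : 100 * (‖ε‖ₑ * ENNReal.ofReal (100 * |ε|)⁻¹) ≤ 1 := by
      rw [Real.enorm_eq_ofReal_abs, ← ENNReal.ofReal_mul (abs_nonneg _),
        show (100 : ℝ≥0∞) = ENNReal.ofReal 100 by simp, ← ENNReal.ofReal_mul (by norm_num),
        ENNReal.ofReal_le_one, ← mul_assoc, mul_inv_cancel₀ hpos.ne']
    obtain ⟨u, a, hu, ha, hnorm⟩ := exists_fix hW hκ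
    obtain ⟨e, rfl, rfl⟩ := exists_amp_eq hmN (u := u) a fun Y hY => by
      rw [← hu, fixAmp, if_neg hY]
    refine ⟨e, (Fmap_eq_iff hmN ε e).2 ⟨hu, ha⟩, (four_mul_solNorm_le_iff hmN hε0 e).1 hnorm, ?_⟩
    intro e' he' hn'
    obtain ⟨hu', ha'⟩ := (Fmap_eq_iff hmN ε e').1 he'
    obtain ⟨h1, h2⟩ := fix_unique hW hκ ((four_mul_solNorm_le_iff hmN hε0 e').2 hn') hnorm
      hu' ha' hu ha
    exact Unknowns.ext_amp h1 h2

theorem solNorm_one_le (hm : 0 < m) (hmN : m < N) {ε : ℝ} (hε : 100 * |ε| < 1)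
    {e : Unknowns N m} (he : Fmap ε e = e) (hn : wnorm 100 ε e ≤ 1 / 4) :
    4 * solNorm (M N m) (fun _ => 1) e.amp e.four ≤ 1 := by
  have := nontrivial_zmod_of_lt hm hmN
  rcases eq_or_ne ε 0 with rfl | hε0
  · rw [Fmap_eq_iff hmN] at he
    obtain ⟨h1, h2⟩ := fix_zero he.1 he.2
    have hW := weightData_one (D := M N m) (card_walls_interval_le m)
      (fun _ h => eq_zero_of_translate_interval (injOn_natCast_zmod hmN) hm h)
    have : solNorm (M N m) (fun _ => 1) e.amp e.four = 0 := by
      rw [hW.solNorm_eq_zero_iff, h1, h2]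
      refine ⟨fun _ => rfl, fun Y hY => if_neg ?_⟩
      rintro rfl
      exact absurd (card_walls_interval_le m) (not_le.2 hY.2)
    simp [this]
  · refine le_trans ?_ ((four_mul_solNorm_le_iff hmN hε0 e).2 hn)
    have hρ : 1 ≤ ENNReal.ofReal (100 * |ε|)⁻¹ := by
      rw [ENNReal.one_le_ofReal]
      exact (one_le_inv₀ (by positivity)).2 hε.le
    gcongr
    refine add_le_add (ENNReal.tsum_le_tsum fun s => ?_)
      (mul_le_mul_right (ENNReal.tsum_le_tsum fun Y => ?_) 2)
    · gcongr
      exact one_le_pow₀ hρ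
    · split_ifs
      · gcongr
        exact one_le_pow₀ hρ
      · exact le_rfl

/-- The decay of the Fourier coefficients that is encoded in the norm. -/
theorem abs_four_le (hmN : m < N) [Nontrivial (ZMod N)] {ε : ℝ}
    {e : Unknowns N m} (he : Fmap ε e = e) (hn : wnorm 100 ε e ≤ 1 / 4) (s : ZMod N) :
    |e.four s| ≤ 1 / 4 * (100 * |ε|) ^ (hopGraph (ZMod N)).dist (M N m) (translate (M N m) s) := by
  rcases eq_or_ne ε 0 with rfl | hε0
  · rw [Fmap_eq_iff hmN] at he
    rw [(fix_zero he.1 he.2).2]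
    simp only [abs_zero]
    positivity
  · have hpos : 0 < 100 * |ε| := by positivity
    have hX : ∀ X : {X : Finset (ZMod N) // Excited m X}, (0 : ℝ) ≤ (nb m X.1 : ℝ) - 2 := by
      intro X
      have : (2 : ℝ) < nb m X.1 := by exact_mod_cast X.2.2
      linarith
    have h1 : |e.four s| * (100 * |ε|) ^ (-(w m (M N m ∆ shift (M N m) s) : ℤ)) ≤ 1 / 4 := by
      refine le_trans ?_ hn
      refine le_trans (Finset.single_le_sum (f := fun s => |e.four s| *
        (100 * |ε|) ^ (-(w m (M N m ∆ shift (M N m) s) : ℤ))) (fun t _ => by positivity)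
        (Finset.mem_univ s)) (le_add_of_nonneg_right ?_)
      exact mul_nonneg zero_le_two (Finset.sum_nonneg fun X _ => by have := hX X; positivity)
    rw [w_eq_dist, shift_eq_translate, symmDiff_comm (M N m), symmDiff_symmDiff_cancel_right,
      zpow_neg, zpow_natCast, ← div_eq_mul_inv, div_le_iff₀ (by positivity)] at h1
    exact h1

end Solution

/-! ### Lower bounds for the distance between translated droplets -/

section LowerBounds

variable {N : ℕ} [NeZero N] {m : ℕ}

omit [NeZero N] in
theorem sum_translate_M (hmN : m < N) (f : ZMod N → ℤ) (s : ZMod N) :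
    ∑ y ∈ translate (M N m) s, f y = ∑ i ∈ Finset.Icc 1 m, f (i + s) := by
  rw [translate, Finset.sum_image (fun x _ y _ h => add_right_cancel h), M, Finset.sum_image]
  intro i hi k hk h
  exact injOn_natCast_zmod hmN (Finset.mem_Icc.1 hi).2 (Finset.mem_Icc.1 hk).2 h

/-- The distance to the site `-c` along the ring. -/
def ringDist (c y : ZMod N) : ℤ := ((y + c).valMinAbs.natAbs : ℤ)

omit [NeZero N] in
theorem ringDist_add_le (c y s : ZMod N) :
    ringDist c (y + s) ≤ ringDist c y + s.valMinAbs.natAbs := by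
  have h := ZMod.natAbs_valMinAbs_add_le (y + c) s
  have h' := Int.natAbs_add_le (y + c).valMinAbs s.valMinAbs
  rw [ringDist, ringDist, show y + s + c = y + c + s by ring]
  exact_mod_cast h.trans h'

theorem natAbs_valMinAbs_one_le : (1 : ZMod N).valMinAbs.natAbs ≤ 1 := by
  rw [ZMod.valMinAbs_natAbs_eq_min]
  refine (min_le_left _ _).trans ?_
  rcases Nat.lt_or_ge 1 N with h | h
  · have : Fact (1 < N) := ⟨h⟩
    rw [ZMod.val_one]
  · have := ZMod.val_lt (1 : ZMod N)
    omega

theorem abs_ringDist_sub_le (c j : ZMod N) : |ringDist c (j + 1) - ringDist c j| ≤ 1 := by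
  have h1 := ringDist_add_le c j 1
  have h2 := ringDist_add_le c (j + 1) (-1)
  rw [ZMod.natAbs_valMinAbs_neg, add_neg_cancel_right] at h2
  have h3 := natAbs_valMinAbs_one_le (N := N)
  rw [abs_le]
  constructor <;> omega

theorem abs_sum_ringDist_le (hmN : m < N) [Nontrivial (ZMod N)] (c s : ZMod N) :
    |∑ i ∈ Finset.Icc 1 m, ringDist c (i + s) - ∑ i ∈ Finset.Icc 1 m, ringDist c i| ≤
      (hopGraph (ZMod N)).dist (M N m) (translate (M N m) s) := by
  have h := abs_sum_sub_le_dist (abs_ringDist_sub_le c) (reachable_M_translate hmN s)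
  have h0 := sum_translate_M hmN (ringDist c) (0 : ZMod N)
  simp only [translate_zero, add_zero] at h0
  rwa [sum_translate_M hmN, h0] at h

theorem ringDist_intCast {c : ℤ} {x : ℤ} (h1 : 0 ≤ x + c) (h2 : (x + c) * 2 ≤ N) :
    ringDist (c : ZMod N) (x : ZMod N) = x + c := by
  have : ((x : ZMod N) + (c : ZMod N)).valMinAbs = x + c := by
    rw [ZMod.valMinAbs_spec]
    refine ⟨by push_cast; rfl, ?_, h2⟩
    have : 0 < N := Nat.pos_of_neZero N
    omega
  rw [ringDist, this]
  omega

/-- Moving a droplet by `s` on the ring takes at least `|s| - 2m` hops. -/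
theorem valMinAbs_sub_le_dist (hm : 0 < m) (hmN : m < N) [Nontrivial (ZMod N)] (s : ZMod N) :
    s.valMinAbs.natAbs - 2 * m ≤ (hopGraph (ZMod N)).dist (M N m) (translate (M N m) s) := by
  rcases Nat.le_total s.valMinAbs.natAbs (2 * m) with h | h
  · omega
  have h1 := abs_sum_ringDist_le hmN 0 s
  rw [← Finset.sum_sub_distrib] at h1
  have h2 : ∀ i ∈ Finset.Icc 1 m, ((s.valMinAbs.natAbs : ℤ) - 2 * m) ≤
      ringDist 0 ((i : ZMod N) + s) - ringDist 0 (i : ZMod N) := by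
    intro i hi
    have him := (Finset.mem_Icc.1 hi).2
    have h3 := ringDist_add_le 0 ((i : ZMod N) + s) (-(i : ZMod N))
    have h4 : ringDist 0 ((i : ZMod N) + s + -(i : ZMod N)) = s.valMinAbs.natAbs := by
      rw [ringDist]
      congr 3
      ring
    have h5 : ((i : ZMod N)).valMinAbs.natAbs ≤ i := by
      rw [ZMod.valMinAbs_natAbs_eq_min]
      refine (min_le_left _ _).trans ?_
      rw [ZMod.val_natCast]
      exact Nat.mod_le _ _
    rw [ZMod.natAbs_valMinAbs_neg, h4] at h3
    have h6 : ringDist 0 (i : ZMod N) = ((i : ZMod N)).valMinAbs.natAbs := by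
      rw [ringDist, add_zero]
    omega
  have h3 := Finset.card_nsmul_le_sum _ _ _ h2
  rw [Nat.card_Icc, Nat.add_sub_cancel, nsmul_eq_mul] at h3
  have h4 : ((s.valMinAbs.natAbs : ℤ) - 2 * m) ≤ m * ((s.valMinAbs.natAbs : ℤ) - 2 * m) :=
    le_mul_of_one_le_left (by omega) (by exact_mod_cast hm)
  have h5 := (h4.trans h3).trans ((le_abs_self _).trans h1)
  omega

/-- On a long ring, every nontrivial translate of a droplet is at least `m` hops away. -/
theorem le_dist_translate (hmN : m < N) [Nontrivial (ZMod N)] {s : ℤ} (hs : s ≠ 0)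
    (hN : 4 * s.natAbs + 2 * m ≤ N) :
    m ≤ (hopGraph (ZMod N)).dist (M N m) (translate (M N m) (s : ZMod N)) := by
  have h1 := abs_sum_ringDist_le hmN ((s.natAbs : ℤ) : ZMod N) (s : ZMod N)
  rw [← Finset.sum_sub_distrib] at h1
  -- The origin of `ringDist` is chosen at distance `|s|` to the left, so that both droplets lie on
  -- the half of the ring where the function is linear.
  have h2 : ∀ i ∈ Finset.Icc 1 m, ringDist ((s.natAbs : ℤ) : ZMod N) ((i : ZMod N) + (s : ZMod N)) -
      ringDist ((s.natAbs : ℤ) : ZMod N) (i : ZMod N) = s := by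
    intro i hi
    have him := (Finset.mem_Icc.1 hi).2
    have h3 := ringDist_intCast (N := N) (c := s.natAbs) (x := i + s) (by omega) (by omega)
    have h4 := ringDist_intCast (N := N) (c := s.natAbs) (x := i) (by omega) (by omega)
    rw [Int.cast_natCast i] at h4
    rw [Int.cast_add, Int.cast_natCast i] at h3
    rw [h3, h4]
    ring
  rw [Finset.sum_congr rfl h2, Finset.sum_const, Nat.card_Icc, Nat.add_sub_cancel, nsmul_eq_mul,
    abs_mul, Nat.abs_cast] at h1
  have h3 : (1 : ℤ) ≤ |s| := Int.one_le_abs hs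
  have h4 : (m : ℤ) ≤ m * |s| := le_mul_of_one_le_right (by omega) h3
  exact_mod_cast h4.trans h1

end LowerBounds

/-! ### The Hamiltonian in the basis of site sets -/

section Hamiltonian

variable {N : ℕ} [NeZero N]

omit [NeZero N] in
theorem config_injective : Function.Injective (config : Finset (ZMod N) → Config N) := by
  intro Y Z h
  ext j
  have := congrFun h j
  simp only [config] at this
  by_cases h1 : j ∈ Y <;> by_cases h2 : j ∈ Z <;> simp_all

theorem exists_config_eq (σ : Config N) : ∃ Y, config Y = σ := by
  refine ⟨Finset.univ.filter fun j => σ j = 1, funext fun j => ?_⟩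
  simp only [config, Finset.mem_filter, Finset.mem_univ, true_and]
  split_ifs with h
  · exact h.symm
  · omega

/-- Site sets and spin configurations are the same thing. -/
noncomputable def configEquiv (N : ℕ) [NeZero N] : Finset (ZMod N) ≃ Config N :=
  Equiv.ofBijective config ⟨config_injective, exists_config_eq⟩

theorem state_ext {ψ φ : State N} (h : ∀ Y, ψ (config Y) = φ (config Y)) : ψ = φ := by
  funext σ
  obtain ⟨Y, rfl⟩ := exists_config_eq σ
  exact h Y

theorem numDown_config (Y : Finset (ZMod N)) : numDown (config Y) = Y.card := by
  rw [numDown]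
  congr 1
  ext j
  simp [config]

theorem ket_config (Y Z : Finset (ZMod N)) : ket Y (config Z) = if Z = Y then 1 else 0 := by
  rw [ket, Pi.single_apply]
  simp only [config_injective.eq_iff]

theorem inSector_iff {m : ℕ} {ψ : State N} :
    InSector m ψ ↔ ∀ Y : Finset (ZMod N), Y.card ≠ m → ψ (config Y) = 0 := by
  constructor
  · intro h Y hY
    by_contra h0
    exact hY (by rw [← numDown_config, h _ h0])
  · intro h σ hσ
    obtain ⟨Y, rfl⟩ := exists_config_eq σ
    rw [numDown_config]
    by_contra h0
    exact hσ (h Y h0)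

omit [NeZero N] in
theorem translation_config (ψ : State N) (Y : Finset (ZMod N)) :
    translation N ψ (config Y) = ψ (config (translate Y (-1))) := by
  change ψ (fun j => config Y (j + 1)) = _
  congr 1
  funext j
  simp [config, mem_translate]

omit [NeZero N] in
theorem siteOp_apply (A : Matrix (Fin 2) (Fin 2) ℂ) (j : ZMod N) (ψ : State N) (σ : Config N) :
    siteOp A j ψ σ = A (σ j) 0 * ψ (Function.update σ j 0) + A (σ j) 1 * ψ (Function.update σ j 1) := by
  simp [siteOp]

omit [NeZero N] in
theorem config_hop (Y : Finset (ZMod N)) [Nontrivial (ZMod N)] (j : ZMod N) :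
    config (hop Y j) = Function.update (Function.update (config Y) j (1 - config Y j)) (j + 1)
      (1 - config Y (j + 1)) := by
  have hne : j + 1 ≠ j := by simp
  funext x
  by_cases h2 : x = j + 1
  · subst h2
    rw [Function.update_self]
    by_cases h : j + 1 ∈ Y <;> simp [config, mem_hop, h]
  · rw [Function.update_of_ne h2]
    by_cases h1 : x = j
    · subst h1
      rw [Function.update_self]
      by_cases h : x ∈ Y <;> simp [config, mem_hop, h]
    · rw [Function.update_of_ne h1]
      simp [config, mem_hop, h1, h2]

omit [NeZero N] in
/-- The Hamiltonian of a single bond: it acts only on configurations with a domain wall there. -/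
theorem bond_apply [Nontrivial (ZMod N)] (ε : ℝ) (ψ : State N) (Y : Finset (ZMod N)) (j : ZMod N) :
    (1 - siteOp pauliZ j * siteOp pauliZ (j + 1)
      - (ε : ℂ) • (siteOp pauliX j * siteOp pauliX (j + 1))
      - (ε : ℂ) • (siteOp pauliY j * siteOp pauliY (j + 1)) : Module.End ℂ (State N)) ψ (config Y) =
      if j ∈ walls Y then 2 * ψ (config Y) - 2 * ε * ψ (config (hop Y j)) else 0 := by
  have hne : j + 1 ≠ j := by simp
  rw [config_hop]
  simp only [mem_walls, LinearMap.sub_apply, LinearMap.smul_apply, Module.End.one_apply, Module.End.mul_apply,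
    Pi.sub_apply, Pi.smul_apply, siteOp_apply, Function.update_of_ne hne, smul_eq_mul]
  have hupd : ∀ b c : Fin 2, config Y j = b → config Y (j + 1) = c →
      Function.update (Function.update (config Y) j b) (j + 1) c = config Y := by
    rintro b c rfl rfl
    simp
  by_cases h1 : j ∈ Y <;> by_cases h2 : j + 1 ∈ Y
  · have e1 : config Y j = 1 := if_pos h1
    have e2 : config Y (j + 1) = 1 := if_pos h2
    simp [e1, e2, h1, h2, pauliX, pauliY, pauliZ, hupd 1 1 e1 e2, ← mul_assoc]
  · have e1 : config Y j = 1 := if_pos h1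
    have e2 : config Y (j + 1) = 0 := if_neg h2
    simp [e1, e2, h1, h2, pauliX, pauliY, pauliZ, hupd 1 0 e1 e2, ← mul_assoc]
    ring
  · have e1 : config Y j = 0 := if_neg h1
    have e2 : config Y (j + 1) = 1 := if_pos h2
    simp [e1, e2, h1, h2, pauliX, pauliY, pauliZ, hupd 0 1 e1 e2, ← mul_assoc]
    ring
  · have e1 : config Y j = 0 := if_neg h1
    have e2 : config Y (j + 1) = 0 := if_neg h2
    simp [e1, e2, h1, h2, pauliX, pauliY, pauliZ, hupd 0 0 e1 e2, ← mul_assoc]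

theorem hamiltonian_config [Nontrivial (ZMod N)] (ε : ℝ) (ψ : State N) (Y : Finset (ZMod N)) :
    hamiltonian N ε ψ (config Y) =
      2 * (walls Y).card * ψ (config Y) - 2 * ε * ∑ j ∈ walls Y, ψ (config (hop Y j)) := by
  rw [hamiltonian, LinearMap.sum_apply, Finset.sum_apply,
    Finset.sum_congr rfl fun j _ => bond_apply ε ψ Y j, ← Finset.sum_filter, Finset.filter_univ_mem,
    Finset.sum_sub_distrib, Finset.sum_const, nsmul_eq_mul, Finset.mul_sum]
  ring

end Hamiltonian

/-! ### Configurations with two domain walls -/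

section Classification

variable {N : ℕ} [NeZero N] {m : ℕ}

omit [NeZero N] in
theorem sum_translate {A : Type*} [AddCommMonoid A] (Y : Finset (ZMod N)) (s : ZMod N)
    (f : ZMod N → A) : ∑ j ∈ translate Y s, f j = ∑ j ∈ Y, f (j + s) :=
  Finset.sum_image fun _ _ _ _ h => add_right_cancel h

/-- Induction around the ring. -/
theorem forall_of_add_one {P : ZMod N → Prop} {a : ZMod N} (h0 : P a)
    (h : ∀ j, P j → P (j + 1)) (x : ZMod N) : P x := by
  have key : ∀ n : ℕ, P (a + n) := by
    intro n
    induction n with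
    | zero => simpa using h0
    | succ n ih =>
      push_cast
      rw [← add_assoc]
      exact h _ ih
  have := key (x - a).val
  rwa [ZMod.natCast_zmod_val, add_sub_cancel] at this

theorem exists_up_step {Y : Finset (ZMod N)} (h1 : Y.Nonempty) {b : ZMod N} (h2 : b ∉ Y) :
    ∃ a, a ∉ Y ∧ a + 1 ∈ Y := by
  by_contra! h
  obtain ⟨x, hx⟩ := h1
  exact forall_of_add_one (P := fun j => j ∉ Y) h2 h x hx

theorem exists_down_step {Y : Finset (ZMod N)} (h1 : Y.Nonempty) {b : ZMod N} (h2 : b ∉ Y) :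
    ∃ d, d ∈ Y ∧ d + 1 ∉ Y := by
  by_contra! h
  obtain ⟨x, hx⟩ := h1
  exact h2 (forall_of_add_one (P := fun j => j ∈ Y) hx h b)

/-- A configuration is determined by its domain walls and one of its sites. -/
theorem eq_of_walls_eq {Y Z : Finset (ZMod N)} (h : walls Y = walls Z) {a : ZMod N} (hY : a ∉ Y)
    (hZ : a ∉ Z) : Y = Z := by
  ext x
  refine forall_of_add_one (P := fun x => x ∈ Y ↔ x ∈ Z) (a := a) (by simp [hY, hZ]) ?_ x
  intro j hj
  have := congrArg (j ∈ ·) h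
  simp only [mem_walls, eq_iff_iff] at this
  tauto

/-- On a ring, the configurations with at most two domain walls are the droplets. -/
theorem exists_translate_of_card_walls_le (hm : 0 < m) (hmN : m < N) {Y : Finset (ZMod N)}
    (hY : Y.card = m) (hw : (walls Y).card ≤ 2) : ∃ t, Y = translate (M N m) t := by
  have hne : Y.Nonempty := Finset.card_pos.1 (by omega)
  obtain ⟨b, hb⟩ : ∃ b, b ∉ Y := by
    by_contra! h
    have : Y = Finset.univ := Finset.eq_univ_iff_forall.2 h
    rw [this, Finset.card_univ, ZMod.card] at hY
    omega
  obtain ⟨a, ha, ha'⟩ := exists_up_step hne hb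
  obtain ⟨d, hd, hd'⟩ := exists_down_step hne hb
  have had : a ≠ d := fun h => ha (h ▸ hd)
  have hwY : {a, d} = walls Y := by
    refine Finset.eq_of_subset_of_card_le ?_ (by rwa [Finset.card_pair had])
    intro x hx
    rw [Finset.mem_insert, Finset.mem_singleton] at hx
    rw [mem_walls]
    rcases hx with rfl | rfl <;> tauto
  -- Compare `Y` with the droplet `Z` on the sites `a + 1, …, d`.
  set r := (d - a).val with hr
  have hrN : r < N := ZMod.val_lt _
  have hr0 : 0 < r := by
    rw [Nat.pos_iff_ne_zero, hr, Ne, ZMod.val_eq_zero, sub_eq_zero]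
    exact had.symm
  have hdr : d = r + a := by rw [hr, ZMod.natCast_zmod_val, sub_add_cancel]
  set Z := translate (interval (ZMod N) r) a with hZ
  have haZ : a ∉ Z := by
    rw [hZ, mem_translate, sub_self]
    intro h
    obtain ⟨i, h1, h2, h3⟩ := mem_interval.1 h
    have := injOn_natCast_zmod hrN (show i ∈ Set.Iic r from h2)
      (show 0 ∈ Set.Iic r from Nat.zero_le r) (by simpa using h3)
    omega
  have hdZ : d ∈ Z := by
    rw [hZ, mem_translate, hdr, add_sub_cancel_right]
    exact mem_interval.2 ⟨r, hr0, le_rfl, rfl⟩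
  have hsub : walls Z ⊆ {a, d} := by
    intro x hx
    rw [hZ, walls_translate, mem_translate] at hx
    have := walls_interval_subset r hx
    rw [Finset.mem_insert, Finset.mem_singleton] at this ⊢
    rcases this with h | h
    · exact Or.inl (sub_eq_zero.1 h)
    · exact Or.inr (by rw [hdr, ← h, sub_add_cancel])
  have hwZ : walls Z = {a, d} := by
    refine Finset.Subset.antisymm hsub ?_
    obtain ⟨x, hx, hx'⟩ := exists_up_step ⟨d, hdZ⟩ haZ
    obtain ⟨y, hy, hy'⟩ := exists_down_step ⟨d, hdZ⟩ haZ
    have h1 : x ∈ walls Z := by rw [mem_walls]; tauto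
    have h2 : y ∈ walls Z := by rw [mem_walls]; tauto
    have h3 := hsub h1
    have h4 := hsub h2
    rw [Finset.mem_insert, Finset.mem_singleton] at h3 h4
    have h5 : x = a := h3.resolve_right fun h => hx (h ▸ hdZ)
    have h6 : y = d := h4.resolve_left fun h => haZ (h ▸ hy)
    intro z hz
    rw [Finset.mem_insert, Finset.mem_singleton] at hz
    rcases hz with rfl | rfl
    · exact h5 ▸ h1
    · exact h6 ▸ h2
  have hYZ : Y = Z := eq_of_walls_eq (hwY.symm.trans hwZ.symm) ha haZ
  have hrm : r = m := by
    rw [← hY, hYZ, hZ, card_translate, card_interval (injOn_natCast_zmod hrN)]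
  exact ⟨a, by rw [hYZ, hZ, hrm]; rfl⟩

end Classification

/-! ### The quadratic form of the Hamiltonian -/

section Quadratic

variable {N : ℕ} [NeZero N]

theorem dotProduct_eq_sum (φ ψ : State N) :
    star φ ⬝ᵥ ψ = ∑ Y, star (φ (config Y)) * ψ (config Y) := by
  rw [dotProduct, ← Equiv.sum_comp (configEquiv N)]
  rfl

variable [Nontrivial (ZMod N)]

theorem sum_walls_hop_comm {A : Type*} [AddCommMonoid A]
    (F : Finset (ZMod N) → Finset (ZMod N) → A) :
    ∑ Y, ∑ j ∈ walls Y, F Y (hop Y j) = ∑ Y, ∑ j ∈ walls Y, F (hop Y j) Y := by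
  have h : ∀ g : Finset (ZMod N) → ZMod N → A,
      ∑ Y, ∑ j ∈ walls Y, g Y j = ∑ j, ∑ Y, if j ∈ walls Y then g Y j else 0 := by
    intro g
    rw [Finset.sum_comm]
    refine Finset.sum_congr rfl fun Y _ => ?_
    rw [← Finset.sum_filter, Finset.filter_univ_mem]
  rw [h, h]
  refine Finset.sum_congr rfl fun j _ => ?_
  have hinv : Function.Involutive fun Y : Finset (ZMod N) => hop Y j := fun Y => hop_hop Y j
  rw [← Equiv.sum_comp hinv.toPerm]
  simp

/-- The Hamiltonian is symmetric. -/
theorem dotProduct_hamiltonian (ε : ℝ) (φ ψ : State N) :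
    star φ ⬝ᵥ hamiltonian N ε ψ = star (hamiltonian N ε φ) ⬝ᵥ ψ := by
  rw [dotProduct_eq_sum, dotProduct_eq_sum]
  simp only [hamiltonian_config, star_sub, star_mul', star_sum, mul_sub, sub_mul,
    Finset.sum_sub_distrib]
  congr 1
  · refine Finset.sum_congr rfl fun Y _ => ?_
    simp
    ring
  · have h := sum_walls_hop_comm (N := N) fun Y Z => star (φ (config Y)) * ψ (config Z)
    calc _ = 2 * ε * ∑ Y, ∑ j ∈ walls Y, star (φ (config Y)) * ψ (config (hop Y j)) := by
          simp only [Finset.mul_sum]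
          refine Finset.sum_congr rfl fun Y _ => Finset.sum_congr rfl fun j _ => ?_
          ring
      _ = _ := by
          rw [h]
          simp only [Finset.mul_sum, Finset.sum_mul]
          refine Finset.sum_congr rfl fun Y _ => Finset.sum_congr rfl fun j _ => ?_
          simp
          ring

/-- The hopping is bounded relative to the number of domain walls. -/
theorem le_re_dotProduct_hamiltonian (ε : ℝ) (ψ : State N) :
    ∑ Y, 2 * (1 - |ε|) * ((walls Y).card * Complex.normSq (ψ (config Y))) ≤
      (star ψ ⬝ᵥ hamiltonian N ε ψ).re := by
  have hre : ∀ a b : ℂ, |(star a * b).re| ≤ (Complex.normSq a + Complex.normSq b) / 2 := by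
    intro a b
    simp only [Complex.star_def, Complex.mul_re, Complex.conj_re, Complex.conj_im,
      Complex.normSq_apply]
    rw [abs_le]
    constructor <;> nlinarith [sq_nonneg (a.re - b.re), sq_nonneg (a.im - b.im),
      sq_nonneg (a.re + b.re), sq_nonneg (a.im + b.im)]
  have h1 : (star ψ ⬝ᵥ hamiltonian N ε ψ).re =
      ∑ Y, 2 * ((walls Y).card * Complex.normSq (ψ (config Y))) -
        2 * ε * ∑ Y, ∑ j ∈ walls Y, (star (ψ (config Y)) * ψ (config (hop Y j))).re := by
    rw [dotProduct_eq_sum, Complex.re_sum, Finset.mul_sum, ← Finset.sum_sub_distrib]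
    refine Finset.sum_congr rfl fun Y _ => ?_
    have : star (ψ (config Y)) * hamiltonian N ε ψ (config Y) =
        ((2 * ((walls Y).card * Complex.normSq (ψ (config Y))) : ℝ) : ℂ) -
          ((2 * ε : ℝ) : ℂ) * ∑ j ∈ walls Y, star (ψ (config Y)) * ψ (config (hop Y j)) := by
      rw [hamiltonian_config, ← Finset.mul_sum]
      push_cast
      rw [Complex.normSq_eq_conj_mul_self]
      simp only [Complex.star_def]
      ring
    rw [this, Complex.sub_re, Complex.ofReal_re, Complex.re_ofReal_mul, Complex.re_sum]
  have h2 : |∑ Y, ∑ j ∈ walls Y, (star (ψ (config Y)) * ψ (config (hop Y j))).re| ≤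
      ∑ Y, (walls Y).card * Complex.normSq (ψ (config Y)) := by
    have h3 := sum_walls_hop_comm (N := N) fun Y Z => Complex.normSq (ψ (config Z)) / 2
    calc _ ≤ ∑ Y, ∑ j ∈ walls Y,
          (Complex.normSq (ψ (config Y)) / 2 + Complex.normSq (ψ (config (hop Y j))) / 2) := by
          refine (Finset.abs_sum_le_sum_abs _ _).trans (Finset.sum_le_sum fun Y _ =>
            (Finset.abs_sum_le_sum_abs _ _).trans (Finset.sum_le_sum fun j _ => ?_))
          rw [← add_div]
          exact hre _ _
      _ = _ := by
          simp only [Finset.sum_add_distrib]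
          rw [h3, ← Finset.sum_add_distrib]
          refine Finset.sum_congr rfl fun Y _ => ?_
          rw [Finset.sum_const, nsmul_eq_mul]
          ring
  rw [h1]
  have h4 := abs_le.1 ((abs_mul ε _).le.trans (mul_le_mul_of_nonneg_left h2 (abs_nonneg ε)))
  have h5 : ∑ Y, 2 * (1 - |ε|) * ((walls Y).card * Complex.normSq (ψ (config Y))) =
      2 * (1 - |ε|) * ∑ Y, ((walls Y).card * Complex.normSq (ψ (config Y))) := by
    rw [Finset.mul_sum]
  have h6 : ∑ Y, 2 * ((walls Y).card * Complex.normSq (ψ (config Y))) =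
      2 * ∑ Y, ((walls Y).card * Complex.normSq (ψ (config Y))) := by
    rw [Finset.mul_sum]
  rw [h5, h6]
  linarith [h4.2]

end Quadratic

/-! ### The droplet states are eigenvectors -/

section Eigenvector

variable {N : ℕ} [NeZero N] {m : ℕ}

theorem amp_of_card_ne (hmN : m < N) (e : Unknowns N m) {Y : Finset (ZMod N)} (hY : Y.card ≠ m) :
    e.amp Y = 0 := by
  rw [amp_of_not_isExcited hmN e fun h => hY (h.1.trans (card_M hmN))]
  refine if_neg ?_
  rintro rfl
  exact hY (card_M hmN)

theorem amp_translate_M (hm : 0 < m) (hmN : m < N) (e : Unknowns N m) (s : ZMod N) :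
    e.amp (translate (M N m) s) = if s = 0 then 1 else 0 := by
  rw [amp_of_not_isExcited hmN e]
  · congr 1
    rw [eq_iff_iff]
    constructor
    · exact eq_zero_of_translate_interval (injOn_natCast_zmod hmN) hm
    · rintro rfl
      simp
  · rw [isExcited_translate]
    exact fun h => absurd (card_walls_interval_le m) (not_le.2 h.2)

/-- The fixed point equation as a single equation for all configurations. -/
theorem amp_equation (hm : 0 < m) (hmN : m < N) {ε : ℝ} {e : Unknowns N m} (he : Fmap ε e = e)
    (Y : Finset (ZMod N)) :
    2 * (walls Y).card * e.amp Y - 2 * ε * ∑ j ∈ walls Y, e.amp (hop Y j) =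
      4 * e.amp Y + ∑ s, e.four s * e.amp (translate Y s) := by
  have := nontrivial_zmod_of_lt hm hmN
  obtain ⟨h1, h2⟩ := (Fmap_eq_iff hmN ε e).1 he
  by_cases hcard : Y.card = m
  · by_cases hY : IsExcited (M N m) Y
    · have h3 := congrFun h1 Y
      rw [fixAmp, if_pos hY, tsum_fintype] at h3
      have hn : (2 : ℝ) < (walls Y).card := by exact_mod_cast hY.2
      have hn0 : ((walls Y).card : ℝ) - 2 ≠ 0 := by linarith
      field_simp at h3
      linarith
    · have hle : (walls Y).card ≤ 2 := by
        by_contra h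
        exact hY ⟨hcard.trans (card_M hmN).symm, by omega⟩
      obtain ⟨t, rfl⟩ := exists_translate_of_card_walls_le hm hmN hcard hle
      have hw : (walls (translate (M N m) t)).card = 2 := by
        refine le_antisymm hle ?_
        have hne : (translate (M N m) t).Nonempty := Finset.card_pos.1 (by omega)
        obtain ⟨b, hb⟩ : ∃ b, b ∉ translate (M N m) t := by
          by_contra! h
          have h' := Finset.eq_univ_iff_forall.2 h
          rw [h', Finset.card_univ, ZMod.card] at hcard
          omega
        obtain ⟨a, ha, ha'⟩ := exists_up_step hne hb
        obtain ⟨d, hd, hd'⟩ := exists_down_step hne hb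
        have had : a ≠ d := fun h => ha (h ▸ hd)
        rw [← Finset.card_pair had]
        refine Finset.card_le_card fun x hx => ?_
        rw [Finset.mem_insert, Finset.mem_singleton] at hx
        rw [mem_walls]
        rcases hx with rfl | rfl <;> tauto
      have h3 := congrFun h2 (-t)
      rw [fixFour, neg_neg] at h3
      simp only [translate_translate, amp_translate_M hm hmN]
      have h4 : ∑ s, e.four s * (if t + s = 0 then (1 : ℝ) else 0) = e.four (-t) := by
        rw [Finset.sum_eq_single (-t)]
        · simp
        · intro s _ hs
          rw [if_neg, mul_zero]
          intro h
          exact hs (eq_neg_of_add_eq_zero_right h)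
        · simp
      rw [h4, ← h3, hw]
      push_cast
      ring
  · have h3 : ∑ j ∈ walls Y, e.amp (hop Y j) = 0 :=
      Finset.sum_eq_zero fun j hj => amp_of_card_ne hmN e (by rwa [card_hop hj])
    have h4 : ∑ s, e.four s * e.amp (translate Y s) = 0 :=
      Finset.sum_eq_zero fun s _ => by
        rw [amp_of_card_ne hmN e (by rwa [card_translate]), mul_zero]
    rw [h3, h4, amp_of_card_ne hmN e hcard]
    simp

/-- `e^{iks}` for `s` modulo `N`. -/
noncomputable def phase (k : ℝ) (s : ZMod N) : ℂ := Complex.exp (Complex.I * k * (s.valMinAbs : ℂ))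

theorem phase_intCast (p : ℕ) (n : ℤ) :
    phase (momentum N p) (n : ZMod N) = Complex.exp (Complex.I * momentum N p * n) := by
  have hN : (N : ℂ) ≠ 0 := by exact_mod_cast NeZero.ne N
  obtain ⟨t, ht⟩ : (N : ℤ) ∣ (n : ZMod N).valMinAbs - n := by
    rw [← ZMod.intCast_zmod_eq_zero_iff_dvd _ N]
    simp
  have h1 : ((n : ZMod N).valMinAbs : ℂ) = n + N * t := by
    rw [sub_eq_iff_eq_add] at ht
    rw [ht]
    push_cast
    ring
  rw [phase, h1, Complex.exp_eq_exp_iff_exists_int]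
  refine ⟨p * t, ?_⟩
  rw [momentum]
  push_cast
  field_simp

theorem phase_natCast (p n : ℕ) :
    phase (momentum N p) (n : ZMod N) = Complex.exp (Complex.I * momentum N p * n) := by
  have := phase_intCast (N := N) p n
  rwa [Int.cast_natCast, Int.cast_natCast] at this

theorem phase_add (p : ℕ) (s t : ZMod N) :
    phase (momentum N p) (s + t) = phase (momentum N p) s * phase (momentum N p) t := by
  have h : s + t = ((s.valMinAbs + t.valMinAbs : ℤ) : ZMod N) := by simp
  rw [h, phase_intCast, phase, phase, ← Complex.exp_add]
  push_cast
  ring_nf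

omit [NeZero N] in
theorem phase_zero (k : ℝ) : phase k (0 : ZMod N) = 1 := by simp [phase]

theorem phase_neg_one (p : ℕ) :
    phase (momentum N p) (-1 : ZMod N) = Complex.exp (-(Complex.I * momentum N p)) := by
  have := phase_intCast (N := N) p (-1)
  simpa using this

theorem sum_Icc_natCast (f : ZMod N → ℂ) : ∑ l ∈ Finset.Icc 1 N, f (l : ZMod N) = ∑ s, f s := by
  have himg : (Finset.Icc 1 N).image (fun l : ℕ => (l : ZMod N)) = Finset.univ := by
    rw [Finset.eq_univ_iff_forall]
    intro s
    rw [Finset.mem_image]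
    have hlt := ZMod.val_lt s
    rcases Nat.eq_zero_or_pos s.val with h | h
    · refine ⟨N, Finset.mem_Icc.2 ⟨by omega, le_rfl⟩, ?_⟩
      rw [ZMod.natCast_self, (ZMod.val_eq_zero s).1 h]
    · exact ⟨s.val, Finset.mem_Icc.2 ⟨h, hlt.le⟩, ZMod.natCast_zmod_val s⟩
  have hinj : Set.InjOn (fun l : ℕ => (l : ZMod N)) (Finset.Icc 1 N) := by
    rw [← Finset.card_image_iff, himg, Finset.card_univ, ZMod.card, Nat.card_Icc]
    omega
  rw [← himg, Finset.sum_image hinj]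

theorem droplet_config (hmN : m < N) (e : Unknowns N m) (k : ℝ) (Y : Finset (ZMod N)) :
    droplet e k (config Y) = ∑ l ∈ Finset.Icc 1 N,
      Complex.exp (Complex.I * k * l) * (e.amp (translate Y (-(l : ZMod N))) : ℂ) := by
  rw [droplet, Finset.sum_apply]
  refine Finset.sum_congr rfl fun l _ => ?_
  rw [Pi.smul_apply, smul_eq_mul]
  congr 1
  rw [Finset.sum_apply]
  simp only [Pi.smul_apply, smul_eq_mul, ket_config, shift_eq_translate, mul_ite, mul_one, mul_zero]
  have hiff : ∀ X : Finset (ZMod N), Y = translate (X ∆ M N m) (l : ZMod N) ↔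
      X = translate Y (-(l : ZMod N)) ∆ M N m := by
    intro X
    constructor
    · rintro rfl
      rw [translate_translate, add_neg_cancel, translate_zero, symmDiff_symmDiff_cancel_right]
    · rintro rfl
      rw [symmDiff_symmDiff_cancel_right, translate_translate, neg_add_cancel, translate_zero]
  simp only [hiff]
  rw [Finset.sum_ite_eq']
  simp only [Finset.mem_filter, Finset.mem_univ, true_and, InSec, symmDiff_symmDiff_cancel_right,
    card_translate]
  split_ifs with h
  · rfl
  · rw [amp_of_card_ne hmN e (by rwa [card_translate]), Complex.ofReal_zero]

theorem droplet_momentum_config (hmN : m < N) (e : Unknowns N m) (p : ℕ) (Y : Finset (ZMod N)) :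
    droplet e (momentum N p) (config Y) =
      ∑ s, phase (momentum N p) s * (e.amp (translate Y (-s)) : ℂ) := by
  rw [droplet_config hmN, ← sum_Icc_natCast]
  exact Finset.sum_congr rfl fun l _ => by rw [phase_natCast]

theorem droplet_M (hm : 0 < m) (hmN : m < N) (e : Unknowns N m) (p : ℕ) :
    droplet e (momentum N p) (config (M N m)) = 1 := by
  rw [droplet_momentum_config hmN, Finset.sum_eq_single 0]
  · rw [amp_translate_M hm hmN, phase_zero]
    simp
  · intro s _ hs
    rw [amp_translate_M hm hmN, if_neg (by simpa using hs)]
    simp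
  · simp

theorem inSector_droplet (hmN : m < N) (e : Unknowns N m) (k : ℝ) : InSector m (droplet e k) := by
  rw [inSector_iff]
  intro Y hY
  rw [droplet_config hmN]
  refine Finset.sum_eq_zero fun l _ => ?_
  rw [amp_of_card_ne hmN e (by rwa [card_translate]), Complex.ofReal_zero, mul_zero]

theorem hasMomentum_iff {k : ℝ} {ψ : State N} : HasMomentum k ψ ↔
    ∀ Y : Finset (ZMod N), ψ (config (translate Y (-1))) =
      Complex.exp (-(Complex.I * k)) * ψ (config Y) := by
  constructor
  · intro h Y
    have := congrFun h (config Y)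
    rwa [translation_config, Pi.smul_apply, smul_eq_mul] at this
  · intro h
    refine state_ext fun Y => ?_
    rw [translation_config, h, Pi.smul_apply, smul_eq_mul]

theorem droplet_translate (hmN : m < N) (e : Unknowns N m) (p : ℕ) (Y : Finset (ZMod N))
    (t : ZMod N) : droplet e (momentum N p) (config (translate Y t)) =
      phase (momentum N p) t * droplet e (momentum N p) (config Y) := by
  rw [droplet_momentum_config hmN, droplet_momentum_config hmN, Finset.mul_sum,
    ← Equiv.sum_comp (Equiv.addRight t)]
  refine Finset.sum_congr rfl fun s _ => ?_
  rw [Equiv.coe_addRight, phase_add, translate_translate, show t + -(s + t) = -s by ring]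
  ring

theorem hasMomentum_droplet (hmN : m < N) (e : Unknowns N m) (p : ℕ) :
    HasMomentum (momentum N p) (droplet e (momentum N p)) := by
  rw [hasMomentum_iff]
  intro Y
  rw [droplet_translate hmN, phase_neg_one]

theorem energy_eq (e : Unknowns N m) (k : ℝ) :
    energy e k = 4 + ∑ s, (e.four s : ℂ) * phase k s := rfl

theorem hamiltonian_droplet (hm : 0 < m) (hmN : m < N) {ε : ℝ} {e : Unknowns N m}
    (he : Fmap ε e = e) (p : ℕ) :
    hamiltonian N ε (droplet e (momentum N p)) =
      energy e (momentum N p) • droplet e (momentum N p) := by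
  have := nontrivial_zmod_of_lt hm hmN
  set χ : ZMod N → ℂ := phase (momentum N p) with hχ
  refine state_ext fun Y => ?_
  rw [hamiltonian_config, Pi.smul_apply, smul_eq_mul]
  simp only [droplet_momentum_config hmN, energy_eq, ← hχ]
  -- The fixed point equation for the translate `Y - s`.
  have hs : ∀ s, 2 * ((walls Y).card : ℂ) * (e.amp (translate Y (-s)) : ℂ) -
      2 * ε * ∑ j ∈ walls Y, (e.amp (translate (hop Y j) (-s)) : ℂ) =
      4 * (e.amp (translate Y (-s)) : ℂ) +
        ∑ t, (e.four t : ℂ) * (e.amp (translate Y (t - s)) : ℂ) := by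
    intro s
    have h := amp_equation hm hmN he (translate Y (-s))
    rw [card_walls_translate, walls_translate, sum_translate] at h
    simp only [hop_translate, translate_translate] at h
    have h' := congrArg (Complex.ofReal) h
    push_cast at h'
    rw [h']
    congr 1
    refine Finset.sum_congr rfl fun t _ => ?_
    rw [neg_add_eq_sub]
  calc _ = ∑ s, χ s * (2 * ((walls Y).card : ℂ) * (e.amp (translate Y (-s)) : ℂ) -
      2 * ε * ∑ j ∈ walls Y, (e.amp (translate (hop Y j) (-s)) : ℂ)) := by
        rw [Finset.sum_comm]
        simp only [Finset.mul_sum, ← Finset.sum_sub_distrib]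
        refine Finset.sum_congr rfl fun s _ => ?_
        rw [mul_sub, Finset.mul_sum]
        congr 1
        · ring
        · exact Finset.sum_congr rfl fun j _ => by ring
    _ = 4 * ∑ s, χ s * (e.amp (translate Y (-s)) : ℂ) +
          ∑ t, ∑ s, χ s * ((e.four t : ℂ) * (e.amp (translate Y (t - s)) : ℂ)) := by
        rw [Finset.sum_comm, Finset.mul_sum, ← Finset.sum_add_distrib]
        refine Finset.sum_congr rfl fun s _ => ?_
        rw [hs, mul_add, Finset.mul_sum]
        ring
    _ = _ := by
        rw [add_mul, Finset.sum_mul]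
        congr 1
        refine Finset.sum_congr rfl fun t _ => ?_
        rw [← Equiv.sum_comp (Equiv.addRight t), Finset.mul_sum]
        refine Finset.sum_congr rfl fun s _ => ?_
        rw [Equiv.coe_addRight, hχ, phase_add, show t - (s + t) = -s by ring]
        ring

end Eigenvector

/-! ### The spectral gap -/

section Gap

variable {N : ℕ} [NeZero N] {m : ℕ}

/-- The squared norm of a state. -/
def sqNorm (ψ : State N) : ℝ := ∑ Y : Finset (ZMod N), Complex.normSq (ψ (config Y))

theorem dotProduct_self_eq (ψ : State N) : star ψ ⬝ᵥ ψ = (sqNorm ψ : ℂ) := by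
  rw [dotProduct_eq_sum, sqNorm, Complex.ofReal_sum]
  exact Finset.sum_congr rfl fun Y _ => (Complex.normSq_eq_conj_mul_self).symm

theorem sqNorm_pos {ψ : State N} (h : ψ ≠ 0) : 0 < sqNorm ψ := by
  obtain ⟨Y, hY⟩ : ∃ Y, ψ (config Y) ≠ 0 := by
    by_contra! h0
    exact h (state_ext fun Y => h0 Y)
  exact Finset.sum_pos' (fun Y _ => Complex.normSq_nonneg _)
    ⟨Y, Finset.mem_univ _, Complex.normSq_pos.2 hY⟩

omit [NeZero N] in
theorem norm_phase (k : ℝ) (s : ZMod N) : ‖phase k s‖ = 1 := by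
  have : Complex.I * k * (s.valMinAbs : ℂ) = ((k * s.valMinAbs : ℝ) : ℂ) * Complex.I := by
    push_cast
    ring
  rw [phase, this, Complex.norm_exp_ofReal_mul_I]

theorem sum_abs_four_le (hm : 0 < m) (hmN : m < N) {ε : ℝ} (hε : 100 * |ε| < 1)
    {e : Unknowns N m} (he : Fmap ε e = e) (hn : wnorm 100 ε e ≤ 1 / 4) :
    ∑ s, |e.four s| ≤ 1 / 4 := by
  have h := solNorm_one_le hm hmN hε he hn
  have h1 : 4 * ∑ s, ‖e.four s‖ₑ ≤ 1 := by
    refine le_trans (mul_le_mul_right ?_ 4) h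
    rw [solNorm, fourNorm, tsum_fintype]
    simp only [mul_one]
    exact le_self_add
  simp only [Real.enorm_eq_ofReal_abs] at h1
  rw [← ENNReal.ofReal_sum_of_nonneg (fun s _ => abs_nonneg _),
    show (4 : ℝ≥0∞) = ENNReal.ofReal 4 by simp, ← ENNReal.ofReal_mul (by norm_num),
    ENNReal.ofReal_le_one] at h1
  linarith

theorem abs_re_energy_sub_le (hm : 0 < m) (hmN : m < N) {ε : ℝ} (hε : 100 * |ε| < 1)
    {e : Unknowns N m} (he : Fmap ε e = e) (hn : wnorm 100 ε e ≤ 1 / 4) (k : ℝ) :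
    |(energy e k).re - 4| ≤ 1 / 4 := by
  have h : (energy e k).re - 4 = (∑ s, (e.four s : ℂ) * phase k s).re := by
    rw [energy_eq, Complex.add_re]
    simp
  rw [h]
  refine (Complex.abs_re_le_norm _).trans ((norm_sum_le _ _).trans ?_)
  simp only [norm_mul, norm_phase, mul_one, Complex.norm_real, Real.norm_eq_abs]
  exact sum_abs_four_le hm hmN hε he hn

theorem droplet_ne_zero (hm : 0 < m) (hmN : m < N) (e : Unknowns N m) (p : ℕ) :
    droplet e (momentum N p) ≠ 0 := by
  intro h
  have := droplet_M hm hmN e p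
  rw [h] at this
  simp at this

theorem energy_im (hm : 0 < m) (hmN : m < N) {ε : ℝ} {e : Unknowns N m} (he : Fmap ε e = e)
    (p : ℕ) : (energy e (momentum N p)).im = 0 := by
  have := nontrivial_zmod_of_lt hm hmN
  set Ψ := droplet e (momentum N p) with hΨ
  have h := dotProduct_hamiltonian ε Ψ Ψ
  rw [hΨ, hamiltonian_droplet hm hmN he, ← hΨ, star_smul, dotProduct_smul, smul_dotProduct,
    dotProduct_self_eq, smul_eq_mul, smul_eq_mul] at h
  have h0 : (sqNorm Ψ : ℂ) ≠ 0 := by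
    exact_mod_cast (sqNorm_pos (droplet_ne_zero hm hmN e p)).ne'
  exact Complex.conj_eq_iff_im.1 (mul_right_cancel₀ h0 h).symm

theorem energy_eq_re (hm : 0 < m) (hmN : m < N) {ε : ℝ} {e : Unknowns N m} (he : Fmap ε e = e)
    (p : ℕ) : energy e (momentum N p) = ((energy e (momentum N p)).re : ℂ) :=
  (Complex.conj_eq_iff_re.1 (Complex.conj_eq_iff_im.2 (energy_im hm hmN he p))).symm

theorem eq_zero_of_hasMomentum {k : ℝ} {ψ : State N} (h : HasMomentum k ψ) {Y : Finset (ZMod N)}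
    (h0 : ψ (config Y) = 0) (t : ZMod N) : ψ (config (translate Y t)) = 0 := by
  rw [hasMomentum_iff] at h
  have key := forall_of_add_one (P := fun s : ZMod N => ψ (config (translate Y (-s))) = 0) (a := 0)
    (by simpa using h0) (fun s hs => by
      have := h (translate Y (-s))
      rw [hs, mul_zero, translate_translate] at this
      rwa [neg_add]) (-t)
  simpa using key

/-- The spectral gap: an eigenvector of momentum `k` in the sector that is orthogonal to `Ψ_k` has
an eigenvalue larger than `9 / 2`.  Otherwise a combination of it with `Ψ_k` would vanish on all
droplets, hence have energy at least `6 (1 - |ε|)`, although both eigenvalues are at most `9 / 2`. -/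
theorem lt_eigenvalue_of_orthogonal (hm : 0 < m) (hmN : m < N) {ε : ℝ} (hε : 100 * |ε| < 1)
    {e : Unknowns N m} (he : Fmap ε e = e) (hn : wnorm 100 ε e ≤ 1 / 4) (p : ℕ) {μ : ℝ}
    {φ : State N} (hφ : φ ≠ 0) (hsec : InSector m φ) (hmom : HasMomentum (momentum N p) φ)
    (heig : hamiltonian N ε φ = (μ : ℂ) • φ)
    (horth : star (droplet e (momentum N p)) ⬝ᵥ φ = 0) : 9 / 2 < μ := by
  have := nontrivial_zmod_of_lt hm hmN
  by_contra! hμ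
  set Ψ := droplet e (momentum N p) with hΨ
  have hE := abs_le.1 (abs_re_energy_sub_le hm hmN hε he hn (momentum N p))
  have hHΨ := hamiltonian_droplet hm hmN he p
  rw [energy_eq_re hm hmN he, ← hΨ] at hHΨ
  set E := (energy e (momentum N p)).re
  set c := φ (config (M N m)) with hc
  have horth' : star φ ⬝ᵥ Ψ = 0 := by
    rw [Matrix.star_dotProduct, horth, star_zero]
  set χ := φ - c • Ψ with hχ
  have hHχ : hamiltonian N ε χ = (μ : ℂ) • φ - (c * E) • Ψ := by
    rw [hχ, map_sub, map_smul, heig, hHΨ, smul_smul]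
  have hχχ : sqNorm χ = sqNorm φ + Complex.normSq c * sqNorm Ψ := by
    have h : star χ ⬝ᵥ χ = ((sqNorm φ + Complex.normSq c * sqNorm Ψ : ℝ) : ℂ) := by
      rw [hχ, star_sub, star_smul]
      simp only [sub_dotProduct, dotProduct_sub, smul_dotProduct, dotProduct_smul, horth, horth',
        dotProduct_self_eq]
      push_cast
      rw [Complex.normSq_eq_conj_mul_self]
      simp only [smul_eq_mul, Complex.star_def]
      ring
    rw [dotProduct_self_eq] at h
    exact_mod_cast h
  have hform : (star χ ⬝ᵥ hamiltonian N ε χ).re =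
      μ * sqNorm φ + E * (Complex.normSq c * sqNorm Ψ) := by
    have h : star χ ⬝ᵥ hamiltonian N ε χ =
        ((μ * sqNorm φ + E * (Complex.normSq c * sqNorm Ψ) : ℝ) : ℂ) := by
      rw [hHχ, hχ, star_sub, star_smul]
      simp only [sub_dotProduct, dotProduct_sub, smul_dotProduct, dotProduct_smul, horth, horth',
        dotProduct_self_eq]
      push_cast
      rw [Complex.normSq_eq_conj_mul_self]
      simp only [smul_eq_mul, Complex.star_def]
      ring
    rw [h, Complex.ofReal_re]
  have hφpos := sqNorm_pos hφ
  have hΨpos : 0 ≤ Complex.normSq c * sqNorm Ψ :=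
    mul_nonneg (Complex.normSq_nonneg _) (sqNorm_pos (droplet_ne_zero hm hmN e p)).le
  have hχM : ∀ t, χ (config (translate (M N m) t)) = 0 := by
    refine eq_zero_of_hasMomentum (k := momentum N p) ?_ ?_
    · rw [HasMomentum, hχ, map_sub, map_smul, hmom, hasMomentum_droplet hmN e p, smul_sub,
        smul_comm]
    · rw [hχ, Pi.sub_apply, Pi.smul_apply, hΨ, droplet_M hm hmN, smul_eq_mul, mul_one, sub_self]
  have hΨsec : InSector m Ψ := inSector_droplet hmN e _
  have hχsec : ∀ Y : Finset (ZMod N), Y.card ≠ m → χ (config Y) = 0 := by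
    intro Y hY
    rw [hχ, Pi.sub_apply, Pi.smul_apply, inSector_iff.1 hsec Y hY,
      inSector_iff.1 hΨsec Y hY, smul_zero, sub_zero]
  have hlow : 6 * (1 - |ε|) * sqNorm χ ≤ (star χ ⬝ᵥ hamiltonian N ε χ).re := by
    refine le_trans ?_ (le_re_dotProduct_hamiltonian ε χ)
    rw [sqNorm, Finset.mul_sum]
    refine Finset.sum_le_sum fun Y _ => ?_
    by_cases hY : χ (config Y) = 0
    · simp [hY]
    · have hcard : Y.card = m := by
        by_contra h
        exact hY (hχsec Y h)
      have hw : 3 ≤ (walls Y).card := by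
        by_contra h
        obtain ⟨t, rfl⟩ := exists_translate_of_card_walls_le hm hmN hcard (by omega)
        exact hY (hχM t)
      have hw' : (3 : ℝ) ≤ (walls Y).card := by exact_mod_cast hw
      have h1 : 0 ≤ 1 - |ε| := by linarith [abs_nonneg ε]
      calc 6 * (1 - |ε|) * Complex.normSq (χ (config Y))
          = 2 * (1 - |ε|) * (3 * Complex.normSq (χ (config Y))) := by ring
        _ ≤ _ := by
            have := Complex.normSq_nonneg (χ (config Y))
            gcongr
  rw [hform, hχχ] at hlow
  have h1 : μ * sqNorm φ ≤ 9 / 2 * sqNorm φ := by gcongr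
  have h2 : E * (Complex.normSq c * sqNorm Ψ) ≤ 9 / 2 * (Complex.normSq c * sqNorm Ψ) := by
    gcongr
    linarith [hE.2]
  have h3 : 5 * (sqNorm φ + Complex.normSq c * sqNorm Ψ) ≤
      6 * (1 - |ε|) * (sqNorm φ + Complex.normSq c * sqNorm Ψ) := by
    gcongr
    linarith
  linarith

/-- Eigenvectors of lower energy would be orthogonal to `Ψ_k` by symmetry of `H`, contrary to the
gap. -/
theorem energy_le_of_hasMomentum (hm : 0 < m) (hmN : m < N) {ε : ℝ} (hε : 100 * |ε| < 1)
    {e : Unknowns N m} (he : Fmap ε e = e) (hn : wnorm 100 ε e ≤ 1 / 4) (p : ℕ) {μ : ℝ}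
    {φ : State N} (hφ : φ ≠ 0) (hsec : InSector m φ) (hmom : HasMomentum (momentum N p) φ)
    (heig : hamiltonian N ε φ = (μ : ℂ) • φ) : (energy e (momentum N p)).re ≤ μ := by
  have := nontrivial_zmod_of_lt hm hmN
  by_contra! hlt
  have hHΨ := hamiltonian_droplet hm hmN he p
  rw [energy_eq_re hm hmN he] at hHΨ
  have horth : star (droplet e (momentum N p)) ⬝ᵥ φ = 0 := by
    have h := dotProduct_hamiltonian ε (droplet e (momentum N p)) φ
    rw [heig, hHΨ, star_smul, dotProduct_smul, smul_dotProduct, smul_eq_mul, smul_eq_mul] at h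
    rw [Complex.star_def, Complex.conj_ofReal] at h
    by_contra h0
    have := mul_right_cancel₀ h0 h
    exact hlt.ne (by exact_mod_cast this)
  have h1 := lt_eigenvalue_of_orthogonal hm hmN hε he hn p hφ hsec hmom heig horth
  have h2 := (abs_le.1 (abs_re_energy_sub_le hm hmN hε he hn (momentum N p))).2
  linarith

/-- The component of momentum `2 π p / N` of a state, times `N`. -/
noncomputable def momentumPart (p : ℕ) (φ : State N) : State N := fun σ =>
  ∑ s : ZMod N, phase (momentum N p) s * φ fun j => σ (j + s)

theorem momentumPart_config (p : ℕ) (φ : State N) (Y : Finset (ZMod N)) :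
    momentumPart p φ (config Y) =
      ∑ s, phase (momentum N p) s * φ (config (translate Y (-s))) := by
  refine Finset.sum_congr rfl fun s _ => ?_
  congr 2
  funext j
  simp [config, mem_translate]

theorem hasMomentum_momentumPart (p : ℕ) (φ : State N) :
    HasMomentum (momentum N p) (momentumPart p φ) := by
  rw [hasMomentum_iff]
  intro Y
  rw [momentumPart_config, momentumPart_config, ← phase_neg_one, Finset.mul_sum,
    ← Equiv.sum_comp (Equiv.addRight (-1 : ZMod N))]
  refine Finset.sum_congr rfl fun s _ => ?_
  rw [Equiv.coe_addRight, phase_add, translate_translate]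
  simp only [neg_add_rev, neg_neg, neg_add_cancel_left]
  ring

theorem hamiltonian_momentumPart [Nontrivial (ZMod N)] (p : ℕ) {ε : ℝ} {φ : State N} {μ : ℂ}
    (h : hamiltonian N ε φ = μ • φ) :
    hamiltonian N ε (momentumPart p φ) = μ • momentumPart p φ := by
  refine state_ext fun Y => ?_
  rw [hamiltonian_config, Pi.smul_apply, smul_eq_mul]
  simp only [momentumPart_config]
  rw [Finset.sum_comm]
  simp only [Finset.mul_sum, ← Finset.sum_sub_distrib]
  refine Finset.sum_congr rfl fun s _ => ?_
  have hs := congrFun h (config (translate Y (-s)))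
  rw [hamiltonian_config, Pi.smul_apply, smul_eq_mul, card_walls_translate, walls_translate,
    sum_translate] at hs
  simp only [hop_translate] at hs
  rw [mul_left_comm μ, ← hs, mul_sub, Finset.mul_sum, Finset.mul_sum]
  congr 1
  · ring
  · exact Finset.sum_congr rfl fun j _ => by ring

theorem inSector_momentumPart (p : ℕ) {φ : State N} (h : InSector m φ) :
    InSector m (momentumPart p φ) := by
  rw [inSector_iff] at h ⊢
  intro Y hY
  rw [momentumPart_config]
  exact Finset.sum_eq_zero fun s _ => by rw [h _ (by rwa [card_translate]), mul_zero]

/-- The momentum component inherits the orthogonality to the droplet state of that momentum. -/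
theorem dotProduct_momentumPart (hmN : m < N) (e : Unknowns N m) (p : ℕ) (φ : State N) :
    star (droplet e (momentum N p)) ⬝ᵥ momentumPart p φ =
      N * (star (droplet e (momentum N p)) ⬝ᵥ φ) := by
  have hs : ∀ s : ZMod N, ∑ Y : Finset (ZMod N), star (droplet e (momentum N p) (config Y)) *
      (phase (momentum N p) s * φ (config (translate Y (-s)))) =
      ∑ Y : Finset (ZMod N), star (droplet e (momentum N p) (config Y)) * φ (config Y) := by
    intro s
    let E : Finset (ZMod N) ≃ Finset (ZMod N) :=
      ⟨fun Y => translate Y s, fun Y => translate Y (-s), fun Y => by simp [translate_translate],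
        fun Y => by simp [translate_translate]⟩
    rw [← Equiv.sum_comp E]
    refine Finset.sum_congr rfl fun Y _ => ?_
    change star (droplet e (momentum N p) (config (translate Y s))) *
      (phase (momentum N p) s * φ (config (translate (translate Y s) (-s)))) = _
    rw [translate_translate, add_neg_cancel, translate_zero, droplet_translate hmN, star_mul']
    have : star (phase (momentum N p) s) * phase (momentum N p) s = 1 := by
      rw [Complex.star_def, ← Complex.normSq_eq_conj_mul_self, Complex.normSq_eq_norm_sq,
        norm_phase]
      simp
    linear_combination star (droplet e (momentum N p) (config Y)) * φ (config Y) * this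
  rw [dotProduct_eq_sum, dotProduct_eq_sum]
  simp only [momentumPart_config, Finset.mul_sum]
  rw [Finset.sum_comm, Finset.sum_congr rfl fun s _ => hs s, Finset.sum_const, Finset.card_univ,
    ZMod.card, nsmul_eq_mul, Finset.mul_sum]

/-- Orthogonality of the characters of `ZMod N`. -/
theorem sum_phase (s : ZMod N) :
    ∑ p ∈ Finset.range N, phase (momentum N p) s = if s = 0 then (N : ℂ) else 0 := by
  split_ifs with hs
  · simp [hs, phase_zero]
  · have hN : (N : ℂ) ≠ 0 := by exact_mod_cast NeZero.ne N
    set ζ : ℂ := Complex.exp (2 * Real.pi * Complex.I * (s.valMinAbs / N)) with hζ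
    have hpow : ∀ p : ℕ, phase (momentum N p) s = ζ ^ p := by
      intro p
      rw [phase, hζ, ← Complex.exp_nat_mul, momentum]
      congr 1
      push_cast
      ring
    have hζN : ζ ^ N = 1 := by
      rw [hζ, ← Complex.exp_nat_mul, Complex.exp_eq_one_iff]
      exact ⟨s.valMinAbs, by field_simp⟩
    have hζ1 : ζ - 1 ≠ 0 := by
      rw [sub_ne_zero]
      intro h
      rw [hζ, Complex.exp_eq_one_iff] at h
      obtain ⟨n, hn⟩ := h
      have hpi : (2 * Real.pi * Complex.I : ℂ) ≠ 0 := Complex.two_pi_I_ne_zero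
      rw [mul_comm (n : ℂ)] at hn
      have h1 := mul_left_cancel₀ hpi hn
      rw [div_eq_iff hN] at h1
      have h2 : s.valMinAbs = n * N := by exact_mod_cast h1
      apply hs
      rw [← ZMod.coe_valMinAbs s, h2]
      simp
    simp only [hpow]
    have := mul_geom_sum ζ N
    rw [hζN, sub_self] at this
    exact (mul_eq_zero.1 this).resolve_left hζ1

theorem exists_momentumPart_ne_zero {φ : State N} (h : φ ≠ 0) :
    ∃ p < N, momentumPart p φ ≠ 0 := by
  by_contra! h0
  refine h (state_ext fun Y => ?_)
  have h1 : ∑ p ∈ Finset.range N, momentumPart p φ (config Y) = N * φ (config Y) := by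
    simp only [momentumPart_config]
    rw [Finset.sum_comm]
    simp only [← Finset.sum_mul, sum_phase]
    simp
  rw [Finset.sum_eq_zero fun p hp => by rw [h0 p (Finset.mem_range.1 hp)]; rfl] at h1
  have hN : (N : ℂ) ≠ 0 := by exact_mod_cast NeZero.ne N
  exact (mul_eq_zero.1 h1.symm).resolve_left hN

theorem energy_lt_of_orthogonal (hm : 0 < m) (hmN : m < N) {ε : ℝ} (hε : 100 * |ε| < 1)
    {e : Unknowns N m} (he : Fmap ε e = e) (hn : wnorm 100 ε e ≤ 1 / 4) {μ : ℝ}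
    {φ : State N} (hφ : φ ≠ 0) (hsec : InSector m φ)
    (horth : ∀ p < N, star (droplet e (momentum N p)) ⬝ᵥ φ = 0)
    (heig : hamiltonian N ε φ = (μ : ℂ) • φ) (k : ℝ) : (energy e k).re < μ := by
  have := nontrivial_zmod_of_lt hm hmN
  obtain ⟨q, hq, hne⟩ := exists_momentumPart_ne_zero hφ
  have h1 := lt_eigenvalue_of_orthogonal hm hmN hε he hn q hne (inSector_momentumPart q hsec)
    (hasMomentum_momentumPart q φ) (hamiltonian_momentumPart q heig)
    (by rw [dotProduct_momentumPart hmN, horth q hq, mul_zero])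
  have h2 := (abs_le.1 (abs_re_energy_sub_le hm hmN hε he hn k)).2
  linarith

/-! ### The fully polarized states -/

theorem hamiltonian_ket_of_walls_eq [Nontrivial (ZMod N)] (ε : ℝ) {Y : Finset (ZMod N)}
    (h : walls Y = ∅) : hamiltonian N ε (ket Y) = 0 := by
  refine state_ext fun Z => ?_
  rw [hamiltonian_config, Pi.zero_apply, Finset.sum_eq_zero fun j hj => ?_]
  · rw [ket_config]
    split_ifs with hZ
    · simp [hZ, h]
    · simp
  · rw [ket_config, if_neg]
    intro hZ
    have := mem_walls_hop.2 hj
    rw [hZ, h] at this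
    simp at this

theorem hasMomentum_ket {Y : Finset (ZMod N)} (h : translate Y 1 = Y) : HasMomentum 0 (ket Y) := by
  rw [hasMomentum_iff]
  intro Z
  rw [ket_config, ket_config]
  have : translate Z (-1) = Y ↔ Z = Y := by
    constructor
    · intro h'
      rw [← h, ← h', translate_translate, neg_add_cancel, translate_zero]
    · rintro rfl
      conv_lhs => rw [← h]
      rw [translate_translate, add_neg_cancel, translate_zero]
  simp [this]

omit [NeZero N] in
theorem walls_empty : walls (∅ : Finset (ZMod N)) = ∅ := by
  ext j
  simp [mem_walls]

theorem walls_univ : walls (Finset.univ : Finset (ZMod N)) = ∅ := by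
  ext j
  simp [mem_walls]

theorem eq_zero_or_energy_le (hm : 0 < m) (hmN : m < N) {ε : ℝ} (hε : 100 * |ε| < 1)
    {e : Unknowns N m} (he : Fmap ε e = e) (hn : wnorm 100 ε e ≤ 1 / 4) {μ : ℝ}
    {φ : State N} (hφ : φ ≠ 0)
    (hsec : ∀ σ : Config N, φ σ ≠ 0 → numDown σ = 0 ∨ numDown σ = m ∨ numDown σ = N)
    (hmom : HasMomentum 0 φ) (heig : hamiltonian N ε φ = (μ : ℂ) • φ) :
    μ = 0 ∨ (energy e 0).re ≤ μ := by
  have := nontrivial_zmod_of_lt hm hmN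
  -- The component of `φ` in the sector with `m` down spins.
  set ψ : State N := fun σ => if numDown σ = m then φ σ else 0 with hψ
  have hψY : ∀ Y, ψ (config Y) = if Y.card = m then φ (config Y) else 0 := fun Y => by
    rw [hψ]
    simp only [numDown_config]
  have h0 : momentum N 0 = 0 := by simp [momentum]
  rw [hasMomentum_iff] at hmom
  by_cases h : ψ = 0
  · left
    obtain ⟨Y, hY⟩ : ∃ Y, φ (config Y) ≠ 0 := by
      by_contra! h0
      exact hφ (state_ext fun Y => h0 Y)
    have hwalls : walls Y = ∅ := by
      have h1 := hsec _ hY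
      rw [numDown_config] at h1
      rcases h1 with h1 | h1 | h1
      · rw [Finset.card_eq_zero.1 h1, walls_empty]
      · have h2 := congrFun h (config Y)
        rw [hψY, if_pos h1] at h2
        exact absurd h2 hY
      · rw [(Finset.card_eq_iff_eq_univ Y).1 (by rw [h1, ZMod.card]), walls_univ]
    have h1 := congrFun heig (config Y)
    rw [hamiltonian_config, hwalls, Pi.smul_apply, smul_eq_mul] at h1
    simp only [Finset.card_empty, Nat.cast_zero, mul_zero, zero_mul, Finset.sum_empty,
      sub_zero] at h1
    exact_mod_cast (mul_eq_zero.1 h1.symm).resolve_right hY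
  · right
    rw [← h0]
    refine energy_le_of_hasMomentum hm hmN hε he hn 0 h ?_ ?_ (μ := μ) ?_
    · rw [inSector_iff]
      intro Y hY
      rw [hψY, if_neg hY]
    · rw [hasMomentum_iff, h0]
      intro Y
      rw [hψY, hψY, card_translate, hmom Y]
      split_ifs <;> simp
    · refine state_ext fun Y => ?_
      have h1 := congrFun heig (config Y)
      rw [hamiltonian_config, Pi.smul_apply, smul_eq_mul] at h1
      rw [hamiltonian_config, Pi.smul_apply, smul_eq_mul, hψY]
      have h2 : ∑ j ∈ walls Y, ψ (config (hop Y j)) =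
          if Y.card = m then ∑ j ∈ walls Y, φ (config (hop Y j)) else 0 := by
        split_ifs with hY
        · exact Finset.sum_congr rfl fun j hj => by rw [hψY, card_hop hj, if_pos hY]
        · exact Finset.sum_eq_zero fun j hj => by rw [hψY, card_hop hj, if_neg hY]
      rw [h2]
      split_ifs
      · exact h1
      · simp

end Gap

open scoped Topology
open Filter

/-! ### The limit of long chains -/

section LongChains

/-- A long ring looks like `ℤ` near a finite set. -/
theorem eventually_injOn_intCast (A : Finset ℤ) :
    ∀ᶠ n : ℕ in atTop, Set.InjOn (Int.cast : ℤ → ZMod (n + 1)) A := by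
  obtain ⟨B, hB⟩ : ∃ B : ℕ, ∀ x ∈ A, x.natAbs ≤ B :=
    ⟨A.sup Int.natAbs, fun x hx => Finset.le_sup (f := Int.natAbs) hx⟩
  filter_upwards [eventually_ge_atTop (2 * B)] with n hn x hx y hy h
  have h1 : ((n + 1 : ℕ) : ℤ) ∣ y - x := (ZMod.intCast_eq_intCast_iff_dvd_sub x y (n + 1)).1 h
  have h2 := hB x hx
  have h3 := hB y hy
  have h4 : y - x = 0 := Int.eq_zero_of_abs_lt_dvd h1 (by rw [abs_lt]; push_cast; omega)
  omega

theorem eventually_valMinAbs_eq (s : ℤ) :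
    ∀ᶠ n : ℕ in atTop, ((s : ZMod (n + 1))).valMinAbs = s := by
  filter_upwards [eventually_ge_atTop (2 * s.natAbs)] with n hn
  rw [ZMod.valMinAbs_spec]
  refine ⟨rfl, ?_, ?_⟩ <;> push_cast <;> omega

theorem sum_zmod_eq_tsum_int {E : Type*} [AddCommGroup E] [TopologicalSpace E] {N : ℕ} [NeZero N]
    (f : ZMod N → E) :
    ∑ t, f t = ∑' s : ℤ, if (s : ZMod N).valMinAbs = s then f s else 0 := by
  rw [← tsum_fintype (L := .unconditional _),
    ← (ZMod.injective_valMinAbs (n := N)).tsum_eq]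
  · refine tsum_congr fun t => ?_
    rw [ZMod.coe_valMinAbs, if_pos rfl]
  · intro s hs
    by_contra h
    refine hs (if_neg fun h' => h ⟨_, h'⟩)

theorem image_translate {N : ℕ} (Y : Finset ℤ) (s : ℤ) :
    (translate Y s).image (Int.cast : ℤ → ZMod N) = translate (Y.image Int.cast) (s : ZMod N) := by
  simp only [translate, Finset.image_image]
  congr 1
  funext x
  simp

theorem image_interval {N : ℕ} (m : ℕ) :
    (interval ℤ m).image (Int.cast : ℤ → ZMod N) = interval (ZMod N) m := by
  simp only [interval, Finset.image_image]
  congr 1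
  funext x
  simp

theorem injOn_natCast_int (m : ℕ) : Set.InjOn (Nat.cast : ℕ → ℤ) (Set.Iic m) :=
  Nat.cast_injective.injOn

theorem weightData_int {m : ℕ} (hm : 0 < m) : WeightData (interval ℤ m) (fun _ => 1) 1 :=
  weightData_one (card_walls_interval_le m)
    fun _ h => eq_zero_of_translate_interval (injOn_natCast_int m) hm h

variable {m : ℕ}

/-- The amplitudes on the ring with `n + 1` sites, as a function of configurations on `ℤ`. -/
noncomputable def liftAmp (e : ∀ (N : ℕ) [NeZero N], Unknowns N m) (n : ℕ) (Y : Finset ℤ) : ℝ :=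
  (e (n + 1)).amp (Y.image Int.cast)

/-- The Fourier coefficients on the ring with `n + 1` sites, extended by zero from the
representatives `-(n + 1) / 2 < s ≤ (n + 1) / 2` to `ℤ`. -/
noncomputable def liftFour (e : ∀ (N : ℕ) [NeZero N], Unknowns N m) (n : ℕ) (s : ℤ) : ℝ :=
  if (s : ZMod (n + 1)).valMinAbs = s then (e (n + 1)).four s else 0

/-- `e N` is a small solution of the fixed point equation on the ring with `N` sites, for every
`N > m`. -/
structure IsSolutionFamily (ε : ℝ) (e : ∀ (N : ℕ) [NeZero N], Unknowns N m) : Prop where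
  pos : 0 < m
  lt_one : 100 * |ε| < 1
  fix : ∀ (N : ℕ) [NeZero N], m < N → Fmap ε (e N) = e N
  norm_le : ∀ (N : ℕ) [NeZero N], m < N → wnorm 100 ε (e N) ≤ 1 / 4

variable {ε : ℝ} {e : ∀ (N : ℕ) [NeZero N], Unknowns N m}

theorem eventually_isExcited_image (Y : Finset ℤ) : ∀ᶠ n : ℕ in atTop,
    (IsExcited (M (n + 1) m) (Y.image Int.cast) ↔ IsExcited (interval ℤ m) Y) := by
  filter_upwards [eventually_injOn_intCast (neighborhood Y), eventually_ge_atTop m] with n hn hmn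
  rw [IsExcited, IsExcited, card_image_of_injOn_neighborhood hn,
    card_walls_image (fun x => by push_cast; rfl) hn, card_M (by omega),
    card_interval (injOn_natCast_int m)]

theorem eventually_liftAmp_of_not_isExcited {Y : Finset ℤ}
    (hY : ¬ IsExcited (interval ℤ m) Y) :
    ∀ᶠ n : ℕ in atTop, liftAmp e n Y = if Y = interval ℤ m then 1 else 0 := by
  filter_upwards [eventually_isExcited_image (m := m) Y,
    eventually_injOn_intCast (Y ∪ interval ℤ m), eventually_ge_atTop m] with n hn hinj hmn
  rw [liftAmp, amp_of_not_isExcited (by omega) _ (by rwa [hn])]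
  congr 1
  rw [eq_iff_iff, M_eq_interval, ← image_interval]
  constructor
  · intro h
    have h' := congrArg (fun Z : Finset (ZMod (n + 1)) => (Z : Set (ZMod (n + 1)))) h
    simp only [Finset.coe_image] at h'
    exact_mod_cast (hinj.image_eq_image_iff (by simp) (by simp)).1 h'
  · rintro rfl
    rfl

theorem liftAmp_hop {n : ℕ} {Y : Finset ℤ}
    (hinj : Set.InjOn (Int.cast : ℤ → ZMod (n + 1)) (neighborhood Y)) :
    ∑ j ∈ walls (Y.image (Int.cast : ℤ → ZMod (n + 1))),
      (e (n + 1)).amp (hop (Y.image Int.cast) j) = ∑ j ∈ walls Y, liftAmp e n (hop Y j) := by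
  rw [sum_walls_image (fun x => by push_cast; rfl) hinj]
  refine Finset.sum_congr rfl fun j hj => ?_
  rw [hop_image (fun x => by push_cast; rfl) hinj hj, liftAmp]

theorem IsSolutionFamily.eventually_liftFour (h : IsSolutionFamily ε e) (s : ℤ) :
    ∀ᶠ n : ℕ in atTop, liftFour e n s = fixFour ε (interval ℤ m) (liftAmp e n) s := by
  filter_upwards [eventually_injOn_intCast (neighborhood (translate (interval ℤ m) (-s))),
    eventually_valMinAbs_eq s, eventually_ge_atTop m] with n hinj hs hmn
  have h1 := congrFun ((Fmap_eq_iff (by omega) ε _).1 (h.fix (n + 1) (by omega))).2 (s : ZMod (n + 1))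
  rw [liftFour, if_pos hs, ← h1, fixFour, fixFour, ← liftAmp_hop hinj, image_translate,
    image_interval, ← M_eq_interval, Int.cast_neg]

theorem IsSolutionFamily.eventually_liftAmp (h : IsSolutionFamily ε e) {Y : Finset ℤ}
    (hY : IsExcited (interval ℤ m) Y) : ∀ᶠ n : ℕ in atTop,
    liftAmp e n Y = fixAmp ε (interval ℤ m) (liftAmp e n) (liftFour e n) Y := by
  filter_upwards [eventually_injOn_intCast (neighborhood Y),
    eventually_isExcited_image (m := m) Y, eventually_ge_atTop m] with n hinj hexc hmn
  have h1 := congrFun ((Fmap_eq_iff (by omega) ε _).1 (h.fix (n + 1) (by omega))).1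
    (Y.image Int.cast)
  rw [liftAmp, ← h1, fixAmp, fixAmp, if_pos (hexc.2 hY), if_pos hY, ← liftAmp_hop hinj,
    card_walls_image (fun x => by push_cast; rfl) hinj, tsum_fintype, sum_zmod_eq_tsum_int]
  congr 2
  refine tsum_congr fun s => ?_
  rw [liftFour, ite_mul, zero_mul, liftAmp, image_translate]

theorem IsSolutionFamily.abs_liftAmp_le (h : IsSolutionFamily ε e) {n : ℕ} (hn : m ≤ n)
    (Y : Finset ℤ) : |liftAmp e n Y| ≤ 1 := by
  have hlt : m < n + 1 := by omega
  by_cases hY : IsExcited (M (n + 1) m) (Y.image Int.cast)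
  · have hW := weightData_one (D := M (n + 1) m) (card_walls_interval_le m)
      (fun _ h' => eq_zero_of_translate_interval (injOn_natCast_zmod hlt) h.pos h')
    have h1 := solNorm_one_le h.pos hlt h.lt_one (h.fix (n + 1) hlt) (h.norm_le (n + 1) hlt)
    have h2 := hW.enorm_le_ampNorm (e (n + 1)).amp hY
    have h3 : ‖(e (n + 1)).amp (Y.image Int.cast)‖ₑ ≤ 1 := by
      refine (h2.trans ?_).trans h1
      rw [solNorm, mul_add, ← mul_assoc]
      refine le_add_left ?_
      conv_lhs => rw [← one_mul (ampNorm _ _ _)]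
      gcongr
      norm_num
    rwa [Real.enorm_eq_ofReal_abs, ENNReal.ofReal_le_one] at h3
  · rw [liftAmp, amp_of_not_isExcited hlt _ hY]
    split_ifs <;> simp

theorem IsSolutionFamily.abs_liftFour_le (h : IsSolutionFamily ε e) {n : ℕ} (hn : m ≤ n)
    (s : ℤ) : |liftFour e n s| ≤ 1 / 4 * (100 * |ε|) ^ (s.natAbs - 2 * m) := by
  have hlt : m < n + 1 := by omega
  have := nontrivial_zmod_of_lt h.pos hlt
  rw [liftFour]
  split_ifs with hs
  · refine (abs_four_le hlt (h.fix (n + 1) hlt) (h.norm_le (n + 1) hlt) _).trans ?_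
    have h1 := valMinAbs_sub_le_dist h.pos hlt (s : ZMod (n + 1))
    rw [hs] at h1
    gcongr ?_ * ?_
    exact pow_le_pow_of_le_one (by positivity) h.lt_one.le h1
  · rw [abs_zero]
    positivity

theorem IsSolutionFamily.eventually_abs_liftFour_le (h : IsSolutionFamily ε e) {s : ℤ}
    (hs : s ≠ 0) : ∀ᶠ n : ℕ in atTop, |liftFour e n s| ≤ 1 / 4 * (100 * |ε|) ^ m := by
  filter_upwards [eventually_ge_atTop (4 * s.natAbs + 2 * m)] with n hn
  have hlt : m < n + 1 := by have := h.pos; omega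
  have := nontrivial_zmod_of_lt h.pos hlt
  rw [liftFour]
  split_ifs
  · refine (abs_four_le hlt (h.fix (n + 1) hlt) (h.norm_le (n + 1) hlt) _).trans ?_
    gcongr ?_ * ?_
    exact pow_le_pow_of_le_one (by positivity) h.lt_one.le (le_dist_translate hlt hs (by omega))
  · rw [abs_zero]
    positivity

theorem summable_pow_natAbs_sub {r : ℝ} (h0 : 0 ≤ r) (h1 : r < 1) (k : ℕ) :
    Summable fun s : ℤ => r ^ (s.natAbs - k) := by
  have hnat : Summable fun n : ℕ => r ^ (n - k) := by
    rw [← summable_nat_add_iff k]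
    simpa using summable_geometric_of_lt_one h0 h1
  refine Summable.of_nat_of_neg (by simpa using hnat) (by simpa using hnat)

/-- The bound on the norm, for finitely many of the terms; these are not affected by the finite size
of a long ring. -/
theorem IsSolutionFamily.eventually_sum_le (h : IsSolutionFamily ε e) (A : Finset ℤ)
    (B : Finset (Finset ℤ)) : ∀ᶠ n : ℕ in atTop,
    ∑ s ∈ A, ‖liftFour e n s‖ₑ + ∑ Y ∈ B, 2 * (if IsExcited (interval ℤ m) Y then
      ‖liftAmp e n Y‖ₑ * (((walls Y).card - 2 : ℕ) : ℝ≥0∞) else 0) ≤ 4⁻¹ := by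
  have hB : ∀ᶠ n : ℕ in atTop, ∀ Y ∈ B,
      Set.InjOn (Int.cast : ℤ → ZMod (n + 1)) (neighborhood Y) ∧
      (IsExcited (M (n + 1) m) (Y.image Int.cast) ↔ IsExcited (interval ℤ m) Y) :=
    (B.eventually_all).2 fun Y _ =>
      (eventually_injOn_intCast (neighborhood Y)).and (eventually_isExcited_image Y)
  filter_upwards [eventually_injOn_intCast A, eventually_injOn_intCast (B.biUnion id), hB,
    (A.eventually_all).2 fun s _ => eventually_valMinAbs_eq s,
    eventually_ge_atTop m] with n hA hBinj hB hA' hmn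
  have hlt : m < n + 1 := by omega
  have h1 := solNorm_one_le h.pos hlt h.lt_one (h.fix (n + 1) hlt) (h.norm_le (n + 1) hlt)
  rw [mul_comm, ← ENNReal.le_inv_iff_mul_le] at h1
  refine le_trans (add_le_add ?_ ?_) h1
  · rw [fourNorm]
    calc _ = ∑ s ∈ A, ‖(e (n + 1)).four s‖ₑ * 1 :=
          Finset.sum_congr rfl fun s hs => by rw [liftFour, if_pos (hA' s hs), mul_one]
      _ = ∑ t ∈ A.image (Int.cast : ℤ → ZMod (n + 1)), ‖(e (n + 1)).four t‖ₑ * 1 :=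
          (Finset.sum_image (f := fun t : ZMod (n + 1) => ‖(e (n + 1)).four t‖ₑ * 1) hA).symm
      _ ≤ _ := ENNReal.sum_le_tsum _
  · rw [← Finset.mul_sum]
    refine mul_le_mul_right ?_ 2
    rw [ampNorm]
    have himg : Set.InjOn (fun Y : Finset ℤ => Y.image (Int.cast : ℤ → ZMod (n + 1))) B := by
      intro Y hY Z hZ hYZ
      have h' := congrArg (fun Z : Finset (ZMod (n + 1)) => (Z : Set (ZMod (n + 1)))) hYZ
      simp only [Finset.coe_image] at h'
      exact_mod_cast (hBinj.image_eq_image_iff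
        (Finset.coe_subset.2 (Finset.subset_biUnion_of_mem id hY))
        (Finset.coe_subset.2 (Finset.subset_biUnion_of_mem id hZ))).1 h'
    set F : Finset (ZMod (n + 1)) → ℝ≥0∞ := fun Y => if IsExcited (M (n + 1) m) Y then
      ‖(e (n + 1)).amp Y‖ₑ * ((((walls Y).card - 2 : ℕ) : ℝ≥0∞) * 1) else 0 with hF
    calc _ = ∑ Y ∈ B, F (Y.image Int.cast) := by
          refine Finset.sum_congr rfl fun Y hY => ?_
          rw [hF]
          simp only [(hB Y hY).2, mul_one]
          rw [card_walls_image (fun x => by push_cast; rfl) (hB Y hY).1]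
          rfl
      _ = ∑ Z ∈ B.image fun Y : Finset ℤ => Y.image (Int.cast : ℤ → ZMod (n + 1)), F Z :=
          (Finset.sum_image himg).symm
      _ ≤ _ := ENNReal.sum_le_tsum _

/-- Along an ultrafilter the solutions on long rings converge to a small solution of the fixed
point equation on `ℤ`. -/
theorem IsSolutionFamily.exists_ultrafilter_limit (h : IsSolutionFamily ε e) (U : Ultrafilter ℕ)
    (hU : (U : Filter ℕ) ≤ atTop) : ∃ (u : Finset ℤ → ℝ) (a : ℤ → ℝ),
      (∀ s, Tendsto (fun n => liftFour e n s) U (𝓝 (a s))) ∧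
      fixAmp ε (interval ℤ m) u a = u ∧ fixFour ε (interval ℤ m) u = a ∧
      4 * solNorm (interval ℤ m) (fun _ => 1) u a ≤ 1 := by
  have hm : ∀ᶠ n in (U : Filter ℕ), m ≤ n := hU (eventually_ge_atTop m)
  have hlim : ∀ f : ℕ → ℝ, (∀ n, m ≤ n → |f n| ≤ 1) → ∃ x, Tendsto f U (𝓝 x) := by
    intro f hf
    have hle : ((U.map f : Ultrafilter ℝ) : Filter ℝ) ≤ 𝓟 (Set.Icc (-1) 1) := by
      rw [le_principal_iff, Ultrafilter.coe_map, mem_map]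
      filter_upwards [hm] with n hn
      exact abs_le.1 (hf n hn)
    obtain ⟨x, -, hx⟩ := isCompact_Icc.ultrafilter_le_nhds _ hle
    exact ⟨x, hx⟩
  have hr0 : 0 ≤ 100 * |ε| := by positivity
  choose u hu using fun Y => hlim (fun n => liftAmp e n Y) fun n hn => h.abs_liftAmp_le hn Y
  choose a ha using fun s => hlim (fun n => liftFour e n s) fun n hn =>
    (h.abs_liftFour_le hn s).trans (by
      have := pow_le_one₀ hr0 h.lt_one.le (n := s.natAbs - 2 * m)
      linarith)
  refine ⟨u, a, ha, funext fun Y => ?_, funext fun s => ?_, ?_⟩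
  · by_cases hY : IsExcited (interval ℤ m) Y
    · refine tendsto_nhds_unique (Tendsto.congr'
        (((h.eventually_liftAmp hY).filter_mono hU).mono fun n hn => hn.symm) ?_) (hu Y)
      simp only [fixAmp, if_pos hY]
      refine Tendsto.add (Tendsto.const_mul _ (tendsto_finsetSum _ fun j _ => hu _))
        (Tendsto.const_mul _ ?_)
      refine tendsto_tsum_of_dominated_convergence
        (bound := fun s => 1 / 4 * (100 * |ε|) ^ (s.natAbs - 2 * m))
        ((summable_pow_natAbs_sub hr0 h.lt_one _).mul_left _)
        (fun s => (ha s).mul (hu _)) ?_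
      filter_upwards [hm] with n hn s
      rw [norm_mul, Real.norm_eq_abs, Real.norm_eq_abs]
      calc _ ≤ (1 / 4 * (100 * |ε|) ^ (s.natAbs - 2 * m)) * 1 :=
            mul_le_mul (h.abs_liftFour_le hn s) (h.abs_liftAmp_le hn _) (abs_nonneg _)
              (by positivity)
        _ = _ := mul_one _
    · rw [fixAmp, if_neg hY]
      refine tendsto_nhds_unique (Tendsto.congr' ?_ tendsto_const_nhds) (hu Y)
      exact ((eventually_liftAmp_of_not_isExcited hY).filter_mono hU).mono
        fun n hn => hn.symm
  · refine tendsto_nhds_unique (Tendsto.congr'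
      (((h.eventually_liftFour s).filter_mono hU).mono fun n hn => hn.symm) ?_) (ha s)
    simp only [fixFour]
    exact (Tendsto.const_mul _ (tendsto_finsetSum _ fun j _ => hu _)).neg
  · rw [mul_comm, ← ENNReal.le_inv_iff_mul_le, solNorm, fourNorm, ampNorm,
      ← ENNReal.tsum_mul_left, ENNReal.tsum_eq_iSup_sum, ENNReal.tsum_eq_iSup_sum]
    refine ENNReal.iSup_add_iSup_le fun A B => ?_
    simp only [mul_one]
    refine le_of_tendsto ?_ (hU (h.eventually_sum_le A B))
    have hen : ∀ {f : ℕ → ℝ} {x : ℝ}, Tendsto f U (𝓝 x) → Tendsto (fun n => ‖f n‖ₑ) U (𝓝 ‖x‖ₑ) :=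
      fun hf => (continuous_enorm.tendsto _).comp hf
    refine Tendsto.add (tendsto_finsetSum _ fun s _ => hen (ha s))
      (tendsto_finsetSum _ fun Y _ => ENNReal.Tendsto.const_mul ?_ (Or.inr (by simp)))
    split_ifs
    · exact ENNReal.Tendsto.mul_const (hen (hu Y)) (Or.inr (by simp))
    · exact tendsto_const_nhds

/-- The Fourier coefficients converge as the ring grows: all limits along ultrafilters solve the
fixed point equation on `ℤ`, whose small solution is unique. -/
theorem IsSolutionFamily.exists_limit (h : IsSolutionFamily ε e) : ∃ d : ℤ → ℝ,
    ∀ s, Tendsto (fun n => liftFour e n s) atTop (𝓝 (d s)) := by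
  obtain ⟨u, d, -, hu, hd, hn⟩ := h.exists_ultrafilter_limit (Ultrafilter.of atTop)
    (Ultrafilter.of_le _)
  refine ⟨d, fun s => ?_⟩
  rw [tendsto_iff_ultrafilter]
  intro U hU
  obtain ⟨u', d', hd's, hu', hd', hn'⟩ := h.exists_ultrafilter_limit U hU
  have hε : 100 * (‖ε‖ₑ * 1) ≤ 1 := by
    rw [mul_one, Real.enorm_eq_ofReal_abs, show (100 : ℝ≥0∞) = ENNReal.ofReal 100 by simp,
      ← ENNReal.ofReal_mul (by norm_num), ENNReal.ofReal_le_one]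
    exact h.lt_one.le
  rw [(fix_unique (weightData_int h.pos) hε hn hn' hu hd hu' hd').2]
  exact hd's s

theorem energy_eq_tsum (n : ℕ) (k : ℝ) : energy (e (n + 1)) k =
    4 + ∑' s : ℤ, (liftFour e n s : ℂ) * Complex.exp (Complex.I * k * s) := by
  rw [energy, sum_zmod_eq_tsum_int]
  congr 1
  refine tsum_congr fun s => ?_
  rw [liftFour]
  split_ifs with hs
  · rw [hs]
  · simp

theorem IsSolutionFamily.tendsto_energy (h : IsSolutionFamily ε e) : ∃ d : ℤ → ℝ,
    Summable (fun s => |d s|) ∧ (∀ s : ℤ, s ≠ 0 → |d s| ≤ 1 / 4 * 100 ^ m * |ε| ^ m) ∧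
      ∀ k : ℝ, Tendsto (fun n : ℕ => energy (e (n + 1)) k) atTop
        (𝓝 (4 + ∑' s : ℤ, (d s : ℂ) * Complex.exp (Complex.I * k * s))) := by
  obtain ⟨d, hd⟩ := h.exists_limit
  have hr0 : 0 ≤ 100 * |ε| := by positivity
  have hbound := (summable_pow_natAbs_sub hr0 h.lt_one (2 * m)).mul_left (1 / 4)
  refine ⟨d, ?_, ?_, ?_⟩
  · refine Summable.of_nonneg_of_le (fun _ => abs_nonneg _) (fun s => ?_) hbound
    refine le_of_tendsto (hd s).abs ?_
    filter_upwards [eventually_ge_atTop m] with n hn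
    exact h.abs_liftFour_le hn s
  · intro s hs
    rw [mul_assoc, ← mul_pow]
    exact le_of_tendsto (hd s).abs (h.eventually_abs_liftFour_le hs)
  · intro k
    simp only [energy_eq_tsum]
    refine tendsto_const_nhds.add (tendsto_tsum_of_dominated_convergence hbound (fun s => ?_) ?_)
    · exact ((Complex.continuous_ofReal.tendsto _).comp (hd s)).mul_const _
    · filter_upwards [eventually_ge_atTop m] with n hn s
      have : Complex.I * k * (s : ℂ) = ((k * s : ℝ) : ℂ) * Complex.I := by
        push_cast
        ring
      rw [norm_mul, this, Complex.norm_exp_ofReal_mul_I, mul_one, Complex.norm_real,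
        Real.norm_eq_abs]
      exact h.abs_liftFour_le hn s

end LongChains

end XXZ

theorem mainTheorem1 :
    ∃ K δ : ℝ, 0 < K ∧ 0 < δ ∧ ∀ m : ℕ, 0 < m → ∃ C : ℝ, ∀ ε : ℝ, K * |ε| < 1 →
      ∃ e : ∀ (N : ℕ) [NeZero N], Unknowns N m,
        (∀ (N : ℕ) [NeZero N], m < N →
          -- the solution of the fixed point equation
          (Fmap ε (e N) = e N ∧ wnorm K ε (e N) ≤ δ ∧
            ∀ e' : Unknowns N m, Fmap ε e' = e' → wnorm K ε e' ≤ δ → e' = e N) ∧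
          -- the `N` momentum eigenstates, each lowest in the sector with its momentum
          (∀ p < N,
            InSector m (droplet (e N) (momentum N p)) ∧
            droplet (e N) (momentum N p) ≠ 0 ∧
            HasMomentum (momentum N p) (droplet (e N) (momentum N p)) ∧
            hamiltonian N ε (droplet (e N) (momentum N p)) =
              energy (e N) (momentum N p) • droplet (e N) (momentum N p) ∧
            (energy (e N) (momentum N p)).im = 0 ∧
            ∀ (μ : ℝ) (φ : State N), φ ≠ 0 → InSector m φ → HasMomentum (momentum N p) φ →
              hamiltonian N ε φ = (μ : ℂ) • φ → (energy (e N) (momentum N p)).re ≤ μ) ∧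
          -- together they are the lowest `N` eigenvalues of the sector
          (∀ (μ : ℝ) (φ : State N), φ ≠ 0 → InSector m φ →
            (∀ p < N, star (droplet (e N) (momentum N p)) ⬝ᵥ φ = 0) →
              hamiltonian N ε φ = (μ : ℂ) • φ →
                ∀ p < N, (energy (e N) (momentum N p)).re < μ) ∧
          -- second lowest for `k = 0` when the two fully polarized states, which have momentum `0`
          -- and eigenvalue `0`, are added to the sector
          (HasMomentum 0 (ket (∅ : Finset (ZMod N))) ∧
            HasMomentum 0 (ket (Finset.univ : Finset (ZMod N))) ∧
            hamiltonian N ε (ket ∅) = 0 ∧ hamiltonian N ε (ket Finset.univ) = 0 ∧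
            0 < (energy (e N) 0).re ∧
            ∀ (μ : ℝ) (φ : State N), φ ≠ 0 →
              (∀ σ : Config N, φ σ ≠ 0 → numDown σ = 0 ∨ numDown σ = m ∨ numDown σ = N) →
              HasMomentum 0 φ → hamiltonian N ε φ = (μ : ℂ) • φ →
                μ = 0 ∨ (energy (e N) 0).re ≤ μ)) ∧
        -- the limit `N → ∞`; the chain has `N + 1` sites here
        ∃ d : ℤ → ℝ,
          Summable (fun s => |d s|) ∧
          (∀ s : ℤ, s ≠ 0 → |d s| ≤ C * |ε| ^ m) ∧
          ∀ k : ℝ, Filter.Tendsto (fun N : ℕ => energy (e (N + 1)) k) Filter.atTop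
            (nhds (4 + ∑' s : ℤ, (d s : ℂ) * Complex.exp (Complex.I * k * s))) := by
  refine ⟨100, 1 / 4, by norm_num, by norm_num, fun m hm => ⟨1 / 4 * 100 ^ m, fun ε hε => ?_⟩⟩
  have hsol : ∀ (N : ℕ) [NeZero N], ∃ e : Unknowns N m, m < N →
      Fmap ε e = e ∧ wnorm 100 ε e ≤ 1 / 4 ∧
        ∀ e' : Unknowns N m, Fmap ε e' = e' → wnorm 100 ε e' ≤ 1 / 4 → e' = e := by
    intro N _
    by_cases hmN : m < N
    · obtain ⟨e, he⟩ := exists_solution hm hmN hε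
      exact ⟨e, fun _ => he⟩
    · exact ⟨⟨fun _ => 0, fun _ => 0⟩, fun h => absurd h hmN⟩
  choose e he using hsol
  refine ⟨e, fun N _ hmN => ?_, ?_⟩
  · have := nontrivial_zmod_of_lt hm hmN
    obtain ⟨hfix, hnorm, huniq⟩ := he N hmN
    refine ⟨⟨hfix, hnorm, huniq⟩, fun p hp => ?_, fun μ φ hφ hsec horth heig p _ => ?_, ?_⟩
    · exact ⟨inSector_droplet hmN _ _, droplet_ne_zero hm hmN _ p, hasMomentum_droplet hmN _ p,
        hamiltonian_droplet hm hmN hfix p, energy_im hm hmN hfix p,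
        fun μ φ hφ hsec hmom heig =>
          energy_le_of_hasMomentum hm hmN hε hfix hnorm p hφ hsec hmom heig⟩
    · exact energy_lt_of_orthogonal hm hmN hε hfix hnorm hφ hsec horth heig _
    · refine ⟨hasMomentum_ket ?_, hasMomentum_ket ?_, hamiltonian_ket_of_walls_eq ε walls_empty,
        hamiltonian_ket_of_walls_eq ε walls_univ, ?_, fun μ φ hφ hsec hmom heig =>
          eq_zero_or_energy_le hm hmN hε hfix hnorm hφ hsec hmom heig⟩
      · ext x
        simp [mem_translate]
      · ext x
        simp [mem_translate]
      · have := (abs_le.1 (abs_re_energy_sub_le hm hmN hε hfix hnorm 0)).1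
        linarith
  · exact IsSolutionFamily.tendsto_energy
      ⟨hm, hε, fun N _ hmN => (he N hmN).1, fun N _ hmN => (he N hmN).2.1⟩
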